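/- Let $0<q<1$; let $a,b\in\mathbb R$ and $c,d\in\mathbb C\setminus\{0\}$ satisfy $|a|,|b|,|c|,|d|\le 1$, $ab<0$, with $c,d$ either both real or complex conjugate, and with no product of two of the four parameters $a,b,c,d$ equal to $1$. Assume also $abcd\neq q$ (so that the operator $M$ below is well defined at $n=0$). **DAHA.** Let $\mathfrak H$ be the unital complex algebra with generators $T_1,T_0,\check T_1,\check T_0$ and relations $$(T_1+ab)(T_1+1)=0,\quad (T_0+q^{-1}cd)(T_0+1)=0,\quad (a\check T_1+1)(b\check T_1+1)=0,\quad (c\check T_0+q)(d\check T_0+q)=0,\quad \check T_1T_1T_0\check T_0=1,$$ and put $Y:=T_1T_0$, $Z:=T_0\check T_0$, so $Z^{-1}=\check T_1T_1$; also $T_1^{-1}=-(ab)^{-1}T_1-((ab)^{-1}+1)$. **Basic representation, 2D form.** On Laurent polynomials $f[z]$ over $\mathbb C$ let $(Z^{-1}f)[z]=z^{-1}f[z]$, $$(T_1f)[z]=\tfrac{(a+b)z-(1+ab)}{1-z^2}f[z]+\tfrac{(1-az)(1-bz)}{1-z^2}f[z^{-1}],\qquad (T_0f)[z]=\tfrac{q^{-1}z((cd+q)z-(c+d)q)}{q-z^2}f[z]-\tfrac{(c-z)(d-z)}{q-z^2}f[qz^{-1}],$$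 and $Y=T_1T_0$. Every Laurent polynomial is uniquely $f[z]=f_1[z]+az^{-1}(1-az)(1-bz)f_2[z]$ with $f_1,f_2$ symmetric under $z\mapsto z^{-1}$; write $\vec f=(f_1,f_2)^{\rm t}$, and for an operator $A$ on Laurent polynomials let $\mathbf A$ be the corresponding operator on such vectors, $\mathbf A\vec f=\overrightarrow{Af}$. **Polynomials.** With $(x;q)_k=\prod_{j=0}^{k-1}(1-xq^j)$, $(x;q)_\infty=\prod_{j\ge0}(1-xq^j)$, let $$R_n[z;a,b,c,d|q]=\sum_{k=0}^n\frac{(q^{-n};q)_k(q^{n-1}abcd;q)_k(az;q)_k(az^{-1};q)_k}{(ab;q)_k(ac;q)_k(ad;q)_k(q;q)_k}q^k,$$ $\sigma(n)=q^{1-n}(1-q^n)(1-q^{n-1}cd)$ for $n\ge0$, $\sigma(-n)=(ab)^{-1}q^{1-n}(1-q^nab)(1-q^{n-1}abcd)$ for $n\ge1$, and for $n\in\mathbb Z$ $$\vec E_n[z]=\begin{pmatrix}R_{|n|}[z;a,b,c,d|q]\\[2pt] -\dfrac{\sigma(n)\,R_{|n|-1}[z;qa,qb,c,d|q]}{(1-qab)(1-ab)(1-ac)(1-ad)}\end{pmatrix}$$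 (second component $0$ for $n=0$). **Transform.** Let $$w_{a,b,c,d;q}[z]=\frac{(q;q)_\infty(ab;q)_\infty(ac;q)_\infty(ad;q)_\infty(bc;q)_\infty(bd;q)_\infty(cd;q)_\infty}{4\pi(abcd;q)_\infty}\left|\frac{(z^2;q)_\infty}{(az;q)_\infty(bz;q)_\infty(cz;q)_\infty(dz;q)_\infty}\right|^2,$$ $\mathbf W[z]=\mathrm{diag}(w_{a,b,c,d;q}[z],\,C\,w_{qa,qb,c,d;q}[z])$ with $C=-a^3b\frac{(1-ab)(1-qab)(1-ac)(1-ad)(1-bc)(1-bd)}{(1-abcd)(1-qabcd)}$, and for a vector $\vec f$ of symmetric Laurent polynomials $$\hat f(n)=\int_{|z|=1}(\vec f[z])^{\rm t}\,\mathbf W[z]\,\vec E_n[z]\,\frac{dz}{iz}\qquad(n\in\mathbb Z).$$ **Operators on functions of $n\in\mathbb Z$.** Let $\nu=\nu(n)=(abcd)^{-1}q^{1-n}$ for $n\ge0$ and $\nu(n)=q^{-n}$ for $n<0$. Put $N_n(g(n))=\nu(n)^{-1}g(n)$, $$\begin{aligned}M_n(g(n))={}&\tfrac{\nu(1+ab-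ab(q^{-1}cd+1)\nu)(q(c+d)-cd(a+b)\nu)}{(q-abcd\nu^2)(q-q^{-1}abcd\nu^2)}g(n)+\tfrac{(1-q^{-1}abcd\nu)(1-ab\nu)(1-ac\nu)(1-ad\nu)}{a(1-q^{-1}abcd\nu^2)(1-abcd\nu^2)}g(n-1)\\&+\tfrac{(1-q^{-1}abcd\nu)(1-ab\nu)(ab(c+d)\nu-(a+b))}{ab(1-q^{-1}abcd\nu^2)(1-abcd\nu^2)}g(-n)+\tfrac{q^2(1-q^{-1}bc\nu)(1-q^{-1}bd\nu)(1+ab-ab(q^{-1}cd+1)\nu)}{b(q-abcd\nu^2)(q-q^{-1}abcd\nu^2)}g(-n-1)\end{aligned}$$ (the second and third terms are $0$ for $n=0$), and $U_n(g(n))=(-ab-\beta(n))g(n)+\beta(n)g(-n)$, where $\beta(0)=0$ and, for $n\ge1$, $$\beta(n)=-ab\,\frac{(1-q^n)(1-q^{n-1}cd)}{1-q^{2n-1}abcd},\qquad \beta(-n)=\frac{(1-q^nab)(1-q^{n-1}abcd)}{1-q^{2n-1}abcd}.$$ **Claim.** 1. $U$ extends the action of $\mathbf T_1$ on the vectors $\vec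 E_n$: $U_n(\vec E_n)=\mathbf T_1\vec E_n$ for all $n\in\mathbb Z$. 2. For every vector $\vec f$ of symmetric Laurent polynomials and all $n\in\mathbb Z$, $$M_n(\hat f(n))=\big(\mathbf T_1\mathbf Z^{-1}\mathbf T_1^{-1}\vec f\,\big)\hat{\ }(n),\qquad N_n(\hat f(n))=(\mathbf Y\vec f\,)\hat{\ }(n),\qquad U_n(\hat f(n))=(\mathbf T_1\vec f\,)\hat{\ }(n).$$ 3. There is a unique anti-representation of $\mathfrak H$ on the space of functions $\mathbb Z\to\mathbb C$ with $T_1\mapsto U$, $Y\mapsto N$, $Z^{-1}\mapsto M$. 4. Let $\langle U,N,M\rangle$ be the unital algebra of operators on functions $\mathbb Z\to\mathbb C$ generated by $U,N,M$. There are algebra isomorphisms $$\langle U,N,M\rangle\simeq\mathfrak H\simeq\mathfrak H^{\rm opp},$$ the first one sending $U,N,M$ to $T_1,\,Y,\,T_1Z^{-1}T_1^{-1}$ and the second one sending $T_1,\,Y,\,T_1Z^{-1}T_1^{-1}$ to $T_1,\,Y,\,Z^{-1}$. -/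

import Mathlib

noncomputable section

namespace AskeyWilson

open LaurentPolynomial Finset

/-! ### Laurent polynomials, evaluation and substitutions -/

/-- Value `f[z]` of a Laurent polynomial at `z` (meaningful for `z ≠ 0`). -/
def evalAt (f : ℂ[T;T⁻¹]) (z : ℂ) : ℂ := f.coeff.sum fun n r => r * z ^ n

/-- The substitution `f[z] ↦ f[z⁻¹]`. -/
def reflect : ℂ[T;T⁻¹] →ₗ[ℂ] ℂ[T;T⁻¹] := (invert (R := ℂ)).toLinearMap

/-- The substitution `f[z] ↦ f[q z⁻¹]`. -/
def qinv (q : ℂ) : ℂ[T;T⁻¹] →ₗ[ℂ] ℂ[T;T⁻¹] where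
  toFun f := f.coeff.sum fun n r => C (r * q ^ n) * T (-n)
  map_add' f g := by
    rw [AddMonoidAlgebra.coeff_add, Finsupp.sum_add_index']
    · simp
    · intro n r s
      rw [add_mul, map_add, add_mul]
  map_smul' r f := by
    rw [AddMonoidAlgebra.coeff_smul, Finsupp.sum_smul_index']
    · rw [Finsupp.smul_sum]
      refine Finsupp.sum_congr fun n _ => ?_
      rw [RingHom.id_apply, smul_eq_C_mul, smul_eq_mul, mul_assoc, map_mul, mul_assoc]
    · simp

theorem reflect_C_mul_T (r : ℂ) (n : ℤ) : reflect (C r * T n) = C r * T (-n) := by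
  simp [reflect]

theorem reflect_mul (f g : ℂ[T;T⁻¹]) : reflect (f * g) = reflect f * reflect g := by
  simp [reflect]

theorem reflect_reflect (f : ℂ[T;T⁻¹]) : reflect (reflect f) = f := by
  simp [reflect, involutive_invert f]

theorem qinv_C_mul_T (q r : ℂ) (n : ℤ) : qinv q (C r * T n) = C (r * q ^ n) * T (-n) := by
  simp only [qinv, LinearMap.coe_mk, AddHom.coe_mk]
  rw [← single_eq_C_mul_T, AddMonoidAlgebra.coeff_single, Finsupp.sum_single_index]
  simp

theorem one_sub_T_two_dvd (n : ℤ) : (1 - T 2 : ℂ[T;T⁻¹]) ∣ T (-n) - T n := by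
  have key : ∀ m : ℕ, (1 - T 2 : ℂ[T;T⁻¹]) ∣ T (-(m : ℤ)) - T (m : ℤ) := by
    intro m
    have h : (T (-(m : ℤ)) - T (m : ℤ) : ℂ[T;T⁻¹]) = T (-(m : ℤ)) * (1 ^ m - T 2 ^ m) := by
      rw [one_pow, T_pow, mul_sub, mul_one, ← T_add]
      congr 2
      ring
    rw [h]
    exact (sub_dvd_pow_sub_pow _ _ m).mul_left _
  obtain ⟨m, rfl | rfl⟩ := n.eq_nat_or_neg
  · exact key m
  · have h := (key m).neg_right
    rw [neg_sub] at h
    rw [neg_neg]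
    exact h

theorem one_sub_dvd_reflect_sub (f : ℂ[T;T⁻¹]) : (1 - T 2 : ℂ[T;T⁻¹]) ∣ reflect f - f := by
  induction f using LaurentPolynomial.induction_on' with
  | add p r hp hr =>
    have : reflect (p + r) - (p + r) = (reflect p - p) + (reflect r - r) := by rw [map_add]; ring
    rw [this]
    exact dvd_add hp hr
  | C_mul_T n r =>
    rw [reflect_C_mul_T, ← mul_sub]
    exact (one_sub_T_two_dvd n).mul_left _

theorem q_sub_dvd_qinv_sub (q : ℂ) (f : ℂ[T;T⁻¹]) : (C q - T 2 : ℂ[T;T⁻¹]) ∣ qinv q f - f := by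
  by_cases hq : q = 0
  · subst hq
    have : IsUnit (C (0 : ℂ) - T 2 : ℂ[T;T⁻¹]) := by
      rw [map_zero, zero_sub]
      exact (isUnit_T 2).neg
    exact this.dvd
  induction f using LaurentPolynomial.induction_on' with
  | add p r hp hr =>
    have : qinv q (p + r) - (p + r) = (qinv q p - p) + (qinv q r - r) := by rw [map_add]; ring
    rw [this]
    exact dvd_add hp hr
  | C_mul_T n r =>
    rw [qinv_C_mul_T, map_mul, mul_assoc, ← mul_sub]
    refine Dvd.dvd.mul_left ?_ _
    obtain ⟨m, rfl | rfl⟩ := n.eq_nat_or_neg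
    · have h : (C (q ^ (m : ℤ)) * T (-(m : ℤ)) - T (m : ℤ) : ℂ[T;T⁻¹])
          = T (-(m : ℤ)) * (C q ^ m - T 2 ^ m) := by
        rw [T_pow, mul_sub, ← T_add, zpow_natCast, map_pow, mul_comm]
        congr 2
        ring
      rw [h]
      exact (sub_dvd_pow_sub_pow _ _ m).mul_left _
    · have h : (C (q ^ (-(m : ℤ))) * T (-(-(m : ℤ))) - T (-(m : ℤ)) : ℂ[T;T⁻¹])
          = -(C (q ^ (-(m : ℤ))) * T (-(m : ℤ)) * (C q ^ m - T 2 ^ m)) := by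
        have h1 : (C (q ^ (-(m : ℤ))) * C q ^ m : ℂ[T;T⁻¹]) = 1 := by
          rw [← map_pow, ← map_mul, zpow_neg, zpow_natCast, inv_mul_cancel₀ (pow_ne_zero m hq),
            map_one]
        have h2 : (T (-(m : ℤ)) * T 2 ^ m : ℂ[T;T⁻¹]) = T (m : ℤ) := by
          rw [T_pow, ← T_add]
          congr 1
          ring
        rw [neg_neg]
        linear_combination (T (-(m : ℤ)) : ℂ[T;T⁻¹]) * h1
          - (C (q ^ (-(m : ℤ))) : ℂ[T;T⁻¹]) * h2
      rw [h]
      exact ((sub_dvd_pow_sub_pow _ _ m).mul_left _).neg_right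

theorem one_sub_T_two_ne_zero : (1 - T 2 : ℂ[T;T⁻¹]) ≠ 0 := by
  intro h
  have := congrArg (fun f : ℂ[T;T⁻¹] => f.coeff 2) h
  rw [← single_zero_one_eq_one, T] at this
  simp [-single_eq_C_mul_T, AddMonoidAlgebra.coeff_single] at this

theorem C_sub_T_two_ne_zero (q : ℂ) : (C q - T 2 : ℂ[T;T⁻¹]) ≠ 0 := by
  intro h
  have := congrArg (fun f : ℂ[T;T⁻¹] => f.coeff 2) h
  rw [← single_eq_C, T] at this
  simp [-single_eq_C_mul_T, AddMonoidAlgebra.coeff_single] at this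

/-- The linear map `f ↦ L f / g`, for a linear map `L` all of whose values are divisible
by `g` in the ring of Laurent polynomials. -/
def divMap (g : ℂ[T;T⁻¹]) (hg : g ≠ 0) (L : ℂ[T;T⁻¹] →ₗ[ℂ] ℂ[T;T⁻¹]) (h : ∀ f, g ∣ L f) :
    ℂ[T;T⁻¹] →ₗ[ℂ] ℂ[T;T⁻¹] where
  toFun f := (h f).choose
  map_add' x y := by
    apply mul_left_cancel₀ hg
    rw [mul_add, ← (h (x + y)).choose_spec, ← (h x).choose_spec, ← (h y).choose_spec, map_add]
  map_smul' r x := by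
    apply mul_left_cancel₀ hg
    rw [RingHom.id_apply, mul_smul_comm, ← (h (r • x)).choose_spec, ← (h x).choose_spec,
      map_smul]

theorem mul_divMap (g : ℂ[T;T⁻¹]) (hg : g ≠ 0) (L : ℂ[T;T⁻¹] →ₗ[ℂ] ℂ[T;T⁻¹])
    (h : ∀ f, g ∣ L f) (f : ℂ[T;T⁻¹]) : g * divMap g hg L h f = L f :=
  (h f).choose_spec.symm

/-! ### The basic representation on Laurent polynomials -/

/-- `(1 - z²)` times the operator `T₁`:
`((a + b) z - (1 + a b)) f[z] + (1 - a z) (1 - b z) f[z⁻¹]`. -/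
def numT1 (a b : ℂ) : ℂ[T;T⁻¹] →ₗ[ℂ] ℂ[T;T⁻¹] :=
  LinearMap.mulLeft ℂ (C (a + b) * T 1 - C (1 + a * b)) +
    LinearMap.mulLeft ℂ ((1 - C a * T 1) * (1 - C b * T 1)) ∘ₗ reflect

theorem dvd_numT1 (a b : ℂ) (f : ℂ[T;T⁻¹]) : (1 - T 2 : ℂ[T;T⁻¹]) ∣ numT1 a b f := by
  have h2 : (T 2 : ℂ[T;T⁻¹]) = T 1 * T 1 := by rw [← T_add]; rfl
  have : numT1 a b f = (1 - T 2) * (-(C (a * b)) * f)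
      + (1 - C a * T 1) * (1 - C b * T 1) * (reflect f - f) := by
    simp only [numT1, LinearMap.add_apply, LinearMap.mulLeft_apply, LinearMap.comp_apply,
      map_add, map_mul, map_one, h2]
    ring
  rw [this]
  exact dvd_add (dvd_mul_right _ _) ((one_sub_dvd_reflect_sub f).mul_left _)

/-- The operator `T₁`:
`(T₁ f)[z] = (((a+b)z - (1+ab)) / (1-z²)) f[z] + ((1-az)(1-bz) / (1-z²)) f[z⁻¹]`. -/
def opT1 (a b : ℂ) : ℂ[T;T⁻¹] →ₗ[ℂ] ℂ[T;T⁻¹] :=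
  divMap (1 - T 2) one_sub_T_two_ne_zero (numT1 a b) (dvd_numT1 a b)

/-- `(q - z²)` times the operator `T₀`:
`q⁻¹ z ((c d + q) z - (c + d) q) f[z] - (c - z) (d - z) f[q z⁻¹]`. -/
def numT0 (c d q : ℂ) : ℂ[T;T⁻¹] →ₗ[ℂ] ℂ[T;T⁻¹] :=
  LinearMap.mulLeft ℂ (C q⁻¹ * T 1 * (C (c * d + q) * T 1 - C ((c + d) * q))) -
    LinearMap.mulLeft ℂ ((C c - T 1) * (C d - T 1)) ∘ₗ qinv q

theorem dvd_numT0 (c d q : ℂ) (f : ℂ[T;T⁻¹]) : (C q - T 2 : ℂ[T;T⁻¹]) ∣ numT0 c d q f := by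
  by_cases hq : q = 0
  · subst hq
    have : IsUnit (C (0 : ℂ) - T 2 : ℂ[T;T⁻¹]) := by
      rw [map_zero, zero_sub]
      exact (isUnit_T 2).neg
    exact this.dvd
  have h2 : (T 2 : ℂ[T;T⁻¹]) = T 1 * T 1 := by rw [← T_add]; rfl
  have hqq : (C q⁻¹ * C q : ℂ[T;T⁻¹]) = 1 := by
    rw [← map_mul, inv_mul_cancel₀ hq, map_one]
  have : numT0 c d q f = (C q - T 2) * (-(C (c * d * q⁻¹)) * f)
      - (C c - T 1) * (C d - T 1) * (qinv q f - f) := by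
    simp only [numT0, LinearMap.sub_apply, LinearMap.mulLeft_apply, LinearMap.comp_apply,
      map_add, map_mul, h2]
    linear_combination ((T 1 * T 1 - (C c + C d) * T 1 + C c * C d) * f) * hqq
  rw [this]
  exact dvd_sub (dvd_mul_right _ _) ((q_sub_dvd_qinv_sub q f).mul_left _)

/-- The operator `T₀`:
`(T₀ f)[z] = (q⁻¹z((cd+q)z - (c+d)q) / (q-z²)) f[z] - ((c-z)(d-z) / (q-z²)) f[q z⁻¹]`. -/
def opT0 (c d q : ℂ) : ℂ[T;T⁻¹] →ₗ[ℂ] ℂ[T;T⁻¹] :=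
  divMap (C q - T 2) (C_sub_T_two_ne_zero q) (numT0 c d q) (dvd_numT0 c d q)

/-- The operator `T₁⁻¹ = -(ab)⁻¹ T₁ - ((ab)⁻¹ + 1)`. -/
def opT1Inv (a b : ℂ) : ℂ[T;T⁻¹] →ₗ[ℂ] ℂ[T;T⁻¹] :=
  -(a * b)⁻¹ • opT1 a b - ((a * b)⁻¹ + 1) • LinearMap.id

/-- The operator `Y = T₁ T₀`. -/
def opY (a b c d q : ℂ) : ℂ[T;T⁻¹] →ₗ[ℂ] ℂ[T;T⁻¹] := opT1 a b ∘ₗ opT0 c d q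

/-- The operator `Z⁻¹`: `(Z⁻¹ f)[z] = z⁻¹ f[z]`. -/
def opZInv : ℂ[T;T⁻¹] →ₗ[ℂ] ℂ[T;T⁻¹] := LinearMap.mulLeft ℂ (T (-1))

/-! ### The 2D realization -/

/-- The space of symmetric Laurent polynomials, `f[z] = f[z⁻¹]`. -/
def Sym : Submodule ℂ ℂ[T;T⁻¹] where
  carrier := {f | reflect f = f}
  add_mem' {f g} hf hg := by
    rw [Set.mem_ofPred_eq] at *
    rw [map_add, hf, hg]
  zero_mem' := map_zero _
  smul_mem' r f hf := by
    rw [Set.mem_ofPred_eq] at *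
    rw [map_smul, hf]

/-- The 2-vectors `(f₁, f₂)` of symmetric Laurent polynomials. -/
abbrev Vec2 : Type := Sym × Sym

/-- The Laurent polynomial `f[z] = f₁[z] + a z⁻¹ (1 - a z) (1 - b z) f₂[z]` with vector
`(f₁, f₂)`. -/
def ofVec (a b : ℂ) : Vec2 →ₗ[ℂ] ℂ[T;T⁻¹] :=
  Sym.subtype ∘ₗ LinearMap.fst ℂ Sym Sym +
    LinearMap.mulLeft ℂ (C a * T (-1) * (1 - C a * T 1) * (1 - C b * T 1)) ∘ₗ
      Sym.subtype ∘ₗ LinearMap.snd ℂ Sym Sym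

/-- `(z - a) (z - b) f[z] - (1 - a z) (1 - b z) f[z⁻¹]`. -/
def numFst (a b : ℂ) : ℂ[T;T⁻¹] →ₗ[ℂ] ℂ[T;T⁻¹] :=
  LinearMap.mulLeft ℂ ((T 1 - C a) * (T 1 - C b)) -
    LinearMap.mulLeft ℂ ((1 - C a * T 1) * (1 - C b * T 1)) ∘ₗ reflect

theorem dvd_numFst (a b : ℂ) (f : ℂ[T;T⁻¹]) : (1 - T 2 : ℂ[T;T⁻¹]) ∣ numFst a b f := by
  have h2 : (T 2 : ℂ[T;T⁻¹]) = T 1 * T 1 := by rw [← T_add]; rfl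
  have : numFst a b f = (1 - T 2) * ((C (a * b) - 1) * f)
      - (1 - C a * T 1) * (1 - C b * T 1) * (reflect f - f) := by
    simp only [numFst, LinearMap.sub_apply, LinearMap.mulLeft_apply, LinearMap.comp_apply,
      map_mul, h2]
    ring
  rw [this]
  exact dvd_sub (dvd_mul_right _ _) ((one_sub_dvd_reflect_sub f).mul_left _)

/-- `f[z] - f[z⁻¹]`. -/
def numSnd : ℂ[T;T⁻¹] →ₗ[ℂ] ℂ[T;T⁻¹] := LinearMap.id - reflect

theorem T_sub_T_neg_eq : (T 1 - T (-1) : ℂ[T;T⁻¹]) = -T (-1) * (1 - T 2) := by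
  have : (T (-1) * T 2 : ℂ[T;T⁻¹]) = T 1 := by rw [← T_add]; rfl
  linear_combination -this

theorem T_sub_T_neg_ne_zero : (T 1 - T (-1) : ℂ[T;T⁻¹]) ≠ 0 := by
  rw [T_sub_T_neg_eq]
  exact mul_ne_zero (neg_ne_zero.mpr (isUnit_T (-1)).ne_zero) one_sub_T_two_ne_zero

theorem dvd_numSnd (f : ℂ[T;T⁻¹]) : (T 1 - T (-1) : ℂ[T;T⁻¹]) ∣ numSnd f := by
  rw [T_sub_T_neg_eq]
  have h : numSnd f = -(reflect f - f) := by
    simp only [numSnd, LinearMap.sub_apply, LinearMap.id_apply]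
    ring
  rw [h, (isUnit_T (R := ℂ) (-1)).neg.mul_left_dvd]
  exact (one_sub_dvd_reflect_sub f).neg_right

theorem divFst_mem (a b : ℂ) (f : ℂ[T;T⁻¹]) :
    divMap (1 - T 2) one_sub_T_two_ne_zero (numFst a b) (dvd_numFst a b) f ∈ Sym := by
  set u := divMap (1 - T 2) one_sub_T_two_ne_zero (numFst a b) (dvd_numFst a b) f with hu
  have h := mul_divMap (1 - T 2) one_sub_T_two_ne_zero (numFst a b) (dvd_numFst a b) f
  rw [← hu] at h
  have hT : (T (-1) * T 1 : ℂ[T;T⁻¹]) = 1 := by rw [← T_add]; exact T_zero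
  have h2 : (T 2 : ℂ[T;T⁻¹]) = T 1 * T 1 := by rw [← T_add]; rfl
  have i1 : reflect (T 1) = T (-1) := by simpa using reflect_C_mul_T 1 1
  have i2 : reflect (T 2) = T (-1) * T (-1) := by
    rw [← T_add]; simpa using reflect_C_mul_T 1 2
  have iC : ∀ r : ℂ, reflect (C r) = C r := fun r => by simpa using reflect_C_mul_T r 0
  have i0 : reflect 1 = 1 := by simpa using iC 1
  have h' := congrArg reflect h
  simp only [numFst, LinearMap.sub_apply, LinearMap.mulLeft_apply, LinearMap.comp_apply,
    reflect_mul, map_sub, i1, i2, i0, iC, reflect_reflect] at h'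
  simp only [numFst, LinearMap.sub_apply, LinearMap.mulLeft_apply, LinearMap.comp_apply] at h
  change reflect u = u
  apply mul_left_cancel₀ one_sub_T_two_ne_zero
  rw [h, h2]
  generalize reflect u = v at *
  generalize reflect f = g at *
  generalize (T (-1) : ℂ[T;T⁻¹]) = s at *
  generalize (T 1 : ℂ[T;T⁻¹]) = t at *
  generalize (C a : ℂ[T;T⁻¹]) = A at *
  generalize (C b : ℂ[T;T⁻¹]) = B at *
  clear h i1 i2 iC i0 h2 hu
  have e : s * t = 1 := hT
  have key : t * t * ((1 - s * s) * v)
      = t * t * ((s - A) * (s - B) * g - (1 - A * s) * (1 - B * s) * f) := by rw [h']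
  have e1 : t * t * ((1 - s * s) * v) = (t * t - 1) * v := by
    linear_combination (-(s * t + 1) * v) * e
  have e2 : t * t * ((s - A) * (s - B) * g - (1 - A * s) * (1 - B * s) * f)
      = (1 - A * t) * (1 - B * t) * g - (t - A) * (t - B) * f := by
    linear_combination
      ((s * t + 1 - (A + B) * t) * g - (A * B * (s * t + 1) - (A + B) * t) * f) * e
  rw [e1, e2] at key
  linear_combination -key

theorem divSnd_mem (f : ℂ[T;T⁻¹]) :
    divMap (T 1 - T (-1)) T_sub_T_neg_ne_zero numSnd dvd_numSnd f ∈ Sym := by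
  set u := divMap (T 1 - T (-1)) T_sub_T_neg_ne_zero numSnd dvd_numSnd f with hu
  have h := mul_divMap (T 1 - T (-1)) T_sub_T_neg_ne_zero numSnd dvd_numSnd f
  rw [← hu] at h
  have i1 : reflect (T 1) = T (-1) := by simpa using reflect_C_mul_T 1 1
  have i2 : reflect (T (-1)) = T 1 := by simpa using reflect_C_mul_T 1 (-1)
  have h' := congrArg reflect h
  simp only [numSnd, LinearMap.sub_apply, LinearMap.id_apply, reflect_mul, map_sub, i1, i2,
    reflect_reflect] at h'
  simp only [numSnd, LinearMap.sub_apply, LinearMap.id_apply] at h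
  change reflect u = u
  apply mul_left_cancel₀ T_sub_T_neg_ne_zero
  linear_combination -h' - h

/-- The first component of the vector of `f`:
`f₁[z] = ((z-a)(z-b) f[z] - (1-az)(1-bz) f[z⁻¹]) / ((ab-1)(1-z²))`. -/
def vecFst (a b : ℂ) : ℂ[T;T⁻¹] →ₗ[ℂ] Sym :=
  (a * b - 1)⁻¹ • LinearMap.codRestrict Sym
    (divMap (1 - T 2) one_sub_T_two_ne_zero (numFst a b) (dvd_numFst a b)) (divFst_mem a b)

/-- The second component of the vector of `f`:
`f₂[z] = (f[z] - f[z⁻¹]) / (a (ab-1) (z - z⁻¹))`. -/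
def vecSnd (a b : ℂ) : ℂ[T;T⁻¹] →ₗ[ℂ] Sym :=
  (a * (a * b - 1))⁻¹ • LinearMap.codRestrict Sym
    (divMap (T 1 - T (-1)) T_sub_T_neg_ne_zero numSnd dvd_numSnd) divSnd_mem

/-- The vector `(f₁, f₂)` of a Laurent polynomial `f`; inverse of `ofVec` if `a ≠ 0`, `ab ≠ 1`. -/
def vec (a b : ℂ) : ℂ[T;T⁻¹] →ₗ[ℂ] Vec2 := (vecFst a b).prod (vecSnd a b)

/-- The `2 × 2` matrix-valued operator `𝐀` on 2-vectors of symmetric Laurent polynomials that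
corresponds to an operator `A` on Laurent polynomials. -/
def bold (a b : ℂ) (A : ℂ[T;T⁻¹] →ₗ[ℂ] ℂ[T;T⁻¹]) : Vec2 →ₗ[ℂ] Vec2 :=
  vec a b ∘ₗ A ∘ₗ ofVec a b

/-- The operator `𝐓₁`. -/
def boldT1 (a b : ℂ) : Vec2 →ₗ[ℂ] Vec2 := bold a b (opT1 a b)

/-- The operator `𝐓₁⁻¹`. -/
def boldT1Inv (a b : ℂ) : Vec2 →ₗ[ℂ] Vec2 := bold a b (opT1Inv a b)

/-- The operator `𝐘`. -/
def boldY (a b c d q : ℂ) : Vec2 →ₗ[ℂ] Vec2 := bold a b (opY a b c d q)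

/-- The operator `𝐙⁻¹`. -/
def boldZInv (a b : ℂ) : Vec2 →ₗ[ℂ] Vec2 := bold a b opZInv

/-! ### Askey-Wilson polynomials and vector-valued non-symmetric Askey-Wilson polynomials -/

/-- The `q`-shifted factorial `(x; q)_k`. -/
def qPoch (x q : ℂ) (k : ℕ) : ℂ := ∏ j ∈ range k, (1 - x * q ^ j)

/-- The infinite `q`-shifted factorial `(x; q)_∞`. -/
def qPochInf (x q : ℂ) : ℂ := ∏' j : ℕ, (1 - x * q ^ j)

/-- `(a z; q)_k (a z⁻¹; q)_k` as a Laurent polynomial in `z`. -/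
def awFactor (a q : ℂ) (k : ℕ) : ℂ[T;T⁻¹] :=
  ∏ j ∈ range k, ((1 - C (a * q ^ j) * T 1) * (1 - C (a * q ^ j) * T (-1)))

/-- The Askey-Wilson polynomial `R_n[z; a,b,c,d | q]`, the terminating `₄φ₃` with upper
parameters `q⁻ⁿ, qⁿ⁻¹abcd, az, az⁻¹`, lower parameters `ab, ac, ad` and argument `q`. -/
def awR (n : ℕ) (a b c d q : ℂ) : ℂ[T;T⁻¹] :=
  ∑ k ∈ range (n + 1),
    (qPoch (q ^ (-(n : ℤ))) q k * qPoch (q ^ ((n : ℤ) - 1) * (a * b * c * d)) q k /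
      (qPoch (a * b) q k * qPoch (a * c) q k * qPoch (a * d) q k * qPoch q q k) * q ^ k) •
      awFactor a q k

theorem awFactor_mem (a q : ℂ) (k : ℕ) : awFactor a q k ∈ Sym := by
  change reflect (awFactor a q k) = awFactor a q k
  unfold awFactor reflect
  simp only [AlgEquiv.toLinearMap_apply, map_prod, map_mul, map_sub, map_one, invert_T, invert_C,
    neg_neg]
  exact Finset.prod_congr rfl fun j _ => mul_comm _ _

theorem awR_mem (n : ℕ) (a b c d q : ℂ) : awR n a b c d q ∈ Sym :=
  Submodule.sum_mem _ fun k _ => Submodule.smul_mem _ _ (awFactor_mem a q k)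

/-- `σ(n) = q^{1-n} (1-qⁿ) (1-q^{n-1}cd)` for `n ≥ 0` and
`σ(-n) = (ab)⁻¹ q^{1-n} (1-qⁿab) (1-q^{n-1}abcd)` for `n ≥ 1`. -/
def sigma (a b c d q : ℂ) (n : ℤ) : ℂ :=
  if 0 ≤ n then q ^ (1 - n) * (1 - q ^ n) * (1 - q ^ (n - 1) * (c * d))
  else (a * b)⁻¹ * q ^ (1 + n) * (1 - q ^ (-n) * (a * b)) * (1 - q ^ (-n - 1) * (a * b * c * d))

/-- The vector-valued non-symmetric Askey-Wilson polynomial `E_n` (`n ∈ ℤ`), with components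
`R_{|n|}[z; a,b,c,d | q]` and
`-σ(n) R_{|n|-1}[z; qa,qb,c,d | q] / ((1-qab)(1-ab)(1-ac)(1-ad))`. For `n = 0` the second
component is `0`, since `σ(0) = 0`. -/
def vecE (a b c d q : ℂ) (n : ℤ) : Vec2 :=
  (⟨awR n.natAbs a b c d q, awR_mem _ _ _ _ _ _⟩,
    (-sigma a b c d q n / ((1 - q * a * b) * (1 - a * b) * (1 - a * c) * (1 - a * d))) •
      (⟨awR (n.natAbs - 1) (q * a) (q * b) c d q, awR_mem _ _ _ _ _ _⟩ : Sym))

/-! ### The weight and the Fourier-type transform -/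

/-- The weight function `w_{a,b,c,d;q}[z]`. -/
def weight (a b c d q z : ℂ) : ℂ :=
  (qPochInf q q * qPochInf (a * b) q * qPochInf (a * c) q * qPochInf (a * d) q *
      qPochInf (b * c) q * qPochInf (b * d) q * qPochInf (c * d) q) /
    (4 * (Real.pi : ℂ) * qPochInf (a * b * c * d) q) *
    (‖qPochInf (z ^ 2) q / (qPochInf (a * z) q * qPochInf (b * z) q * qPochInf (c * z) q *
      qPochInf (d * z) q)‖ ^ 2 : ℝ)

/-- The constant `C_{a,b,c,d;q}`. -/
def constC (a b c d q : ℂ) : ℂ :=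
  -a ^ 3 * b * ((1 - a * b) * (1 - q * a * b) * (1 - a * c) * (1 - a * d) * (1 - b * c) *
    (1 - b * d)) / ((1 - a * b * c * d) * (1 - q * a * b * c * d))

/-- The diagonal matrix weight `𝐖[z]`. -/
def matW (a b c d q z : ℂ) : Matrix (Fin 2) (Fin 2) ℂ :=
  !![weight a b c d q z, 0; 0, constC a b c d q * weight (q * a) (q * b) c d q z]

/-- The value of a 2-vector of Laurent polynomials at `z`. -/
def evalVec (f : Vec2) (z : ℂ) : Fin 2 → ℂ := ![evalAt f.1 z, evalAt f.2 z]

/-- The transform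
`f^(n) = ∫_{|z|=1} (f[z])ᵗ 𝐖[z] E_n[z] dz/(iz)`, `n ∈ ℤ`, of a 2-vector `f`. -/
def awTransform (a b c d q : ℂ) (f : Vec2) (n : ℤ) : ℂ :=
  ∮ z in C(0, 1),
    (evalVec f z ⬝ᵥ (matW a b c d q z).mulVec (evalVec (vecE a b c d q n) z)) / (Complex.I * z)

/-! ### The operators `M`, `N`, `U` on functions of `n ∈ ℤ`

They act on functions with values in an arbitrary complex vector space `X`. -/

/-- `ν(n) = (abcd)⁻¹ q^{1-n}` for `n ≥ 0` and `ν(n) = q^{-n}` for `n < 0`. -/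
def nuSeq (a b c d q : ℂ) (n : ℤ) : ℂ :=
  if 0 ≤ n then (a * b * c * d)⁻¹ * q ^ (1 - n) else q ^ (-n)

/-- The coefficient of `g(n)` in `M_n(g(n))`, in terms of `v = ν(n)`. -/
def coefM1 (a b c d q v : ℂ) : ℂ :=
  v * (1 + a * b - a * b * (q⁻¹ * c * d + 1) * v) * (q * (c + d) - c * d * (a + b) * v) /
    ((q - a * b * c * d * v ^ 2) * (q - q⁻¹ * a * b * c * d * v ^ 2))

/-- The coefficient of `g(n-1)` in `M_n(g(n))`, in terms of `v = ν(n)`. -/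
def coefM2 (a b c d q v : ℂ) : ℂ :=
  (1 - q⁻¹ * a * b * c * d * v) * (1 - a * b * v) * (1 - a * c * v) * (1 - a * d * v) /
    (a * (1 - q⁻¹ * a * b * c * d * v ^ 2) * (1 - a * b * c * d * v ^ 2))

/-- The coefficient of `g(-n)` in `M_n(g(n))`, in terms of `v = ν(n)`. -/
def coefM3 (a b c d q v : ℂ) : ℂ :=
  (1 - q⁻¹ * a * b * c * d * v) * (1 - a * b * v) * (a * b * (c + d) * v - (a + b)) /
    (a * b * (1 - q⁻¹ * a * b * c * d * v ^ 2) * (1 - a * b * c * d * v ^ 2))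

/-- The coefficient of `g(-n-1)` in `M_n(g(n))`, in terms of `v = ν(n)`. -/
def coefM4 (a b c d q v : ℂ) : ℂ :=
  q ^ 2 * (1 - q⁻¹ * b * c * v) * (1 - q⁻¹ * b * d * v) *
      (1 + a * b - a * b * (q⁻¹ * c * d + 1) * v) /
    (b * (q - a * b * c * d * v ^ 2) * (q - q⁻¹ * a * b * c * d * v ^ 2))

/-- The operator on functions of `n ∈ ℤ` sending `g` to
`n ↦ k₁(n) g(n) + k₂(n) g(n-1) + k₃(n) g(-n) + k₄(n) g(-n-1)`. -/
def bandOp (X : Type*) [AddCommGroup X] [Module ℂ X] (k₁ k₂ k₃ k₄ : ℤ → ℂ) :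
    Module.End ℂ (ℤ → X) where
  toFun g n := k₁ n • g n + k₂ n • g (n - 1) + k₃ n • g (-n) + k₄ n • g (-n - 1)
  map_add' g h := by
    funext n
    simp only [Pi.add_apply, smul_add]
    abel
  map_smul' r g := by
    funext n
    simp only [Pi.smul_apply, RingHom.id_apply, smul_add, smul_comm r]

/-- The operator `M_n`. -/
def opM (X : Type*) [AddCommGroup X] [Module ℂ X] (a b c d q : ℂ) : Module.End ℂ (ℤ → X) :=
  bandOp X (fun n => coefM1 a b c d q (nuSeq a b c d q n)) (fun n => coefM2 a b c d q (nuSeq a b c d q n))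
    (fun n => coefM3 a b c d q (nuSeq a b c d q n)) (fun n => coefM4 a b c d q (nuSeq a b c d q n))

/-- The multiplication operator `N_n(g(n)) = ν(n)⁻¹ g(n)`. -/
def opN (X : Type*) [AddCommGroup X] [Module ℂ X] (a b c d q : ℂ) : Module.End ℂ (ℤ → X) :=
  bandOp X (fun n => (nuSeq a b c d q n)⁻¹) 0 0 0

/-- The coefficient of `g(-n)` in `U_n(g(n))`: for `n ≥ 0` it is
`-ab (1-qⁿ) (1-q^{n-1}cd) / (1-q^{2n-1}abcd)` (zero for `n = 0`), and for `n = -m < 0` it is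
`(1-q^m ab) (1-q^{m-1}abcd) / (1-q^{2m-1}abcd)`. -/
def coefU (a b c d q : ℂ) (n : ℤ) : ℂ :=
  if 0 ≤ n then
    -(a * b) * (1 - q ^ n) * (1 - q ^ (n - 1) * (c * d)) /
      (1 - q ^ (2 * n - 1) * (a * b * c * d))
  else
    (1 - q ^ (-n) * (a * b)) * (1 - q ^ (-n - 1) * (a * b * c * d)) /
      (1 - q ^ (-2 * n - 1) * (a * b * c * d))

/-- The operator `U_n(g(n)) = (-ab - β(n)) g(n) + β(n) g(-n)`, with `β = coefU`. -/
def opU (X : Type*) [AddCommGroup X] [Module ℂ X] (a b c d q : ℂ) : Module.End ℂ (ℤ → X) :=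
  bandOp X (fun n => -(a * b) - coefU a b c d q n) 0 (coefU a b c d q) 0

/-! ### The Askey-Wilson DAHA -/

/-- Names of the generators `T₁, T₀, Ť₁, Ť₀`. -/
inductive Gen : Type
  | t1 | t0 | ct1 | ct0

/-- The defining relations of the Askey-Wilson DAHA. -/
inductive DahaRel (a b c d q : ℂ) : FreeAlgebra ℂ Gen → FreeAlgebra ℂ Gen → Prop
  | t1 : DahaRel a b c d q
      ((FreeAlgebra.ι ℂ Gen.t1 + algebraMap ℂ _ (a * b)) * (FreeAlgebra.ι ℂ Gen.t1 + 1)) 0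
  | t0 : DahaRel a b c d q
      ((FreeAlgebra.ι ℂ Gen.t0 + algebraMap ℂ _ (q⁻¹ * c * d)) * (FreeAlgebra.ι ℂ Gen.t0 + 1)) 0
  | ct1 : DahaRel a b c d q
      ((a • FreeAlgebra.ι ℂ Gen.ct1 + 1) * (b • FreeAlgebra.ι ℂ Gen.ct1 + 1)) 0
  | ct0 : DahaRel a b c d q
      ((c • FreeAlgebra.ι ℂ Gen.ct0 + algebraMap ℂ _ q) *
        (d • FreeAlgebra.ι ℂ Gen.ct0 + algebraMap ℂ _ q)) 0
  | prod : DahaRel a b c d q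
      (FreeAlgebra.ι ℂ Gen.ct1 * FreeAlgebra.ι ℂ Gen.t1 * FreeAlgebra.ι ℂ Gen.t0 *
        FreeAlgebra.ι ℂ Gen.ct0) 1

/-- The Askey-Wilson DAHA with parameters `a, b, c, d; q`. -/
abbrev Daha (a b c d q : ℂ) : Type := RingQuot (DahaRel a b c d q)

/-- The generators of the Askey-Wilson DAHA. -/
def Daha.gen (a b c d q : ℂ) (g : Gen) : Daha a b c d q :=
  RingQuot.mkAlgHom ℂ (DahaRel a b c d q) (FreeAlgebra.ι ℂ g)

/-- The element `T₁`. -/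
def Daha.T1 (a b c d q : ℂ) : Daha a b c d q := Daha.gen a b c d q Gen.t1

/-- The element `T₁⁻¹ = -(ab)⁻¹ T₁ - ((ab)⁻¹ + 1)`. -/
def Daha.T1Inv (a b c d q : ℂ) : Daha a b c d q :=
  -(a * b)⁻¹ • Daha.T1 a b c d q - algebraMap ℂ _ ((a * b)⁻¹ + 1)

/-- The element `Y = T₁ T₀`. -/
def Daha.Y (a b c d q : ℂ) : Daha a b c d q := Daha.T1 a b c d q * Daha.gen a b c d q Gen.t0

/-- The element `Z⁻¹ = Ť₁ T₁`, the inverse of `Z = T₀ Ť₀`. -/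
def Daha.ZInv (a b c d q : ℂ) : Daha a b c d q := Daha.gen a b c d q Gen.ct1 * Daha.T1 a b c d q

/-- The algebra of operators on complex-valued functions of `n ∈ ℤ` generated by `U`, `N`, `M`. -/
def opAlgebra (a b c d q : ℂ) : Subalgebra ℂ (Module.End ℂ (ℤ → ℂ)) :=
  Algebra.adjoin ℂ {opU ℂ a b c d q, opN ℂ a b c d q, opM ℂ a b c d q}

end AskeyWilson

end

open AskeyWilson

noncomputable section

namespace AskeyWilson

open LaurentPolynomial Finset

section
/-! ### Elementary facts on substitutions and evaluation -/

/-! Everything is read off from the basic representation on Laurent polynomials, where the vectors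
`E_n` become scalar polynomials `polyE` (`ofVec_vecE`). In this family `Y` is diagonal with
eigenvalue `ν(n)⁻¹`, `T₁` mixes only `E_n` and `E_{-n}`, and `Ť₁ = Z⁻¹ T₁⁻¹` mixes only `E_n` and
`E_{-n-1}` (`opY_polyE`, `opT1_polyE`, `opCT1_polyE`). Hence `U` and `N` are `T₁` and `Y` in this
family, and the four-term operator `M` is the composite `Z⁻¹ = Ť₁ T₁`. The three actions are checked
by expanding in `ψ_k = (az;q)_k (qa/z;q)_k` and `χ_k = (az;q)_{k+1} (qa/z;q)_k` (`psiL`, `chiL`):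
`ψ_k` is invariant under `z ↦ q/z`, hence an eigenvector of `T₀`, while `T₀ χ_k` and the products of
`z⁻¹` with `ψ_k` and `χ_k` involve only neighbouring elements.

The `E_n` form a basis: they are nonzero eigenvectors of `Y` with distinct eigenvalues, and their
span contains `1` and is stable under `Z` and `Z⁻¹`. Transposing operators with respect to this
basis turns the basic representation into the anti-representation on functions of `n`, so that no
relation has to be verified for `U`, `N`, `M` themselves.

For the transform, put `⟨f, g⟩` for the integral of the first component of the vector of `f g`
against the scalar weight. Up to a constant, `f^(n) = ⟨f, T₁⁻¹ E_n⟩` (`awTransform_eq`).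
Multiplication operators are trivially self-adjoint for this form, `T₁` is because it is diagonal in
the two components, and `T₀` is by a shift of the contour along `z ↦ q/z` (`moment_vecFst_opT0`).
Moving operators across the form gives the three intertwining relations.

For the isomorphisms two more facts are needed. The basic representation is faithful
(`Admissible.rep_injective`): the algebra is spanned by Laurent polynomials in `Y` times alternating
words in `T₁`, `Ť₁`, and in the order `E_0, E_{-1}, E_1, E_{-2}, …` the two letters alternately
raise the index with nonzero coefficient. And there is an anti-involution fixing `T₁`, `Ť₁`, `Y`
(`Daha.anti`); composing it with the anti-representation gives a faithful representation with image
`⟨U, N, M⟩`. -/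

theorem T_neg_one_mul_T_one : (T (-1) * T 1 : ℂ[T;T⁻¹]) = 1 := by
  rw [← T_add]; exact T_zero

theorem T_two_eq : (T 2 : ℂ[T;T⁻¹]) = T 1 * T 1 := by
  rw [← T_add]; rfl

theorem reflect_T (n : ℤ) : reflect (T n) = T (-n) := by
  simpa using reflect_C_mul_T 1 n

theorem reflect_C (r : ℂ) : reflect (C r) = C r := by
  simpa using reflect_C_mul_T r 0

theorem reflect_one : reflect 1 = 1 := by
  simpa using reflect_C 1

theorem qinv_T (q : ℂ) (n : ℤ) : qinv q (T n) = C (q ^ n) * T (-n) := by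
  simpa using qinv_C_mul_T q 1 n

theorem qinv_C (q r : ℂ) : qinv q (C r) = C r := by
  simpa using qinv_C_mul_T q r 0

theorem qinv_one (q : ℂ) : qinv q 1 = 1 := by
  simpa using qinv_C q 1

theorem qinv_mul {q : ℂ} (hq : q ≠ 0) (f g : ℂ[T;T⁻¹]) :
    qinv q (f * g) = qinv q f * qinv q g := by
  induction f using LaurentPolynomial.induction_on' with
  | add p r hp hr => rw [add_mul, map_add, map_add, hp, hr, add_mul]
  | C_mul_T n r =>
    induction g using LaurentPolynomial.induction_on' with
    | add p r hp hr => rw [mul_add, map_add, map_add, hp, hr, mul_add]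
    | C_mul_T m s =>
      have h : (C r * T n * (C s * T m) : ℂ[T;T⁻¹]) = C (r * s) * T (n + m) := by
        rw [map_mul, T_add]; ring
      rw [h, qinv_C_mul_T, qinv_C_mul_T, qinv_C_mul_T, zpow_add₀ hq, neg_add, T_add]
      simp only [map_mul]
      ring

theorem qinv_qinv {q : ℂ} (hq : q ≠ 0) (f : ℂ[T;T⁻¹]) : qinv q (qinv q f) = f := by
  induction f using LaurentPolynomial.induction_on' with
  | add p r hp hr => rw [map_add, map_add, hp, hr]
  | C_mul_T n r =>
    rw [qinv_C_mul_T, qinv_C_mul_T, neg_neg, mul_assoc, ← zpow_add₀ hq]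
    simp

theorem C_ne_zero {r : ℂ} : (C r : ℂ[T;T⁻¹]) ≠ 0 ↔ r ≠ 0 := by
  constructor
  · rintro h rfl
    exact h (map_zero _)
  · intro h
    exact ((isUnit_iff_ne_zero.mpr h).map (C (R := ℂ))).ne_zero

theorem smul_eq (r : ℂ) (f : ℂ[T;T⁻¹]) : r • f = C r * f := smul_eq_C_mul r f

/-- Away from `0` evaluation is a ring homomorphism; the evaluation rules follow from this. -/
theorem evalAt_eq_eval₂ (f : ℂ[T;T⁻¹]) {z : ℂ} (hz : z ≠ 0) :
    evalAt f z = eval₂ (RingHom.id ℂ) (Units.mk0 z hz) f := by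
  have hadd : ∀ p r : ℂ[T;T⁻¹], evalAt (p + r) z = evalAt p z + evalAt r z := by
    intro p r
    unfold evalAt
    rw [AddMonoidAlgebra.coeff_add, Finsupp.sum_add_index']
    · simp
    · intro n r s
      rw [add_mul]
  induction f using LaurentPolynomial.induction_on' with
  | add p r hp hr => rw [hadd, hp, hr, map_add]
  | C_mul_T n r =>
    rw [eval₂_C_mul_T, evalAt, ← single_eq_C_mul_T, AddMonoidAlgebra.coeff_single,
      Finsupp.sum_single_index] <;> simp

theorem evalAt_add (f g : ℂ[T;T⁻¹]) {z : ℂ} (hz : z ≠ 0) :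
    evalAt (f + g) z = evalAt f z + evalAt g z := by
  simp only [evalAt_eq_eval₂ _ hz, map_add]

theorem evalAt_sub (f g : ℂ[T;T⁻¹]) {z : ℂ} (hz : z ≠ 0) :
    evalAt (f - g) z = evalAt f z - evalAt g z := by
  simp only [evalAt_eq_eval₂ _ hz, map_sub]

theorem evalAt_mul (f g : ℂ[T;T⁻¹]) {z : ℂ} (hz : z ≠ 0) :
    evalAt (f * g) z = evalAt f z * evalAt g z := by
  simp only [evalAt_eq_eval₂ _ hz, map_mul]

theorem evalAt_one {z : ℂ} (hz : z ≠ 0) : evalAt 1 z = 1 := by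
  simp only [evalAt_eq_eval₂ _ hz, map_one]

theorem evalAt_C (r : ℂ) {z : ℂ} (hz : z ≠ 0) : evalAt (C r) z = r := by
  rw [evalAt_eq_eval₂ _ hz, eval₂_C, RingHom.id_apply]

theorem evalAt_T (n : ℤ) {z : ℂ} (hz : z ≠ 0) : evalAt (T n) z = z ^ n := by
  rw [evalAt_eq_eval₂ _ hz, eval₂_T]; simp

theorem evalAt_smul (r : ℂ) (f : ℂ[T;T⁻¹]) {z : ℂ} (hz : z ≠ 0) :
    evalAt (r • f) z = r * evalAt f z := by
  rw [smul_eq, evalAt_mul _ _ hz, evalAt_C _ hz]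

theorem evalAt_sum {ι : Type*} (s : Finset ι) (f : ι → ℂ[T;T⁻¹]) {z : ℂ} (hz : z ≠ 0) :
    evalAt (∑ i ∈ s, f i) z = ∑ i ∈ s, evalAt (f i) z := by
  simp only [evalAt_eq_eval₂ _ hz, map_sum]

theorem evalAt_reflect (f : ℂ[T;T⁻¹]) {z : ℂ} (hz : z ≠ 0) :
    evalAt (reflect f) z = evalAt f z⁻¹ := by
  induction f using LaurentPolynomial.induction_on' with
  | add p r hp hr => rw [map_add, evalAt_add _ _ hz, evalAt_add _ _ (inv_ne_zero hz), hp, hr]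
  | C_mul_T n r =>
    rw [reflect_C_mul_T, evalAt_mul _ _ hz, evalAt_mul _ _ (inv_ne_zero hz), evalAt_C _ hz,
      evalAt_C _ (inv_ne_zero hz), evalAt_T _ hz, evalAt_T _ (inv_ne_zero hz), inv_zpow']

theorem evalAt_qinv {q : ℂ} (hq : q ≠ 0) (f : ℂ[T;T⁻¹]) {z : ℂ} (hz : z ≠ 0) :
    evalAt (qinv q f) z = evalAt f (q / z) := by
  have hqz := div_ne_zero hq hz
  induction f using LaurentPolynomial.induction_on' with
  | add p r hp hr => rw [map_add, evalAt_add _ _ hz, evalAt_add _ _ hqz, hp, hr]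
  | C_mul_T n r =>
    rw [qinv_C_mul_T, evalAt_mul _ _ hz, evalAt_mul _ _ hqz, evalAt_C _ hz,
      evalAt_C _ hqz, evalAt_T _ hz, evalAt_T _ hqz, div_zpow, zpow_neg]
    ring

theorem differentiableAt_evalAt (f : ℂ[T;T⁻¹]) {z : ℂ} (hz : z ≠ 0) :
    DifferentiableAt ℂ (evalAt f) z := by
  unfold evalAt Finsupp.sum
  refine DifferentiableAt.fun_sum fun n _ => ?_
  exact (differentiableAt_const _).mul (differentiableAt_zpow.mpr (Or.inl hz))

/-! ### The operators of the basic representation -/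

theorem mul_opT1 (a b : ℂ) (f : ℂ[T;T⁻¹]) :
    (1 - T 2) * opT1 a b f = (C (a + b) * T 1 - C (1 + a * b)) * f +
      (1 - C a * T 1) * (1 - C b * T 1) * reflect f := by
  rw [opT1, mul_divMap]
  simp [numT1, mul_assoc]

theorem mul_opT0 (c d q : ℂ) (f : ℂ[T;T⁻¹]) :
    (C q - T 2) * opT0 c d q f = C q⁻¹ * T 1 * (C (c * d + q) * T 1 - C ((c + d) * q)) * f -
      (C c - T 1) * (C d - T 1) * qinv q f := by
  rw [opT0, mul_divMap]
  simp only [numT0, LinearMap.sub_apply, LinearMap.mulLeft_apply, LinearMap.comp_apply]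

theorem opT1_eq_of {a b : ℂ} {f g : ℂ[T;T⁻¹]}
    (h : (1 - T 2) * g = (C (a + b) * T 1 - C (1 + a * b)) * f +
      (1 - C a * T 1) * (1 - C b * T 1) * reflect f) : opT1 a b f = g :=
  mul_left_cancel₀ one_sub_T_two_ne_zero ((mul_opT1 a b f).trans h.symm)

theorem opT0_eq_of {c d q : ℂ} {f g : ℂ[T;T⁻¹]}
    (h : (C q - T 2) * g = C q⁻¹ * T 1 * (C (c * d + q) * T 1 - C ((c + d) * q)) * f -
      (C c - T 1) * (C d - T 1) * qinv q f) : opT0 c d q f = g :=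
  mul_left_cancel₀ (C_sub_T_two_ne_zero q) ((mul_opT0 c d q f).trans h.symm)

theorem opT1_mul_of_reflect (a b : ℂ) {s : ℂ[T;T⁻¹]} (hs : reflect s = s) (f : ℂ[T;T⁻¹]) :
    opT1 a b (s * f) = s * opT1 a b f := by
  apply opT1_eq_of
  rw [reflect_mul, hs]
  linear_combination s * mul_opT1 a b f

theorem opT0_mul_of_qinv (c d : ℂ) {q : ℂ} (hq : q ≠ 0) {s : ℂ[T;T⁻¹]} (hs : qinv q s = s)
    (f : ℂ[T;T⁻¹]) : opT0 c d q (s * f) = s * opT0 c d q f := by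
  apply opT0_eq_of
  rw [qinv_mul hq, hs]
  linear_combination s * mul_opT0 c d q f

theorem opT1_one (a b : ℂ) : opT1 a b 1 = -C (a * b) := by
  apply opT1_eq_of
  rw [reflect_one, T_two_eq]
  simp only [map_add, map_mul, map_one]
  ring

theorem opT1_of_reflect (a b : ℂ) {s : ℂ[T;T⁻¹]} (hs : reflect s = s) :
    opT1 a b s = -C (a * b) * s := by
  have := opT1_mul_of_reflect a b hs 1
  rw [mul_one, opT1_one] at this
  rw [this]; ring

theorem opT0_one (c d : ℂ) {q : ℂ} (hq : q ≠ 0) : opT0 c d q 1 = -C (q⁻¹ * c * d) := by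
  have hqq : (C q⁻¹ * C q : ℂ[T;T⁻¹]) = 1 := by rw [← map_mul, inv_mul_cancel₀ hq, map_one]
  apply opT0_eq_of
  rw [qinv_one, T_two_eq]
  simp only [map_add, map_mul]
  linear_combination (T 1 * T 1 - (C c + C d) * T 1 + C c * C d) * (-hqq) +
    (T 1 * (C c + C d) * 0 ) * hqq

theorem opT0_of_qinv (c d : ℂ) {q : ℂ} (hq : q ≠ 0) {s : ℂ[T;T⁻¹]} (hs : qinv q s = s) :
    opT0 c d q s = -C (q⁻¹ * c * d) * s := by
  have := opT0_mul_of_qinv c d hq hs 1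
  rw [mul_one, opT0_one c d hq] at this
  rw [this]; ring

/-- The function `z⁻¹ (1 - a z) (1 - b z)`, up to the factor `a`. -/
def qAux (a b : ℂ) : ℂ[T;T⁻¹] := C a * T (-1) * (1 - C a * T 1) * (1 - C b * T 1)

theorem reflect_qAux (a b : ℂ) :
    reflect (qAux a b) = C a * T 1 * (1 - C a * T (-1)) * (1 - C b * T (-1)) := by
  simp only [qAux, reflect_mul, map_sub, reflect_C, reflect_one, reflect_T, neg_neg]

theorem ofVec_apply (a b : ℂ) (v : Vec2) :
    ofVec a b v = (v.1 : ℂ[T;T⁻¹]) + qAux a b * (v.2 : ℂ[T;T⁻¹]) := rfl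

/-- With `opT1_of_reflect` this diagonalizes `T₁`: the decomposition `f₁ + qAux * f₂` is the
splitting into eigenspaces for `-ab` and `-1`. -/
theorem opT1_qAux (a b : ℂ) : opT1 a b (qAux a b) = -qAux a b := by
  apply opT1_eq_of
  rw [reflect_qAux, qAux, T_two_eq]
  have e := T_neg_one_mul_T_one
  generalize (T (-1) : ℂ[T;T⁻¹]) = s at *
  generalize (T 1 : ℂ[T;T⁻¹]) = t at *
  simp only [map_add, map_mul, map_one]
  generalize (C a : ℂ[T;T⁻¹]) = A at *
  generalize (C b : ℂ[T;T⁻¹]) = B at *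
  linear_combination A * (1 - A * t) * (1 - B * t) * (t - A * B * s) * e

theorem opT1_ofVec (a b : ℂ) (v : Vec2) :
    opT1 a b (ofVec a b v) = ofVec a b (-(a * b) • v.1, -v.2) := by
  have h1 : reflect (v.1 : ℂ[T;T⁻¹]) = v.1 := v.1.2
  have h2 : reflect (v.2 : ℂ[T;T⁻¹]) = v.2 := v.2.2
  rw [ofVec_apply, ofVec_apply, map_add, opT1_of_reflect a b h1, mul_comm (qAux a b),
    opT1_mul_of_reflect a b h2, opT1_qAux]
  simp only [Submodule.coe_smul, Submodule.coe_neg, smul_eq, map_neg]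
  ring

/-- The first component of the decomposition, before division by `ab - 1`. -/
theorem mul_vecFst {a b : ℂ} (hab : a * b ≠ 1) (f : ℂ[T;T⁻¹]) :
    C (a * b - 1) * (1 - T 2) * (vecFst a b f : ℂ[T;T⁻¹]) =
      (T 1 - C a) * (T 1 - C b) * f - (1 - C a * T 1) * (1 - C b * T 1) * reflect f := by
  have h := mul_divMap (1 - T 2) one_sub_T_two_ne_zero (numFst a b) (dvd_numFst a b) f
  have hc : (C (a * b - 1) * C (a * b - 1)⁻¹ : ℂ[T;T⁻¹]) = 1 := by
    rw [← map_mul, mul_inv_cancel₀ (sub_ne_zero.mpr hab), map_one]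
  simp only [vecFst, LinearMap.smul_apply, Submodule.coe_smul, LinearMap.codRestrict_apply, smul_eq]
  have hn : numFst a b f =
      (T 1 - C a) * (T 1 - C b) * f - (1 - C a * T 1) * (1 - C b * T 1) * reflect f := by
    simp only [numFst, LinearMap.sub_apply, LinearMap.mulLeft_apply, LinearMap.comp_apply]
  rw [hn] at h
  linear_combination h + (1 - T 2) * divMap (1 - T 2) one_sub_T_two_ne_zero (numFst a b) (dvd_numFst a b) f * hc

theorem mul_vecSnd {a b : ℂ} (ha : a ≠ 0) (hab : a * b ≠ 1) (f : ℂ[T;T⁻¹]) :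
    C (a * (a * b - 1)) * (T 1 - T (-1)) * (vecSnd a b f : ℂ[T;T⁻¹]) = f - reflect f := by
  have h := mul_divMap (T 1 - T (-1)) T_sub_T_neg_ne_zero numSnd dvd_numSnd f
  have hc : (C (a * (a * b - 1)) * C (a * (a * b - 1))⁻¹ : ℂ[T;T⁻¹]) = 1 := by
    rw [← map_mul, mul_inv_cancel₀ (mul_ne_zero ha (sub_ne_zero.mpr hab)), map_one]
  simp only [vecSnd, LinearMap.smul_apply, Submodule.coe_smul, LinearMap.codRestrict_apply, smul_eq]
  have hn : numSnd f = f - reflect f := by simp [numSnd]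
  rw [hn] at h
  linear_combination h + (T 1 - T (-1)) * divMap (T 1 - T (-1)) T_sub_T_neg_ne_zero numSnd dvd_numSnd f * hc

theorem ofVec_vec {a b : ℂ} (ha : a ≠ 0) (hab : a * b ≠ 1) (f : ℂ[T;T⁻¹]) :
    ofVec a b (vec a b f) = f := by
  rw [ofVec_apply]
  have h1 := mul_vecFst hab f
  have h2 := mul_vecSnd ha hab f
  change (vecFst a b f : ℂ[T;T⁻¹]) + qAux a b * (vecSnd a b f : ℂ[T;T⁻¹]) = f
  have hne : (C (a * b - 1) * (1 - T 2) : ℂ[T;T⁻¹]) ≠ 0 := by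
    refine mul_ne_zero ?_ one_sub_T_two_ne_zero
    rw [C_ne_zero]
    exact sub_ne_zero.mpr hab
  apply mul_left_cancel₀ hne
  rw [qAux]
  rw [T_two_eq] at *
  have e := T_neg_one_mul_T_one
  generalize (vecFst a b f : ℂ[T;T⁻¹]) = u at *
  generalize (vecSnd a b f : ℂ[T;T⁻¹]) = v at *
  generalize reflect f = g at *
  generalize (T (-1) : ℂ[T;T⁻¹]) = s at *
  generalize (T 1 : ℂ[T;T⁻¹]) = t at *
  simp only [map_sub, map_mul, map_one] at *
  generalize (C a : ℂ[T;T⁻¹]) = A at *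
  generalize (C b : ℂ[T;T⁻¹]) = B at *
  linear_combination h1 - (1 - A * t) * (1 - B * t) * h2 +
    A * (A * B - 1) * (1 - A * t) * (1 - B * t) * v * (-t) * e

theorem ofVec_injective {a b : ℂ} (ha : a ≠ 0) (hab : a * b ≠ 1) :
    Function.Injective (ofVec a b) := by
  rw [← LinearMap.ker_eq_bot, LinearMap.ker_eq_bot']
  intro v hv
  rw [ofVec_apply] at hv
  have hne : (C (a * (1 - a * b)) : ℂ[T;T⁻¹]) ≠ 0 := by
    rw [C_ne_zero]
    exact mul_ne_zero ha (sub_ne_zero.mpr (Ne.symm hab))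
  have hr := congrArg reflect hv
  have h1 : reflect (v.1 : ℂ[T;T⁻¹]) = v.1 := v.1.2
  have h2 : reflect (v.2 : ℂ[T;T⁻¹]) = v.2 := v.2.2
  rw [map_add, reflect_mul, h1, h2, map_zero, reflect_qAux] at hr
  have h3 : (v.2 : ℂ[T;T⁻¹]) = 0 := by
    apply mul_left_cancel₀ (mul_ne_zero hne T_sub_T_neg_ne_zero)
    rw [qAux] at hv
    have e := T_neg_one_mul_T_one
    simp only [map_sub, map_mul, map_one] at *
    linear_combination hr - hv + (C a * (C a * C a * T 1 * C b - C a * C b * C a * T 1 + C a * C b * T 1 - C a * C b * T (-1)) * (v.2 : ℂ[T;T⁻¹])) * e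
  have h4 : (v.1 : ℂ[T;T⁻¹]) = 0 := by rw [h3] at hv; simpa using hv
  exact Prod.ext (Subtype.ext h4) (Subtype.ext h3)

theorem ofVec_bold {a b : ℂ} (ha : a ≠ 0) (hab : a * b ≠ 1)
    (A : ℂ[T;T⁻¹] →ₗ[ℂ] ℂ[T;T⁻¹]) (v : Vec2) :
    ofVec a b (bold a b A v) = A (ofVec a b v) :=
  ofVec_vec ha hab _

theorem opT1_quadratic {a b : ℂ} (ha : a ≠ 0) (hab : a * b ≠ 1) (f : ℂ[T;T⁻¹]) :
    opT1 a b (opT1 a b f) = -(1 + a * b) • opT1 a b f - (a * b) • f := by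
  obtain ⟨v, rfl⟩ : ∃ v, ofVec a b v = f := ⟨_, ofVec_vec ha hab f⟩
  rw [opT1_ofVec, opT1_ofVec, ← map_smul, ← map_smul, ← map_sub]
  congr 1
  ext1 <;> simp only [Prod.smul_fst, Prod.fst_sub, Prod.smul_snd, Prod.snd_sub] <;> module

theorem opT0_quadratic (c d : ℂ) {q : ℂ} (hq : q ≠ 0) (f : ℂ[T;T⁻¹]) :
    opT0 c d q (opT0 c d q f) = -(1 + q⁻¹ * c * d) • opT0 c d q f - (q⁻¹ * c * d) • f := by
  have hqq : (C q⁻¹ * C q : ℂ[T;T⁻¹]) = 1 := by rw [← map_mul, inv_mul_cancel₀ hq, map_one]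
  have h1 := mul_opT0 c d q f
  have h2 := congrArg (qinv q) h1
  have hD := C_sub_T_two_ne_zero q
  apply opT0_eq_of
  simp only [smul_eq, qinv_mul hq, map_sub, qinv_T, qinv_C, qinv_qinv hq, T_two_eq,
    zpow_one] at *
  generalize opT0 c d q f = g at *
  generalize qinv q g = g' at *
  generalize qinv q f = f' at *
  have e := T_neg_one_mul_T_one
  generalize (T (-1) : ℂ[T;T⁻¹]) = s at *
  generalize (T 1 : ℂ[T;T⁻¹]) = t at *
  simp only [map_add, map_neg, map_mul, map_one] at *
  generalize (C c : ℂ[T;T⁻¹]) = c at *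
  generalize (C d : ℂ[T;T⁻¹]) = d at *
  generalize (C q⁻¹ : ℂ[T;T⁻¹]) = p at *
  generalize (C q : ℂ[T;T⁻¹]) = q at *
  have hp : q * p = 1 := by rw [mul_comm]; exact hqq
  -- The relation `h2`, which is `h1` at `q z⁻¹`, multiplied by `z² / q`.
  have key : (t * t - q) * g' = (c * d + q - (c + d) * t) * f' - p * (c * t - q) * (d * t - q) * f := by
    grind
  apply mul_left_cancel₀ hD
  grind

end

section
/-! ### The basic representation of the DAHA -/

/-- Multiplication by `z`. -/
def opZ : ℂ[T;T⁻¹] →ₗ[ℂ] ℂ[T;T⁻¹] := LinearMap.mulLeft ℂ (T 1)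

/-- The inverse of `T₀`. -/
def opT0Inv (c d q : ℂ) : ℂ[T;T⁻¹] →ₗ[ℂ] ℂ[T;T⁻¹] :=
  -(q⁻¹ * c * d)⁻¹ • opT0 c d q - ((q⁻¹ * c * d)⁻¹ + 1) • LinearMap.id

theorem opZ_apply (f : ℂ[T;T⁻¹]) : opZ f = T 1 * f := rfl

theorem opZInv_apply (f : ℂ[T;T⁻¹]) : opZInv f = T (-1) * f := rfl

theorem opZ_opZInv (f : ℂ[T;T⁻¹]) : opZ (opZInv f) = f := by
  rw [opZ_apply, opZInv_apply, ← mul_assoc, mul_comm (T 1), T_neg_one_mul_T_one, one_mul]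

theorem opZInv_opZ (f : ℂ[T;T⁻¹]) : opZInv (opZ f) = f := by
  rw [opZ_apply, opZInv_apply, ← mul_assoc, T_neg_one_mul_T_one, one_mul]

theorem opT1Inv_apply (a b : ℂ) (f : ℂ[T;T⁻¹]) :
    opT1Inv a b f = -(a * b)⁻¹ • opT1 a b f - ((a * b)⁻¹ + 1) • f := rfl

theorem opT0Inv_apply (c d q : ℂ) (f : ℂ[T;T⁻¹]) :
    opT0Inv c d q f = -(q⁻¹ * c * d)⁻¹ • opT0 c d q f - ((q⁻¹ * c * d)⁻¹ + 1) • f := rfl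

section
variable {a b : ℂ} (ha : a ≠ 0) (hb : b ≠ 0) (hab : a * b ≠ 1)
include ha hb hab

theorem opT1_opT1Inv (f : ℂ[T;T⁻¹]) : opT1 a b (opT1Inv a b f) = f := by
  have h0 := mul_ne_zero ha hb
  rw [opT1Inv_apply, map_sub, map_smul, map_smul, opT1_quadratic ha hab, smul_sub, smul_smul,
    smul_smul]
  match_scalars <;> field_simp
  ring

theorem opT1Inv_opT1 (f : ℂ[T;T⁻¹]) : opT1Inv a b (opT1 a b f) = f := by
  have h0 := mul_ne_zero ha hb
  rw [opT1Inv_apply, opT1_quadratic ha hab, smul_sub, smul_smul, smul_smul]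
  match_scalars <;> field_simp
  ring

theorem opT1Inv_ofVec (v : Vec2) :
    opT1Inv a b (ofVec a b v) = ofVec a b (-(a * b)⁻¹ • v.1, -v.2) := by
  have h0 := mul_ne_zero ha hb
  have h := opT1_ofVec a b (-(a * b)⁻¹ • v.1, -v.2)
  have : ((-(a * b) • -(a * b)⁻¹ • v.1, - -v.2) : Vec2) = v := by
    ext1
    · rw [smul_smul, neg_mul_neg, mul_inv_cancel₀ h0, one_smul]
    · simp
  rw [this] at h
  rw [← h, opT1Inv_opT1 ha hb hab]

end

section
variable {c d q : ℂ} (hc : c ≠ 0) (hd : d ≠ 0) (hq : q ≠ 0)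
include hc hd hq

theorem opT0_opT0Inv (f : ℂ[T;T⁻¹]) : opT0 c d q (opT0Inv c d q f) = f := by
  rw [opT0Inv_apply, map_sub, map_smul, map_smul, opT0_quadratic c d hq, smul_sub, smul_smul,
    smul_smul]
  match_scalars <;> field_simp
  ring

end

/-- `T₁ Z` is the inverse of `Ť₁`. Its quadratic relation involves no inverse of `T₁`, so it can be
checked directly from the defining formula and then transferred by `inv_quadratic`. -/
theorem opT1_opZ_quadratic (a b : ℂ) (f : ℂ[T;T⁻¹]) :
    opT1 a b (opZ (opT1 a b (opZ f))) = -(a + b) • opT1 a b (opZ f) - (a * b) • f := by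
  have h1 := mul_opT1 a b (opZ f)
  have h2 := congrArg reflect h1
  have hD := one_sub_T_two_ne_zero
  apply opT1_eq_of
  simp only [opZ_apply, smul_eq, reflect_mul, map_sub, map_add, reflect_T, reflect_C, reflect_one,
    reflect_reflect, T_two_eq, neg_neg] at *
  generalize opT1 a b (T 1 * f) = g at *
  generalize reflect g = g' at *
  generalize reflect f = f' at *
  have e := T_neg_one_mul_T_one
  generalize (T (-1) : ℂ[T;T⁻¹]) = s at *
  generalize (T 1 : ℂ[T;T⁻¹]) = t at *
  simp only [map_add, map_neg, map_mul, map_one] at *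
  generalize (C a : ℂ[T;T⁻¹]) = a at *
  generalize (C b : ℂ[T;T⁻¹]) = b at *
  -- The relation `h2`, which is `h1` at `z⁻¹`, multiplied by `z²`.
  have key : (t * t - 1) * g' = ((a + b) * t - (1 + a * b) * t * t) * s * f' +
      (t - a) * (t - b) * t * f := by
    grind
  apply mul_left_cancel₀ hD
  grind

/-- The quadratic relation of `Z⁻¹ T₀ = Ť₀⁻¹`, with one factor `Z⁻¹` cancelled on the left. -/
theorem opZInv_opT0_quadratic (c d : ℂ) {q : ℂ} (hq : q ≠ 0) (f : ℂ[T;T⁻¹]) :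
    opT0 c d q (opZInv (opT0 c d q f)) =
      -(q⁻¹ * (c + d)) • opT0 c d q f - (q⁻¹ ^ 2 * (c * d)) • opZ f := by
  have hqq : (C q⁻¹ * C q : ℂ[T;T⁻¹]) = 1 := by rw [← map_mul, inv_mul_cancel₀ hq, map_one]
  have h1 := mul_opT0 c d q f
  have h2 := congrArg (qinv q) h1
  have hD := C_sub_T_two_ne_zero q
  apply opT0_eq_of
  simp only [opZInv_apply, opZ_apply, smul_eq, qinv_mul hq, map_sub, qinv_T, qinv_C, qinv_qinv hq,
    T_two_eq, zpow_one, neg_neg, zpow_neg] at *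
  generalize opT0 c d q f = g at *
  generalize qinv q g = g' at *
  generalize qinv q f = f' at *
  have e := T_neg_one_mul_T_one
  generalize (T (-1) : ℂ[T;T⁻¹]) = s at *
  generalize (T 1 : ℂ[T;T⁻¹]) = t at *
  simp only [map_add, map_neg, map_mul, map_pow] at *
  generalize (C c : ℂ[T;T⁻¹]) = c at *
  generalize (C d : ℂ[T;T⁻¹]) = d at *
  generalize (C q⁻¹ : ℂ[T;T⁻¹]) = p at *
  generalize (C q : ℂ[T;T⁻¹]) = q at *
  have hp : q * p = 1 := by rw [mul_comm]; exact hqq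
  have key : (t * t - q) * g' = (c * d + q - (c + d) * t) * f' - p * (c * t - q) * (d * t - q) * f := by
    grind
  apply mul_left_cancel₀ hD
  grind

/-- Multiply the relation for `u` by `v * v` on the right. A right inverse suffices. -/
theorem inv_quadratic {A : Type*} [Ring A] [Algebra ℂ A] {u v : A} (huv : u * v = 1)
    {r s : ℂ} (h : u * u = -r • u - s • (1 : A)) : s • (v * v) = -r • v - 1 := by
  have h2 : u * u * (v * v) = (-r • u - s • (1 : A)) * (v * v) := by rw [h]
  have h3 : u * u * (v * v) = 1 := by
    rw [mul_assoc, ← mul_assoc u v v, huv, one_mul, huv]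
  rw [h3, sub_mul, smul_mul_assoc, smul_mul_assoc, ← mul_assoc, huv, one_mul, one_mul] at h2
  rw [h2]; abel

/-- The operator `Ť₁ = Z⁻¹ T₁⁻¹`. -/
def opCT1 (a b : ℂ) : Module.End ℂ ℂ[T;T⁻¹] := opZInv ∘ₗ opT1Inv a b

/-- The operator `Ť₀ = T₀⁻¹ Z`. -/
def opCT0 (c d q : ℂ) : Module.End ℂ ℂ[T;T⁻¹] := opT0Inv c d q ∘ₗ opZ

theorem opCT1_apply (a b : ℂ) (f : ℂ[T;T⁻¹]) : opCT1 a b f = opZInv (opT1Inv a b f) := rfl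

theorem opCT1_quadratic {a b : ℂ} (ha : a ≠ 0) (hb : b ≠ 0) (hab : a * b ≠ 1) :
    (a * b) • (opCT1 a b * opCT1 a b) = -(a + b) • opCT1 a b - 1 := by
  refine inv_quadratic (u := (opT1 a b ∘ₗ opZ : Module.End ℂ ℂ[T;T⁻¹])) ?_ ?_
  · refine LinearMap.ext fun f => ?_
    change opT1 a b (opZ (opZInv (opT1Inv a b f))) = f
    rw [opZ_opZInv, opT1_opT1Inv ha hb hab]
  · refine LinearMap.ext fun f => ?_
    exact opT1_opZ_quadratic a b f

theorem opCT0_quadratic {c d q : ℂ} (hc : c ≠ 0) (hd : d ≠ 0) (hq : q ≠ 0) :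
    (q⁻¹ ^ 2 * (c * d)) • (opCT0 c d q * opCT0 c d q) = -(q⁻¹ * (c + d)) • opCT0 c d q - 1 := by
  refine inv_quadratic (u := (opZInv ∘ₗ opT0 c d q : Module.End ℂ ℂ[T;T⁻¹])) ?_ ?_
  · refine LinearMap.ext fun f => ?_
    change opZInv (opT0 c d q (opT0Inv c d q (opZ f))) = f
    rw [opT0_opT0Inv hc hd hq, opZInv_opZ]
  · refine LinearMap.ext fun f => ?_
    change opZInv (opT0 c d q (opZInv (opT0 c d q f))) =
      -(q⁻¹ * (c + d)) • opZInv (opT0 c d q f) - (q⁻¹ ^ 2 * (c * d)) • f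
    rw [opZInv_opT0_quadratic c d hq, map_sub, map_smul, map_smul, opZInv_opZ]

/-- The operators representing the generators. -/
def basicGen (a b c d q : ℂ) : Gen → Module.End ℂ ℂ[T;T⁻¹]
  | .t1 => opT1 a b
  | .t0 => opT0 c d q
  | .ct1 => opCT1 a b
  | .ct0 => opCT0 c d q

theorem add_mul_add_one_eq_zero {A : Type*} [Ring A] [Algebra ℂ A] {x : A} {k : ℂ}
    (h : x * x = -(1 + k) • x - k • (1 : A)) : (x + algebraMap ℂ A k) * (x + 1) = 0 := by
  rw [Algebra.algebraMap_eq_smul_one, add_mul, mul_add, mul_add, h, smul_mul_assoc, one_mul, mul_one,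
    smul_mul_assoc, one_mul]
  module

theorem smul_add_mul_smul_add_eq_zero {A : Type*} [Ring A] [Algebra ℂ A] {x : A} {r s k : ℂ}
    (h : (r * s) • (x * x) = -(k * (r + s)) • x - (k ^ 2) • (1 : A)) :
    (r • x + algebraMap ℂ A k) * (s • x + algebraMap ℂ A k) = 0 := by
  have : (r • x + algebraMap ℂ A k) * (s • x + algebraMap ℂ A k) =
      (r * s) • (x * x) + (k * (r + s)) • x + (k ^ 2) • (1 : A) := by
    simp only [Algebra.algebraMap_eq_smul_one, add_mul, mul_add, smul_mul_assoc, mul_smul_comm,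
      one_mul, mul_one]
    module
  rw [this, h]
  module

variable {a b c d q : ℂ}

theorem basicGen_rel (ha : a ≠ 0) (hb : b ≠ 0) (hc : c ≠ 0) (hd : d ≠ 0) (hq : q ≠ 0)
    (hab : a * b ≠ 1) ⦃x y : FreeAlgebra ℂ Gen⦄ (h : DahaRel a b c d q x y) :
    FreeAlgebra.lift ℂ (basicGen a b c d q) x = FreeAlgebra.lift ℂ (basicGen a b c d q) y := by
  cases h with
  | t1 =>
    simp only [map_mul, map_add, FreeAlgebra.lift_ι_apply, AlgHom.commutes, map_one, map_zero]
    rw [← map_mul]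
    exact add_mul_add_one_eq_zero (LinearMap.ext fun f => opT1_quadratic ha hab f)
  | t0 =>
    simp only [map_mul, map_add, FreeAlgebra.lift_ι_apply, AlgHom.commutes, map_one, map_zero]
    rw [← map_mul, ← map_mul]
    exact add_mul_add_one_eq_zero (LinearMap.ext fun f => opT0_quadratic c d hq f)
  | ct1 =>
    simp only [map_mul, map_add, map_smul, FreeAlgebra.lift_ι_apply, map_one, map_zero]
    have := smul_add_mul_smul_add_eq_zero (x := opCT1 a b) (r := a) (s := b) (k := 1) (by
      rw [opCT1_quadratic ha hb hab]; module)
    rwa [map_one] at this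
  | ct0 =>
    simp only [map_mul, map_add, map_smul, FreeAlgebra.lift_ι_apply, AlgHom.commutes, map_zero]
    refine smul_add_mul_smul_add_eq_zero (x := opCT0 c d q) ?_
    -- The factor `q²` brings the relation to the normalization of the presentation, with `k = q`.
    have h := congrArg (fun u => q ^ 2 • u) (opCT0_quadratic hc hd hq)
    simp only [smul_smul] at h
    rw [show q ^ 2 * (q⁻¹ ^ 2 * (c * d)) = c * d by field_simp] at h
    rw [h, smul_sub, smul_smul]
    match_scalars <;> field_simp
  | prod =>
    simp only [map_mul, FreeAlgebra.lift_ι_apply, map_one]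
    refine LinearMap.ext fun f => ?_
    change opZInv (opT1Inv a b (opT1 a b (opT0 c d q (opT0Inv c d q (opZ f))))) = f
    rw [opT0_opT0Inv hc hd hq, opT1Inv_opT1 ha hb hab, opZInv_opZ]

/-- The basic representation of the DAHA on Laurent polynomials. -/
def basicRep (ha : a ≠ 0) (hb : b ≠ 0) (hc : c ≠ 0) (hd : d ≠ 0) (hq : q ≠ 0)
    (hab : a * b ≠ 1) : Daha a b c d q →ₐ[ℂ] Module.End ℂ ℂ[T;T⁻¹] :=
  RingQuot.liftAlgHom ℂ ⟨FreeAlgebra.lift ℂ (basicGen a b c d q), basicGen_rel ha hb hc hd hq hab⟩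

theorem basicRep_gen (ha : a ≠ 0) (hb : b ≠ 0) (hc : c ≠ 0) (hd : d ≠ 0) (hq : q ≠ 0)
    (hab : a * b ≠ 1) (g : Gen) :
    basicRep ha hb hc hd hq hab (Daha.gen a b c d q g) = basicGen a b c d q g := by
  simp [basicRep, Daha.gen]

end

section
/-! ### Expansions of the non-symmetric Askey-Wilson polynomials -/

/-- Nonvanishing conditions on the parameters. -/
structure Admissible (a b c d q : ℂ) : Prop where
  a0 : a ≠ 0
  b0 : b ≠ 0
  c0 : c ≠ 0
  d0 : d ≠ 0
  q0 : q ≠ 0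
  qq : ∀ k : ℕ, 1 - q ^ (k + 1) ≠ 0
  ab : ∀ k : ℕ, 1 - a * b * q ^ k ≠ 0
  ac : ∀ k : ℕ, 1 - a * c * q ^ k ≠ 0
  ad : ∀ k : ℕ, 1 - a * d * q ^ k ≠ 0
  bc : ∀ k : ℕ, 1 - b * c * q ^ k ≠ 0
  bd : ∀ k : ℕ, 1 - b * d * q ^ k ≠ 0
  abcd : ∀ k : ℕ, 1 - a * b * c * d * q ^ k ≠ 0
  abcdq : q - a * b * c * d ≠ 0

/-- `(az;q)_k (qaz⁻¹;q)_k`. -/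
def psiL (a q : ℂ) (k : ℕ) : ℂ[T;T⁻¹] :=
  ∏ j ∈ range k, ((1 - C (a * q ^ j) * T 1) * (1 - C (a * q ^ (j + 1)) * T (-1)))

/-- `(az;q)_{k+1} (qaz⁻¹;q)_k`. -/
def chiL (a q : ℂ) (k : ℕ) : ℂ[T;T⁻¹] := psiL a q k * (1 - C (a * q ^ k) * T 1)

theorem psiL_zero (a q : ℂ) : psiL a q 0 = 1 := by simp [psiL]

theorem psiL_succ (a q : ℂ) (k : ℕ) :
    psiL a q (k + 1) = chiL a q k * (1 - C (a * q ^ (k + 1)) * T (-1)) := by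
  rw [psiL, prod_range_succ, chiL, psiL]; ring

theorem awFactor_succ (a q : ℂ) (k : ℕ) :
    awFactor a q (k + 1) = chiL a q k * (1 - C a * T (-1)) := by
  induction k with
  | zero => simp [awFactor, chiL, psiL]
  | succ k ih =>
    have h : awFactor a q (k + 2) = awFactor a q (k + 1) *
      ((1 - C (a * q ^ (k + 1)) * T 1) * (1 - C (a * q ^ (k + 1)) * T (-1))) := by
      rw [awFactor, prod_range_succ, awFactor]
    rw [h, ih, chiL.eq_1 a q (k + 1), psiL_succ]; ring

theorem chiL_eq_awFactor (a q : ℂ) (k : ℕ) :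
    chiL a q k = (1 - C a * T 1) * awFactor (q * a) q k := by
  induction k with
  | zero => simp [awFactor, chiL, psiL]
  | succ k ih =>
    rw [chiL, psiL_succ, ih, awFactor.eq_1 _ _ (k + 1), prod_range_succ, ← awFactor]
    have : q * a * q ^ k = a * q ^ (k + 1) := by ring
    rw [this]; ring

/-- After extracting `χ_k` this is `q^{k+1} (1 - a/z) = (1 - a q^{k+1}/z) - (1 - q^{k+1})`. -/
theorem pow_smul_awFactor (a q : ℂ) (k : ℕ) :
    q ^ (k + 1) • awFactor a q (k + 1) = psiL a q (k + 1) - (1 - q ^ (k + 1)) • chiL a q k := by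
  rw [awFactor_succ, psiL_succ, smul_eq, smul_eq]
  simp only [map_mul, map_sub, map_one]
  ring

/-- The left side is `a z⁻¹ (1 - bz) χ_k`, and `a/z - ab = (1 - ab) - (1 - a/z)`. Thus both
components of a vector expand in the same two families. -/
theorem qAux_mul_awFactor (a b q : ℂ) (k : ℕ) :
    qAux a b * awFactor (q * a) q k = (1 - a * b) • chiL a q k - awFactor a q (k + 1) := by
  rw [awFactor_succ, chiL_eq_awFactor, qAux, smul_eq]
  have e := T_neg_one_mul_T_one
  simp only [map_mul, map_sub, map_one]
  linear_combination (-(C a * C b * (1 - C a * T 1) * awFactor (q * a) q k)) * e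

variable {a b c d q : ℂ}

/-- The substitution `z ↦ q/z` exchanges the factors `1 - a q^j z` and `1 - a q^{j+1}/z`. -/
theorem qinv_psiL (a : ℂ) (hq : q ≠ 0) (k : ℕ) : qinv q (psiL a q k) = psiL a q k := by
  induction k with
  | zero => rw [psiL_zero, qinv_one]
  | succ k ih =>
    rw [psiL_succ, chiL, qinv_mul hq, qinv_mul hq, ih]
    have hqq : (C q⁻¹ * C q : ℂ[T;T⁻¹]) = 1 := by rw [← map_mul, inv_mul_cancel₀ hq, map_one]
    simp only [map_sub, qinv_one, qinv_mul hq, qinv_C, qinv_T, zpow_neg, zpow_one, neg_neg,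
      pow_succ, map_mul]
    linear_combination (- C (q ^ k) * C a * T 1 * psiL a q k * (1 - C a * C (q ^ k) * C q * T (-1))) * hqq

theorem opT0_psiL (a c d : ℂ) (hq : q ≠ 0) (k : ℕ) :
    opT0 c d q (psiL a q k) = -(q⁻¹ * c * d) • psiL a q k := by
  rw [opT0_of_qinv c d hq (qinv_psiL a hq k), smul_eq, map_neg]

theorem opT0_T_one (c d : ℂ) (hq : q ≠ 0) :
    opT0 c d q (T 1) = -C (q⁻¹ * c * d) * T 1 - T 1 + C (c + d) - C (c * d) * T (-1) := by
  have hqq : (C q⁻¹ * C q : ℂ[T;T⁻¹]) = 1 := by rw [← map_mul, inv_mul_cancel₀ hq, map_one]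
  have e := T_neg_one_mul_T_one
  apply opT0_eq_of
  rw [qinv_T, T_two_eq]
  simp only [map_mul, map_add, zpow_one]
  generalize (T (-1) : ℂ[T;T⁻¹]) = s at *
  generalize (T 1 : ℂ[T;T⁻¹]) = t at *
  grind

/-- Write `χ_k = ψ_k (1 - a q^k z)`. The invariant factor `ψ_k` passes through `T₀`, so only `T₀ 1`
and `T₀ z` are needed. -/
theorem opT0_chiL (a c d : ℂ) (hq : q ≠ 0) (k : ℕ) :
    opT0 c d q (chiL a q k) = -chiL a q k +
      ((1 - a * c * q ^ k) * (1 - a * d * q ^ k)) • psiL a q k -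
      (q⁻¹ * c * d) • psiL a q (k + 1) := by
  have h : chiL a q k = psiL a q k * (1 - (a * q ^ k) • T 1) := by rw [chiL, smul_eq]
  have hqq : (C q⁻¹ * C q : ℂ[T;T⁻¹]) = 1 := by rw [← map_mul, inv_mul_cancel₀ hq, map_one]
  have e := T_neg_one_mul_T_one
  rw [psiL_succ, h, opT0_mul_of_qinv c d hq (qinv_psiL a hq k), map_sub, opT0_one c d hq,
    map_smul, opT0_T_one c d hq]
  simp only [smul_eq, map_mul, map_sub, map_one, pow_succ, map_add]
  generalize (T (-1) : ℂ[T;T⁻¹]) = s at *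
  generalize (T 1 : ℂ[T;T⁻¹]) = t at *
  generalize psiL a q k = p at *
  generalize (C (q ^ k) : ℂ[T;T⁻¹]) = K at *
  generalize (C a : ℂ[T;T⁻¹]) = a at *
  generalize (C c : ℂ[T;T⁻¹]) = c at *
  generalize (C d : ℂ[T;T⁻¹]) = d at *
  generalize (C q⁻¹ : ℂ[T;T⁻¹]) = q' at *
  generalize (C q : ℂ[T;T⁻¹]) = q at *
  grind

theorem opZInv_chiL (ha : a ≠ 0) (hq : q ≠ 0) (k : ℕ) :
    opZInv (chiL a q k) = (a * q ^ (k + 1))⁻¹ • (chiL a q k - psiL a q (k + 1)) := by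
  have h0 : a * q ^ (k + 1) ≠ 0 := mul_ne_zero ha (pow_ne_zero _ hq)
  rw [eq_inv_smul_iff₀ h0, opZInv_apply, psiL_succ, smul_eq]
  ring

theorem opZInv_psiL (ha : a ≠ 0) (hq : q ≠ 0) (k : ℕ) :
    opZInv (psiL a q k) = (a * q ^ k) • psiL a q k -
      (a * q ^ (k + 1))⁻¹ • (psiL a q (k + 1) - chiL a q k) := by
  have h0 : a * q ^ (k + 1) ≠ 0 := mul_ne_zero ha (pow_ne_zero _ hq)
  have h1 : psiL a q (k + 1) - chiL a q k =
      (a * q ^ (k + 1)) • ((a * q ^ k) • psiL a q k - opZInv (psiL a q k)) := by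
    rw [opZInv_apply, psiL_succ, chiL, smul_eq, smul_eq]
    have e := T_neg_one_mul_T_one
    linear_combination C (a * q ^ (k + 1)) * C (a * q ^ k) * psiL a q k * e
  rw [h1, inv_smul_smul₀ h0]
  abel

/-! ### Coefficients -/

theorem qPoch_zero (x q : ℂ) : qPoch x q 0 = 1 := by simp [qPoch]

theorem qPoch_succ (x q : ℂ) (k : ℕ) : qPoch x q (k + 1) = qPoch x q k * (1 - x * q ^ k) := by
  rw [qPoch, prod_range_succ, qPoch]

theorem qPoch_succ' (x q : ℂ) (k : ℕ) : qPoch x q (k + 1) = (1 - x) * qPoch (q * x) q k := by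
  rw [qPoch, prod_range_succ', qPoch, mul_comm]
  congr 1
  · simp
  · exact prod_congr rfl fun j _ => by rw [pow_succ]; ring

theorem qPoch_ne_zero {x q : ℂ} (h : ∀ k : ℕ, 1 - x * q ^ k ≠ 0) (k : ℕ) : qPoch x q k ≠ 0 :=
  prod_ne_zero_iff.mpr fun j _ => h j

theorem qPoch_eq_zero (hq : q ≠ 0) {n k : ℕ} (h : n < k) : qPoch (q ^ (-(n : ℤ))) q k = 0 := by
  refine prod_eq_zero (mem_range.mpr h) ?_
  rw [zpow_neg, zpow_natCast, inv_mul_cancel₀ (pow_ne_zero _ hq), sub_self]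

/-- The coefficients of the Askey-Wilson polynomial `R_n`. -/
def awCoef (a b c d q : ℂ) (n k : ℕ) : ℂ :=
  qPoch (q ^ (-(n : ℤ))) q k * qPoch (q ^ ((n : ℤ) - 1) * (a * b * c * d)) q k /
      (qPoch (a * b) q k * qPoch (a * c) q k * qPoch (a * d) q k * qPoch q q k) * q ^ k

theorem awR_eq (n : ℕ) : awR n a b c d q =
    ∑ k ∈ range (n + 1), awCoef a b c d q n k • awFactor a q k := rfl

namespace Admissible

variable (h : Admissible a b c d q)
include h

theorem poch_ab (k : ℕ) : qPoch (a * b) q k ≠ 0 := qPoch_ne_zero h.ab k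
theorem poch_ac (k : ℕ) : qPoch (a * c) q k ≠ 0 := qPoch_ne_zero h.ac k
theorem poch_ad (k : ℕ) : qPoch (a * d) q k ≠ 0 := qPoch_ne_zero h.ad k
theorem poch_qq (k : ℕ) : qPoch q q k ≠ 0 :=
  qPoch_ne_zero (fun k => by have := h.qq k; rwa [pow_succ'] at this) k
theorem ab_ne_one : a * b ≠ 1 := fun e => h.ab 0 (by simp [e])

end Admissible

theorem awCoef_eq_zero (hq : q ≠ 0) {n k : ℕ} (h : n < k) : awCoef a b c d q n k = 0 := by
  rw [awCoef, qPoch_eq_zero hq h]; simp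

theorem awCoef_zero (n : ℕ) : awCoef a b c d q n 0 = 1 := by
  simp [awCoef, qPoch_zero]

/-- The ratio of consecutive terms of the `₄φ₃`, cleared of denominators. -/
theorem awCoef_succ (h : Admissible a b c d q) (n k : ℕ) :
    awCoef a b c d q n (k + 1) *
      ((1 - a * b * q ^ k) * (1 - a * c * q ^ k) * (1 - a * d * q ^ k) * (1 - q ^ (k + 1))) =
    awCoef a b c d q n k *
      ((1 - q ^ (-(n : ℤ)) * q ^ k) * (1 - q ^ ((n : ℤ) - 1) * (a * b * c * d) * q ^ k) * q) := by
  have h1 := h.poch_ab k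
  have h2 := h.poch_ac k
  have h3 := h.poch_ad k
  have h4 := h.poch_qq k
  have h5 := h.ab k
  have h6 := h.ac k
  have h7 := h.ad k
  have h8 := h.qq k
  have h9 : 1 - q * q ^ k ≠ 0 := by rwa [← pow_succ']
  simp only [awCoef, qPoch_succ, pow_succ' q k] at *
  generalize 1 - a * b * q ^ k = x1 at *
  generalize 1 - a * c * q ^ k = x2 at *
  generalize 1 - a * d * q ^ k = x3 at *
  generalize 1 - q * q ^ k = x4 at *
  field_simp

/-- The polynomials `x R_n + y S_n` with `S_n` a multiple of the second component of `E_n`,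
in the basis `psiL`, `chiL`. -/
def comb (a b c d q : ℂ) (n : ℕ) (x y : ℂ) : ℂ[T;T⁻¹] :=
  x • awR n a b c d q + y • ∑ k ∈ range n, (awCoef a b c d q n (k + 1) * (1 - q ^ (k + 1)) /
    (1 - a * b * q ^ (k + 1))) • (qAux a b * awFactor (q * a) q k)

/-- Combines `pow_smul_awFactor` and `qAux_mul_awFactor`. The free bound `N > n` only adds zero
terms, and allows expansions of different degrees to be compared over one range. -/
theorem comb_eq (h : Admissible a b c d q) {n N : ℕ} (hN : n < N) (x y : ℂ) :
    comb a b c d q n x y =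
      ∑ k ∈ range N, (awCoef a b c d q n k * (q ^ k)⁻¹ *
        (x - y * (1 - q ^ k) / (1 - a * b * q ^ k))) • psiL a q k +
      ∑ k ∈ range N, (awCoef a b c d q n (k + 1) * (q ^ (k + 1))⁻¹ *
        ((1 - q ^ (k + 1)) * (y - x))) • chiL a q k := by
  obtain ⟨M, rfl⟩ : ∃ M, N = n + (M + 1) := ⟨N - n - 1, by omega⟩
  have hz : ∀ k, n < k → awCoef a b c d q n k = 0 := fun k hk => awCoef_eq_zero h.q0 hk
  have e1 : ∑ k ∈ range (n + (M + 1)), (awCoef a b c d q n k * (q ^ k)⁻¹ *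
        (x - y * (1 - q ^ k) / (1 - a * b * q ^ k))) • psiL a q k =
      ∑ k ∈ range (n + 1), (awCoef a b c d q n k * (q ^ k)⁻¹ *
        (x - y * (1 - q ^ k) / (1 - a * b * q ^ k))) • psiL a q k := by
    symm
    refine sum_subset (range_subset_range.mpr (by omega)) fun k _ hk => ?_
    rw [mem_range] at hk
    rw [hz k (by omega)]; simp
  have e2 : ∑ k ∈ range (n + (M + 1)), (awCoef a b c d q n (k + 1) * (q ^ (k + 1))⁻¹ *
        ((1 - q ^ (k + 1)) * (y - x))) • chiL a q k =
      ∑ k ∈ range n, (awCoef a b c d q n (k + 1) * (q ^ (k + 1))⁻¹ *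
        ((1 - q ^ (k + 1)) * (y - x))) • chiL a q k := by
    symm
    refine sum_subset (range_subset_range.mpr (by omega)) fun k _ hk => ?_
    rw [mem_range] at hk
    rw [hz (k + 1) (by omega)]; simp
  rw [e1, e2, comb, awR_eq, sum_range_succ', sum_range_succ', smul_add, smul_sum, smul_sum]
  have e3 : awFactor a q 0 = psiL a q 0 := by simp [awFactor, psiL]
  rw [e3, add_right_comm, add_right_comm _ _ (∑ k ∈ range n, _ : ℂ[T;T⁻¹]), ← sum_add_distrib,
    ← sum_add_distrib]
  congr 1
  · refine sum_congr rfl fun k _ => ?_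
    have hq := pow_ne_zero (k + 1) h.q0
    have hb := h.ab (k + 1)
    have e4 : awFactor a q (k + 1) = (q ^ (k + 1))⁻¹ •
        (psiL a q (k + 1) - (1 - q ^ (k + 1)) • chiL a q k) := by
      rw [← pow_smul_awFactor, inv_smul_smul₀ hq]
    rw [qAux_mul_awFactor, e4]
    generalize q ^ (k + 1) = K at *
    match_scalars <;> grind
  · rw [smul_smul]; simp [mul_comm]

end

/-! ### Scalar form of the non-symmetric polynomials, and the actions of `T₁` and `T₀` -/

section
variable {a b c d q : ℂ}

namespace Admissible

variable (h : Admissible a b c d q)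
include h

theorem abcd0 : a * b * c * d ≠ 0 :=
  mul_ne_zero (mul_ne_zero (mul_ne_zero h.a0 h.b0) h.c0) h.d0

/-- The case `n = 0` is the assumption `abcd ≠ q`; the others reduce to `1 - abcd q^k ≠ 0`. -/
theorem q_sub (n : ℕ) : q - q ^ n * (a * b * c * d) ≠ 0 := by
  cases n with
  | zero => simpa using h.abcdq
  | succ n =>
    intro e
    refine h.abcd n (mul_left_cancel₀ h.q0 ?_)
    rw [mul_zero, ← e]; ring

end Admissible

/-- The ratio of the second to the first component of `E_n` in the normalization of `comb`. -/
def tau (a b c d q : ℂ) (n : ℤ) : ℂ :=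
  if 0 ≤ n then (1 - q ^ (n - 1) * (c * d)) / (1 - q ^ (n - 1) * (a * b * c * d))
  else (1 - q ^ (-n) * (a * b)) / (a * b * (1 - q ^ (-n)))

theorem tau_natCast (hq : q ≠ 0) (n : ℕ) : tau a b c d q n =
    (q - q ^ n * (c * d)) / (q - q ^ n * (a * b * c * d)) := by
  rw [tau, if_pos (Int.natCast_nonneg n), zpow_sub₀ hq, zpow_one, zpow_natCast,
    ← mul_div_mul_left (1 - q ^ n / q * (c * d)) _ hq]
  congr 1 <;> field_simp

theorem tau_neg (n : ℕ) : tau a b c d q (-((n : ℤ) + 1)) =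
    (1 - q ^ (n + 1) * (a * b)) / (a * b * (1 - q ^ (n + 1))) := by
  rw [tau, if_neg (by omega), neg_neg]
  norm_cast

/-- The factor beside `τ` depends only on the degree: `sigma_neg_succ` has the same one. So `E_n`
and `E_{-n}` differ only through `τ`. -/
theorem sigma_natCast_succ (h : Admissible a b c d q) (n : ℕ) :
    -sigma a b c d q ((n : ℤ) + 1) = tau a b c d q ((n : ℤ) + 1) *
      (q * (1 - q ^ (-((n : ℤ) + 1))) * (1 - q ^ (n : ℤ) * (a * b * c * d))) := by
  have h0 := h.q0
  have h1 := h.abcd n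
  rw [sigma, tau, if_pos (by omega), if_pos (by omega)]
  simp only [add_sub_cancel_right, zpow_natCast, neg_add, zpow_add₀ h0, zpow_sub₀ h0, zpow_neg,
    zpow_one]
  have h2 : 1 - q ^ n * (a * b * c * d) ≠ 0 := by rwa [mul_comm (q ^ n)]
  generalize 1 - q ^ n * (a * b * c * d) = D at *
  generalize q ^ n * (c * d) = E at *
  have h3 := pow_ne_zero n h0
  field_simp
  ring

theorem sigma_neg_succ (h : Admissible a b c d q) (n : ℕ) :
    -sigma a b c d q (-((n : ℤ) + 1)) = tau a b c d q (-((n : ℤ) + 1)) *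
      (q * (1 - q ^ (-((n : ℤ) + 1))) * (1 - q ^ (n : ℤ) * (a * b * c * d))) := by
  have h0 := h.q0
  have h1 := h.qq n
  have h2 := h.a0
  have h3 := h.b0
  have h4 := pow_ne_zero n h0
  rw [sigma, tau_neg, if_neg (by omega)]
  have e1 : q ^ (1 + -((n : ℤ) + 1)) = (q ^ n)⁻¹ := by
    rw [show 1 + -((n : ℤ) + 1) = -(n : ℤ) by ring, zpow_neg, zpow_natCast]
  have e2 : q ^ (- -((n : ℤ) + 1)) = q ^ (n + 1) := by rw [neg_neg]; norm_cast
  have e3 : q ^ (- -((n : ℤ) + 1) - 1) = q ^ n := by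
    rw [neg_neg, add_sub_cancel_right, zpow_natCast]
  have e4 : q ^ (-((n : ℤ) + 1)) = (q ^ (n + 1))⁻¹ := by rw [zpow_neg]; norm_cast
  rw [e1, e2, e3, e4, zpow_natCast]
  have e5 : q * (1 - (q ^ (n + 1))⁻¹) = -(q ^ n)⁻¹ * (1 - q ^ (n + 1)) := by
    field_simp; ring
  rw [e5]
  generalize 1 - q ^ (n + 1) = D at *
  field_simp

/-- Relates the second component, of degree `n` with parameters `qa, qb`, to the coefficients of
`R_{n+1}`, using `(x;q)_{k+1} = (1 - x) (qx;q)_k`. The last factor on each side accounts for the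
normalizations of `vecE` and `comb`. -/
theorem awCoef_shift (h : Admissible a b c d q) (n k : ℕ) :
    awCoef (q * a) (q * b) c d q n k *
      (q * (1 - q ^ (-((n : ℤ) + 1))) * (1 - q ^ (n : ℤ) * (a * b * c * d)) *
        (1 - a * b * q ^ (k + 1))) =
    awCoef a b c d q (n + 1) (k + 1) *
      ((1 - q ^ (k + 1)) * ((1 - q * a * b) * (1 - a * b) * (1 - a * c) * (1 - a * d))) := by
  have h0 := h.q0
  have e1 : qPoch (q ^ (-((n + 1 : ℕ) : ℤ))) q (k + 1) =
      (1 - q ^ (-((n : ℤ) + 1))) * qPoch (q ^ (-(n : ℤ))) q k := by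
    rw [qPoch_succ']
    push_cast
    congr 2
    rw [← zpow_one_add₀ h0]
    congr 1; ring
  have e2 : qPoch (q ^ (((n + 1 : ℕ) : ℤ) - 1) * (a * b * c * d)) q (k + 1) =
      (1 - q ^ (n : ℤ) * (a * b * c * d)) *
        qPoch (q ^ ((n : ℤ) - 1) * (q * a * (q * b) * c * d)) q k := by
    rw [qPoch_succ']
    push_cast
    rw [add_sub_cancel_right]
    congr 2
    rw [zpow_sub₀ h0, zpow_one]
    field_simp
  have e3 : qPoch (a * b) q (k + 1) * (1 - a * b * q ^ (k + 1)) =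
      (1 - a * b) * (1 - q * a * b) * qPoch (q * a * (q * b)) q k := by
    rw [← qPoch_succ, qPoch_succ', qPoch_succ']
    rw [show q * (q * (a * b)) = q * a * (q * b) by ring]
    ring
  have e4 : qPoch (a * c) q (k + 1) = (1 - a * c) * qPoch (q * a * c) q k := by
    rw [qPoch_succ', mul_assoc q]
  have e5 : qPoch (a * d) q (k + 1) = (1 - a * d) * qPoch (q * a * d) q k := by
    rw [qPoch_succ', mul_assoc q]
  have e6 : qPoch q q (k + 1) = qPoch q q k * (1 - q ^ (k + 1)) := by
    rw [qPoch_succ, pow_succ']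
  rw [awCoef, awCoef, e1, e2]
  have n1 := h.poch_ab (k + 1)
  have n2 := h.poch_ac (k + 1)
  have n3 := h.poch_ad (k + 1)
  have n4 := h.poch_qq (k + 1)
  have n5 := h.ab (k + 1)
  have n6 : qPoch (q * a * (q * b)) q k ≠ 0 := by
    intro e; rw [e, mul_zero] at e3; exact mul_ne_zero n1 n5 e3
  have n7 : (1 - a * b) * (1 - q * a * b) ≠ 0 := by
    intro e; rw [e, zero_mul] at e3; exact mul_ne_zero n1 n5 e3
  rw [e4] at n2 ⊢
  rw [e5] at n3 ⊢
  rw [e6] at n4 ⊢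
  have e7 : qPoch (a * b) q (k + 1) =
    (1 - a * b) * (1 - q * a * b) * qPoch (q * a * (q * b)) q k / (1 - a * b * q ^ (k + 1)) := by
    rw [← e3, mul_div_cancel_right₀ _ n5]
  rw [e7]
  have m1 := left_ne_zero_of_mul n2
  have m2 := right_ne_zero_of_mul n2
  have m3 := left_ne_zero_of_mul n3
  have m4 := right_ne_zero_of_mul n3
  have m5 := left_ne_zero_of_mul n4
  have m6 := right_ne_zero_of_mul n4
  have m7 := left_ne_zero_of_mul n7
  have m8 := right_ne_zero_of_mul n7
  rw [pow_succ' q k] at *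
  clear e1 e2 e3 e4 e5 e6 e7 n1 n2 n3 n4 n7
  generalize 1 - a * b * (q * q ^ k) = x1 at *
  generalize 1 - a * b = x2 at *
  generalize 1 - q * a * b = x3 at *
  generalize 1 - a * c = x4 at *
  generalize 1 - a * d = x5 at *
  generalize 1 - q * q ^ k = x6 at *
  field_simp

theorem ofVec_vecE_aux (h : Admissible a b c d q) (s : ℤ) (n : ℕ) (hs : s.natAbs = n + 1)
    (hσ : -sigma a b c d q s = tau a b c d q s *
      (q * (1 - q ^ (-((n : ℤ) + 1))) * (1 - q ^ (n : ℤ) * (a * b * c * d)))) :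
    ofVec a b (vecE a b c d q s) = comb a b c d q s.natAbs 1 (tau a b c d q s) := by
  rw [ofVec_apply, vecE, comb, hσ, one_smul]
  simp only [Submodule.coe_smul, hs, add_tsub_cancel_right]
  congr 1
  rw [awR_eq, mul_smul_comm, mul_sum, smul_sum, smul_sum]
  refine sum_congr rfl fun k _ => ?_
  rw [mul_smul_comm, smul_smul, smul_smul]
  congr 1
  have e := awCoef_shift h n k
  have n1 := h.ab (k + 1)
  have n2 : (1 - q * a * b) * (1 - a * b) * (1 - a * c) * (1 - a * d) ≠ 0 := by
    refine mul_ne_zero (mul_ne_zero (mul_ne_zero ?_ ?_) ?_) ?_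
    · have := h.ab 1; rwa [pow_one, mul_comm, ← mul_assoc] at this
    · have := h.ab 0; rwa [pow_zero, mul_one] at this
    · have := h.ac 0; rwa [pow_zero, mul_one] at this
    · have := h.ad 0; rwa [pow_zero, mul_one] at this
  rw [div_mul_eq_mul_div, mul_div_assoc', div_eq_div_iff n2 n1]
  linear_combination tau a b c d q s * e

/-- The scalar form of the non-symmetric Askey-Wilson polynomials. -/
theorem ofVec_vecE (h : Admissible a b c d q) (s : ℤ) :
    ofVec a b (vecE a b c d q s) = comb a b c d q s.natAbs 1 (tau a b c d q s) := by
  obtain ⟨n, rfl | rfl⟩ := s.eq_nat_or_neg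
  · cases n with
    | zero => simp [ofVec_apply, vecE, comb, sigma]
    | succ n =>
      refine ofVec_vecE_aux h _ n (Int.natAbs_natCast _) ?_
      push_cast
      exact sigma_natCast_succ h n
  · cases n with
    | zero => simp [ofVec_apply, vecE, comb, sigma]
    | succ n =>
      refine ofVec_vecE_aux h _ n (by omega) ?_
      push_cast
      exact sigma_neg_succ h n

/-! ### The action of `T₁` and `T₀` -/

theorem comb_add (n : ℕ) (x y x' y' : ℂ) : comb a b c d q n x y + comb a b c d q n x' y' =
    comb a b c d q n (x + x') (y + y') := by
  simp only [comb]; module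

theorem smul_comb (n : ℕ) (r x y : ℂ) :
    r • comb a b c d q n x y = comb a b c d q n (r * x) (r * y) := by
  simp only [comb]; module

theorem comb_zero_left (x y y' : ℂ) : comb a b c d q 0 x y = comb a b c d q 0 x y' := by
  simp [comb]

theorem opT1_comb (n : ℕ) (x y : ℂ) :
    opT1 a b (comb a b c d q n x y) = comb a b c d q n (-(a * b) * x) (-y) := by
  have h1 : ∀ k, opT1 a b (qAux a b * awFactor (q * a) q k) =
      -(qAux a b * awFactor (q * a) q k) := by
    intro k
    rw [mul_comm, opT1_mul_of_reflect a b (awFactor_mem (q * a) q k), opT1_qAux]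
    ring
  have h2 : opT1 a b (awR n a b c d q) = -(a * b) • awR n a b c d q := by
    rw [opT1_of_reflect a b (awR_mem n a b c d q), smul_eq, map_neg]
  simp only [comb, map_add, map_smul, map_sum, h1, h2, smul_neg, sum_neg_distrib]
  module

theorem coefU_zero : coefU a b c d q 0 = 0 := by simp [coefU]

theorem zpow_two_mul_sub_one (hq : q ≠ 0) (m : ℕ) :
    q ^ (2 * ((m : ℤ) + 1) - 1) = (q ^ (m + 1)) ^ 2 / q := by
  rw [zpow_sub₀ hq, zpow_one, ← pow_mul']; norm_cast

theorem one_sub_div_mul (hq : q ≠ 0) (x y : ℂ) : 1 - x / q * y = (q - x * y) / q := by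
  field_simp

theorem coefU_succ (hq : q ≠ 0) (m : ℕ) : coefU a b c d q ((m : ℤ) + 1) =
    -(a * b) * (1 - q ^ (m + 1)) * (q - q ^ (m + 1) * (c * d)) /
      (q - (q ^ (m + 1)) ^ 2 * (a * b * c * d)) := by
  have e4 : q ^ ((m : ℤ) + 1 - 1) = q ^ (m + 1) / q := by
    rw [zpow_sub₀ hq, zpow_one]; rfl
  have e5 : q ^ ((m : ℤ) + 1) = q ^ (m + 1) := by norm_cast
  rw [coefU, if_pos (by omega), zpow_two_mul_sub_one hq, e4, e5, one_sub_div_mul hq,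
    one_sub_div_mul hq, mul_div_assoc', div_div_div_cancel_right₀ hq]

theorem coefU_neg_succ (hq : q ≠ 0) (m : ℕ) : coefU a b c d q (-((m : ℤ) + 1)) =
    (1 - q ^ (m + 1) * (a * b)) * (q - q ^ (m + 1) * (a * b * c * d)) /
      (q - (q ^ (m + 1)) ^ 2 * (a * b * c * d)) := by
  have e4 : q ^ ((m : ℤ) + 1 - 1) = q ^ (m + 1) / q := by
    rw [zpow_sub₀ hq, zpow_one]; rfl
  have e5 : q ^ ((m : ℤ) + 1) = q ^ (m + 1) := by norm_cast
  have e6 : q ^ (-2 * -((m : ℤ) + 1) - 1) = (q ^ (m + 1)) ^ 2 / q := by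
    rw [← zpow_two_mul_sub_one hq]; congr 1
  rw [coefU, if_neg (by omega), neg_neg, e6, e4, e5, one_sub_div_mul hq,
    one_sub_div_mul hq, mul_div_assoc', div_div_div_cancel_right₀ hq]

theorem tau_succ (hq : q ≠ 0) (n : ℕ) : tau a b c d q ((n : ℤ) + 1) =
    (q - q ^ (n + 1) * (c * d)) / (q - q ^ (n + 1) * (a * b * c * d)) := by
  exact_mod_cast tau_natCast hq (n + 1)

theorem Admissible.q_sub_sq (h : Admissible a b c d q) (m : ℕ) :
    q - (q ^ m) ^ 2 * (a * b * c * d) ≠ 0 := by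
  rw [← pow_mul]; exact h.q_sub _

/-- The second coordinate of the expansion of `T₁ E_n` in `E_n`, `E_{-n}`; the first coordinate is
`-ab = (-ab - β) + β`. -/
theorem tau_coefU (h : Admissible a b c d q) {n : ℤ} (hn : n ≠ 0) :
    -tau a b c d q n = (-(a * b) - coefU a b c d q n) * tau a b c d q n +
      coefU a b c d q n * tau a b c d q (-n) := by
  obtain ⟨m, rfl | rfl⟩ := n.eq_nat_or_neg
  all_goals
    obtain ⟨m, rfl⟩ : ∃ k, m = k + 1 := ⟨m - 1, by omega⟩
    have h0 := h.q0
    have h1 := h.a0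
    have h2 := h.b0
    have h3 : 1 - q ^ (m + 1) ≠ 0 := h.qq m
    have h4 := h.q_sub (m + 1)
    have h5 := h.q_sub_sq (m + 1)
    push_cast
  · rw [tau_succ h0, tau_neg, coefU_succ h0]
    generalize q ^ (m + 1) = Q at *
    generalize e1 : 1 - Q = D1 at *
    generalize e2 : q - Q * (a * b * c * d) = D2 at *
    generalize e3 : q - Q ^ 2 * (a * b * c * d) = D3 at *
    field_simp
    rw [← e1, ← e2, ← e3]
    ring
  · rw [neg_neg, tau_succ h0, tau_neg, coefU_neg_succ h0]
    generalize q ^ (m + 1) = Q at *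
    generalize e1 : 1 - Q = D1 at *
    generalize e2 : q - Q * (a * b * c * d) = D2 at *
    generalize e3 : q - Q ^ 2 * (a * b * c * d) = D3 at *
    field_simp
    rw [← e1, ← e2, ← e3]
    ring

/-- The non-symmetric Askey-Wilson polynomial `E_n` as a Laurent polynomial. -/
def polyE (a b c d q : ℂ) (n : ℤ) : ℂ[T;T⁻¹] := comb a b c d q n.natAbs 1 (tau a b c d q n)

theorem opT1_polyE (h : Admissible a b c d q) (n : ℤ) :
    opT1 a b (polyE a b c d q n) = (-(a * b) - coefU a b c d q n) • polyE a b c d q n +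
      coefU a b c d q n • polyE a b c d q (-n) := by
  rw [polyE, polyE, Int.natAbs_neg, opT1_comb, smul_comb, smul_comb, comb_add]
  by_cases hn : n = 0
  · subst hn
    rw [coefU_zero]
    simp only [Int.natAbs_zero]
    -- In degree `0` the second coordinate multiplies an empty sum, so its value is immaterial.
    rw [comb_zero_left _ _ 0, comb_zero_left _ ((-(a * b) - 0) * _ + _) 0]
    congr 1; ring
  · rw [← tau_coefU h hn]
    congr 1; ring

/-- The eigenvalue relation for `Y`, in the form `T₀ E_n = ν(n)⁻¹ T₁⁻¹ E_n`. -/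
theorem opT0_comb (h : Admissible a b c d q) (n : ℕ) {t r : ℂ}
    (h1 : t - 1 = r * (t - (a * b)⁻¹))
    (h2 : ∀ K : ℂ, (1 - a * b * K) * (-(q⁻¹ * c * d)) * (1 + (1 - K) * (t - 1)) +
        (q⁻¹ * c * d) * t * (1 - K)  +
        (1 - K / q ^ n) * (1 - q ^ n * q⁻¹ * (a * b * c * d) * K) * (t - 1) =
      r * (-(a * b)⁻¹ * (1 - a * b * K) + t * (1 - K))) :
    opT0 c d q (comb a b c d q n 1 t) = r • comb a b c d q n (-(a * b)⁻¹) (-t) := by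
  -- `B (k + 1)` is the coefficient of `χ_k`. Since `B` vanishes at `0` and at `n + 1`, the terms
  -- `ψ_{k+1}` produced by `T₀ χ_k` can be reindexed without boundary terms.
  set B : ℕ → ℂ := fun k => awCoef a b c d q n k * (q ^ k)⁻¹ * ((1 - q ^ k) * (t - 1)) with hB
  have hB0 : B 0 = 0 := by simp [hB]
  have hBn : B (n + 1) = 0 := by simp [hB, awCoef_eq_zero h.q0 (Nat.lt_succ_self n)]
  have hshift : ∑ k ∈ range (n + 1), B (k + 1) • psiL a q (k + 1) =
      ∑ k ∈ range (n + 1), B k • psiL a q k := by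
    rw [sum_range_succ, sum_range_succ' _ n, hB0, hBn]; simp
  rw [comb_eq h (Nat.lt_succ_self n), comb_eq h (Nat.lt_succ_self n), map_add, map_sum, map_sum]
  simp only [map_smul, opT0_psiL a c d h.q0, opT0_chiL a c d h.q0]
  have e1 : ∑ k ∈ range (n + 1), (awCoef a b c d q n (k + 1) * (q ^ (k + 1))⁻¹ *
      ((1 - q ^ (k + 1)) * (t - 1))) • (-chiL a q k +
      ((1 - a * c * q ^ k) * (1 - a * d * q ^ k)) • psiL a q k -
      (q⁻¹ * c * d) • psiL a q (k + 1)) =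
      ∑ k ∈ range (n + 1), (-B (k + 1)) • chiL a q k +
      ∑ k ∈ range (n + 1), (B (k + 1) * ((1 - a * c * q ^ k) * (1 - a * d * q ^ k)) -
        (q⁻¹ * c * d) * B k) • psiL a q k := by
    simp only [sub_smul, sum_sub_distrib, mul_smul (q⁻¹ * c * d), ← smul_sum]
    rw [← hshift, smul_sum, ← sum_sub_distrib, ← sum_add_distrib]
    refine sum_congr rfl fun k _ => ?_
    simp only [hB]
    module
  rw [e1, add_left_comm, add_comm, ← sum_add_distrib, smul_add, smul_sum, smul_sum]
  congr 1
  -- Coefficients of `ψ_k`, multiplied by `1 - ab q^k`: the recursion `awCoef_succ` expresses `B (k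
  -- + 1)` by the coefficient of index `k`, and what remains is `h2` at `K = q^k`.
  · refine sum_congr rfl fun k _ => ?_
    rw [smul_smul, smul_smul, ← add_smul]
    congr 1
    have n1 := h.ab k
    have n2 := h.qq k
    have n3 := pow_ne_zero k h.q0
    have n4 := pow_ne_zero (k + 1) h.q0
    have e2 := awCoef_succ h n k
    have e3 := h2 (q ^ k)
    have e4 : q ^ (-(n : ℤ)) * q ^ k = q ^ k / q ^ n := by
      rw [zpow_neg, zpow_natCast]; field_simp
    have e5 : q ^ ((n : ℤ) - 1) = q ^ n * q⁻¹ := by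
      rw [zpow_sub₀ h.q0, zpow_one, zpow_natCast, div_eq_mul_inv]
    have e6 : B (k + 1) * ((1 - a * c * q ^ k) * (1 - a * d * q ^ k)) * (1 - a * b * q ^ k) =
        (q ^ k)⁻¹ * (t - 1) * (awCoef a b c d q n k * ((1 - q ^ k / q ^ n) *
          (1 - q ^ n * q⁻¹ * (a * b * c * d) * q ^ k))) := by
      rw [e4, e5] at e2
      have e7 : q * (q ^ (k + 1))⁻¹ = (q ^ k)⁻¹ := by
        have := h.q0
        rw [pow_succ]; field_simp
      rw [← e7]
      simp only [hB]
      linear_combination (q ^ (k + 1))⁻¹ * (t - 1) * e2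
    apply mul_right_cancel₀ n1
    have e8 : ∀ x : ℂ, x / (1 - a * b * q ^ k) * (1 - a * b * q ^ k) = x :=
      fun x => div_mul_cancel₀ x n1
    have e9 := e8 (t * (1 - q ^ k))
    have e10 := e8 (-t * (1 - q ^ k))
    generalize t * (1 - q ^ k) / (1 - a * b * q ^ k) = u at *
    generalize -t * (1 - q ^ k) / (1 - a * b * q ^ k) = u' at *
    have : B k = awCoef a b c d q n k * (q ^ k)⁻¹ * ((1 - q ^ k) * (t - 1)) := rfl
    rw [this]
    linear_combination e6 + awCoef a b c d q n k * (q ^ k)⁻¹ * e3 +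
      awCoef a b c d q n k * (q ^ k)⁻¹ * (q⁻¹ * c * d) * e9
      + awCoef a b c d q n k * (q ^ k)⁻¹ * r * e10
  -- Coefficients of `χ_k`, where `T₀` acts by `-1`: this is `h1`.
  · refine sum_congr rfl fun k _ => ?_
    rw [smul_smul]
    congr 1
    have : B (k + 1) = awCoef a b c d q n (k + 1) * (q ^ (k + 1))⁻¹ *
      ((1 - q ^ (k + 1)) * (t - 1)) := rfl
    rw [this]
    linear_combination (-awCoef a b c d q n (k + 1) * (q ^ (k + 1))⁻¹ * (1 - q ^ (k + 1))) * h1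

end

/-! ### Eigenvalues of `Y`, and the coefficients of `Ť₁` -/

section
variable {a b c d q : ℂ}

theorem nuSeq_natCast (hq : q ≠ 0) (n : ℕ) :
    nuSeq a b c d q n = q / (q ^ n * (a * b * c * d)) := by
  rw [nuSeq, if_pos (Int.natCast_nonneg n), zpow_sub₀ hq, zpow_one, zpow_natCast]
  ring

theorem nuSeq_neg_succ (n : ℕ) : nuSeq a b c d q (-((n : ℤ) + 1)) = q ^ (n + 1) := by
  rw [nuSeq, if_neg (by omega), neg_neg]; norm_cast

theorem nuSeq_ne_zero (h : Admissible a b c d q) (n : ℤ) : nuSeq a b c d q n ≠ 0 := by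
  rw [nuSeq]
  split_ifs
  · exact mul_ne_zero (inv_ne_zero h.abcd0) (zpow_ne_zero _ h.q0)
  · exact zpow_ne_zero _ h.q0

theorem opT1Inv_comb (h : Admissible a b c d q) (n : ℕ) (x y : ℂ) :
    opT1Inv a b (comb a b c d q n x y) = comb a b c d q n (-(a * b)⁻¹ * x) (-y) := by
  have h0 := mul_ne_zero h.a0 h.b0
  rw [opT1Inv_apply, opT1_comb, smul_comb, smul_comb, sub_eq_add_neg,
    ← neg_one_smul ℂ (comb a b c d q n (_ * x) (_ * y)), smul_comb, comb_add]
  congr 1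
  · linear_combination x * inv_mul_cancel₀ h0
  · ring

theorem opT0_polyE (h : Admissible a b c d q) (n : ℤ) :
    opT0 c d q (polyE a b c d q n) =
      (nuSeq a b c d q n)⁻¹ • comb a b c d q n.natAbs (-(a * b)⁻¹) (-tau a b c d q n) := by
  have h0 := h.q0
  have ha := h.a0
  have hb := h.b0
  have hc := h.c0
  have hd := h.d0
  rcases lt_or_ge n 0 with hn | hn
  · obtain ⟨m, rfl⟩ : ∃ m : ℕ, n = -((m : ℤ) + 1) := ⟨(-n - 1).toNat, by omega⟩
    have h3 : 1 - q ^ (m + 1) ≠ 0 := h.qq m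
    have hQ := pow_ne_zero (m + 1) h.q0
    have e : (-((m : ℤ) + 1)).natAbs = m + 1 := by omega
    rw [polyE, e]
    apply opT0_comb h
    · rw [tau_neg, nuSeq_neg_succ]
      generalize q ^ (m + 1) = Q at *
      generalize e2 : 1 - Q = D2 at *
      field_simp
      rw [← e2]
      ring
    · intro K
      rw [tau_neg, nuSeq_neg_succ]
      generalize q ^ (m + 1) = Q at *
      generalize e2 : 1 - Q = D2 at *
      field_simp
      rw [← e2]
      ring
  · obtain ⟨m, rfl⟩ := Int.eq_ofNat_of_zero_le hn
    have hQ := pow_ne_zero m h.q0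
    have h4 := h.q_sub m
    rw [polyE, Int.natAbs_natCast]
    apply opT0_comb h
    · rw [tau_natCast h0, nuSeq_natCast h0]
      generalize q ^ m = Q at *
      generalize e2 : q - Q * (a * b * c * d) = D2 at *
      field_simp
      rw [← e2]
      ring
    · intro K
      rw [tau_natCast h0, nuSeq_natCast h0]
      generalize q ^ m = Q at *
      generalize e2 : q - Q * (a * b * c * d) = D2 at *
      field_simp
      rw [← e2]
      ring

/-- `E_n` is an eigenfunction of `Y`. -/
theorem opY_polyE (h : Admissible a b c d q) (n : ℤ) :
    opY a b c d q (polyE a b c d q n) = (nuSeq a b c d q n)⁻¹ • polyE a b c d q n := by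
  rw [opY, LinearMap.comp_apply, opT0_polyE h, map_smul, opT1_comb]
  congr 1
  rw [polyE]
  congr 1
  · field_simp [h.a0, h.b0]
  · ring

/-! ### The action of `Ť₁` -/

/-- Three neighbouring coefficients in terms of one common factor `e`. Their ratios are not
available, because terminating coefficients may vanish; the third identity is therefore left
multiplied by a factor that is nonzero where it is used. -/
theorem awCoef_param (h : Admissible a b c d q) (n k : ℕ) : ∃ e : ℂ,
    awCoef a b c d q n (k + 1) = e * ((1 - q ^ k / q ^ n) * (q - q ^ n * (a * b * c * d))) ∧
    awCoef a b c d q (n + 1) (k + 1) =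
      e * (q * (1 - (q ^ (n + 1))⁻¹) * (1 - q ^ n * (a * b * c * d) * q ^ k)) ∧
    awCoef a b c d q n k * (q - q ^ n * (a * b * c * d) * q ^ k) =
      e * ((1 - a * b * q ^ k) * (1 - a * c * q ^ k) * (1 - a * d * q ^ k) * (1 - q ^ (k + 1)) *
        (q - q ^ n * (a * b * c * d))) := by
  have h0 := h.q0
  have e1 : qPoch (q ^ (-(n : ℤ))) q (k + 1) =
      qPoch (q ^ (-(n : ℤ))) q k * (1 - q ^ k / q ^ n) := by
    rw [qPoch_succ, zpow_neg, zpow_natCast]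
    congr 2; field_simp
  have e2 : qPoch (q ^ (-((n + 1 : ℕ) : ℤ))) q (k + 1) =
      (1 - (q ^ (n + 1))⁻¹) * qPoch (q ^ (-(n : ℤ))) q k := by
    rw [qPoch_succ', zpow_neg, zpow_natCast]
    congr 2
    rw [zpow_neg, zpow_natCast, pow_succ]
    field_simp
  have e3 : qPoch (q ^ ((n : ℤ) - 1) * (a * b * c * d)) q (k + 1) =
      (1 - q ^ n / q * (a * b * c * d)) * qPoch (q ^ n * (a * b * c * d)) q k := by
    rw [qPoch_succ', zpow_sub₀ h0, zpow_one, zpow_natCast]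
    congr 2; field_simp
  have e4 : qPoch (q ^ (((n + 1 : ℕ) : ℤ) - 1) * (a * b * c * d)) q (k + 1) =
      qPoch (q ^ n * (a * b * c * d)) q k * (1 - q ^ n * (a * b * c * d) * q ^ k) := by
    rw [qPoch_succ]; push_cast; rw [add_sub_cancel_right, zpow_natCast]
  have e5 : qPoch (q ^ ((n : ℤ) - 1) * (a * b * c * d)) q k *
      (1 - q ^ n / q * (a * b * c * d) * q ^ k) =
      (1 - q ^ n / q * (a * b * c * d)) * qPoch (q ^ n * (a * b * c * d)) q k := by
    rw [← e3, qPoch_succ, zpow_sub₀ h0, zpow_one, zpow_natCast]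
  have d1 : q - q ^ n * (a * b * c * d) = q * (1 - q ^ n / q * (a * b * c * d)) := by field_simp
  have d2 : q - q ^ n * (a * b * c * d) * q ^ k = q * (1 - q ^ n / q * (a * b * c * d) * q ^ k) := by
    field_simp
  refine ⟨q⁻¹ * (qPoch (q ^ (-(n : ℤ))) q k * qPoch (q ^ n * (a * b * c * d)) q k /
    (qPoch (a * b) q (k + 1) * qPoch (a * c) q (k + 1) * qPoch (a * d) q (k + 1) *
      qPoch q q (k + 1)) * q ^ (k + 1)), ?_, ?_, ?_⟩
  · rw [awCoef, e1, e3, d1]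
    field_simp
  · rw [awCoef, e2, e4]
    field_simp
  · rw [awCoef, d1, d2]
    have n1 := h.poch_ab k
    have n2 := h.poch_ac k
    have n3 := h.poch_ad k
    have n4 := h.poch_qq k
    have n5 := h.ab k
    have n6 := h.ac k
    have n7 := h.ad k
    have n8 := h.qq k
    simp only [qPoch_succ, pow_succ' q k] at *
    generalize 1 - a * b * q ^ k = x1 at *
    generalize 1 - a * c * q ^ k = x2 at *
    generalize 1 - a * d * q ^ k = x3 at *
    generalize 1 - q * q ^ k = x4 at *
    generalize 1 - q ^ n / q * (a * b * c * d) = x5 at *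
    generalize 1 - q ^ n / q * (a * b * c * d) * q ^ k = x6 at *
    generalize qPoch (q ^ ((n : ℤ) - 1) * (a * b * c * d)) q k = P1 at *
    generalize qPoch (q ^ n * (a * b * c * d)) q k = P2 at *
    field_simp
    linear_combination qPoch (q ^ (-(n : ℤ))) q k * e5

/-- The diagonal coefficient of `Ť₁` in the basis `E_n`, in terms of `v = ν(n)`. -/
def coefG (a b c d q v : ℂ) : ℂ :=
  v * (q * (c + d) - c * d * (a + b) * v) / (a * b * c * d * v ^ 2 - q ^ 2)

/-- The off-diagonal coefficient of `Ť₁` in the basis `E_n`, in terms of `v = ν(n)`. -/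
def coefD (a b c d q v : ℂ) : ℂ :=
  q ^ 2 * (1 - q⁻¹ * b * c * v) * (1 - q⁻¹ * b * d * v) / (b * (a * b * c * d * v ^ 2 - q ^ 2))

theorem Admissible.one_sub_sq (h : Admissible a b c d q) (m : ℕ) :
    1 - (q ^ m) ^ 2 * (a * b * c * d) ≠ 0 := by
  rw [← pow_mul, mul_comm]; exact h.abcd _

theorem coefG_natCast (h : Admissible a b c d q) (n : ℕ) :
    coefG a b c d q (nuSeq a b c d q n) =
      (a * b * q ^ n * (c + d) - (a + b)) / (a * b * (1 - (q ^ n) ^ 2 * (a * b * c * d))) := by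
  have h0 := h.q0
  have ha := h.a0
  have hb := h.b0
  have hc := h.c0
  have hd := h.d0
  have hQ := pow_ne_zero n h0
  have h1 := h.one_sub_sq n
  rw [coefG, nuSeq_natCast h0]
  generalize q ^ n = Q at *
  have e1 : a * b * c * d * (q / (Q * (a * b * c * d))) ^ 2 - q ^ 2 =
    q ^ 2 * (1 - Q ^ 2 * (a * b * c * d)) / (Q ^ 2 * (a * b * c * d)) := by
    field_simp
  rw [e1]
  generalize 1 - Q ^ 2 * (a * b * c * d) = D at *
  field_simp

theorem coefD_natCast (h : Admissible a b c d q) (n : ℕ) :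
    coefD a b c d q (nuSeq a b c d q n) =
      (1 - a * d * q ^ n) * (1 - a * c * q ^ n) / (a * (1 - (q ^ n) ^ 2 * (a * b * c * d))) := by
  have h0 := h.q0
  have ha := h.a0
  have hb := h.b0
  have hc := h.c0
  have hd := h.d0
  have hQ := pow_ne_zero n h0
  have h1 := h.one_sub_sq n
  rw [coefD, nuSeq_natCast h0]
  generalize q ^ n = Q at *
  have e1 : a * b * c * d * (q / (Q * (a * b * c * d))) ^ 2 - q ^ 2 =
    q ^ 2 * (1 - Q ^ 2 * (a * b * c * d)) / (Q ^ 2 * (a * b * c * d)) := by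
    field_simp
  rw [e1]
  generalize 1 - Q ^ 2 * (a * b * c * d) = D at *
  field_simp
  ring

theorem coefG_neg_succ (h : Admissible a b c d q) (n : ℕ) :
    coefG a b c d q (nuSeq a b c d q (-((n : ℤ) + 1))) =
      -(q ^ n * (c + d - c * d * (a + b) * q ^ n)) / (1 - (q ^ n) ^ 2 * (a * b * c * d)) := by
  have h0 := h.q0
  have h1 := h.one_sub_sq n
  rw [coefG, nuSeq_neg_succ, pow_succ']
  generalize q ^ n = Q at *
  have e1 : a * b * c * d * (q * Q) ^ 2 - q ^ 2 = -(q ^ 2 * (1 - Q ^ 2 * (a * b * c * d))) := by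
    ring
  rw [e1]
  generalize 1 - Q ^ 2 * (a * b * c * d) = D at *
  field_simp

theorem coefD_neg_succ (h : Admissible a b c d q) (n : ℕ) :
    coefD a b c d q (nuSeq a b c d q (-((n : ℤ) + 1))) =
      -((1 - b * c * q ^ n) * (1 - b * d * q ^ n)) / (b * (1 - (q ^ n) ^ 2 * (a * b * c * d))) := by
  have h0 := h.q0
  have hb := h.b0
  have h1 := h.one_sub_sq n
  rw [coefD, nuSeq_neg_succ, pow_succ' q n]
  generalize q ^ n = Q at *
  have e1 : a * b * c * d * (q * Q) ^ 2 - q ^ 2 = -(q ^ 2 * (1 - Q ^ 2 * (a * b * c * d))) := by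
    ring
  rw [e1]
  generalize 1 - Q ^ 2 * (a * b * c * d) = D at *
  field_simp

/-- This is needed twice: to obtain `Ť₁ E_{-n-1}` from `Ť₁ E_n`, and to know that `Ť₁` really raises
the index in the proof of faithfulness. -/
theorem coefD_ne_zero (h : Admissible a b c d q) (n : ℤ) :
    coefD a b c d q (nuSeq a b c d q n) ≠ 0 := by
  rcases lt_or_ge n 0 with hn | hn
  · obtain ⟨m, rfl⟩ : ∃ m : ℕ, n = -((m : ℤ) + 1) := ⟨(-n - 1).toNat, by omega⟩
    rw [coefD_neg_succ h]
    exact div_ne_zero (neg_ne_zero.mpr (mul_ne_zero (h.bc m) (h.bd m)))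
      (mul_ne_zero h.b0 (h.one_sub_sq m))
  · obtain ⟨m, rfl⟩ := Int.eq_ofNat_of_zero_le hn
    rw [coefD_natCast h]
    exact div_ne_zero (mul_ne_zero (h.ad m) (h.ac m)) (mul_ne_zero h.a0 (h.one_sub_sq m))

end

/-! ### The action of `Ť₁` on `E_n` for `n ≥ 0` -/

section
variable {a b c d q : ℂ}

theorem polyE_zero : polyE a b c d q 0 = 1 := by
  simp [polyE, comb, awR, qPoch, awFactor]

/-- Expansion of `z⁻¹ (x R_n + y S_n)`. -/
theorem opZInv_comb (h : Admissible a b c d q) {n N : ℕ} (hN : n < N) (x y : ℂ) :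
    opZInv (comb a b c d q n x y) =
      (a * x) • psiL a q 0 +
      ∑ k ∈ range N, (a * (awCoef a b c d q n (k + 1) *
          (x - y * (1 - q ^ (k + 1)) / (1 - a * b * q ^ (k + 1)))) -
        (a * q ^ (k + 1))⁻¹ * (awCoef a b c d q n k * (q ^ k)⁻¹ *
          (x - y * (1 - q ^ k) / (1 - a * b * q ^ k)) +
          awCoef a b c d q n (k + 1) * (q ^ (k + 1))⁻¹ * ((1 - q ^ (k + 1)) * (y - x)))) •
        psiL a q (k + 1) +
      ∑ k ∈ range N, ((a * q ^ (k + 1))⁻¹ * (awCoef a b c d q n k * (q ^ k)⁻¹ *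
          (x - y * (1 - q ^ k) / (1 - a * b * q ^ k)) +
          awCoef a b c d q n (k + 1) * (q ^ (k + 1))⁻¹ * ((1 - q ^ (k + 1)) * (y - x)))) •
        chiL a q k := by
  rw [comb_eq h hN, map_add, map_sum, map_sum]
  simp only [map_smul, opZInv_psiL h.a0 h.q0, opZInv_chiL h.a0 h.q0]
  -- The remaining terms of `z⁻¹ ψ_k` and `z⁻¹ χ_k` contain only `ψ_{k+1}` and `χ_k`. The diagonal
  -- terms are shifted to match: index `0` gives `ψ_0`, and the term of index `N` is zero because `n
  -- < N`.
  have e : ∑ k ∈ range N, (awCoef a b c d q n k * (q ^ k)⁻¹ *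
      (x - y * (1 - q ^ k) / (1 - a * b * q ^ k))) • (a * q ^ k) • psiL a q k =
      (a * x) • psiL a q 0 + ∑ k ∈ range N, (a * (awCoef a b c d q n (k + 1) *
          (x - y * (1 - q ^ (k + 1)) / (1 - a * b * q ^ (k + 1))))) • psiL a q (k + 1) := by
    have e1 : ∀ k, (awCoef a b c d q n k * (q ^ k)⁻¹ *
        (x - y * (1 - q ^ k) / (1 - a * b * q ^ k))) • (a * q ^ k) • psiL a q k =
        (a * (awCoef a b c d q n k *
          (x - y * (1 - q ^ k) / (1 - a * b * q ^ k)))) • psiL a q k := by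
      intro k
      rw [smul_smul]
      congr 1
      have := pow_ne_zero k h.q0
      generalize x - y * (1 - q ^ k) / (1 - a * b * q ^ k) = u
      field_simp
    simp only [e1]
    have e2 := sum_range_succ' (fun k => (a * (awCoef a b c d q n k *
          (x - y * (1 - q ^ k) / (1 - a * b * q ^ k)))) • psiL a q k) N
    rw [sum_range_succ, awCoef_eq_zero h.q0 hN] at e2
    simp only [zero_mul, mul_zero, zero_smul, add_zero] at e2
    rw [e2, awCoef_zero, add_comm]
    simp
  simp only [smul_sub, sum_sub_distrib, e]
  simp only [add_assoc, sub_eq_add_neg]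
  simp only [← sum_neg_distrib, ← sum_add_distrib]
  congr 1
  refine sum_congr rfl fun k _ => ?_
  module

/-- The polynomial identities behind the action of `Ť₁`. -/
theorem opCT1_scalar_aux (h : Admissible a b c d q) (n : ℕ) :
    coefG a b c d q (nuSeq a b c d q n) + coefD a b c d q (nuSeq a b c d q n) = -b⁻¹ := by
  have ha := h.a0
  have hb := h.b0
  have h1 := h.one_sub_sq n
  rw [coefG_natCast h, coefD_natCast h]
  generalize q ^ n = Q at *
  generalize e1 : 1 - Q ^ 2 * (a * b * c * d) = D at *
  field_simp
  rw [← e1]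
  ring

theorem opCT1_polyE_natCast (h : Admissible a b c d q) (n : ℕ) :
    opCT1 a b (polyE a b c d q n) =
      coefG a b c d q (nuSeq a b c d q n) • polyE a b c d q n +
      coefD a b c d q (nuSeq a b c d q n) • polyE a b c d q (-(n : ℤ) - 1) := by
  have e0 : (-(n : ℤ) - 1).natAbs = n + 1 := by omega
  rw [opCT1_apply, polyE, polyE, e0, Int.natAbs_natCast, opT1Inv_comb h,
    opZInv_comb h (N := n + 2) (by omega)]
  -- With the bound `n + 3`, removing `ψ_0` at one end and a vanishing `χ_{n+2}` at the other leaves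
  -- sums of `ψ_{k+1}` and `χ_k` over `range (n + 2)`, as in the expansion of the left side.
  have e1 := comb_eq h (n := n) (N := n + 3) (by omega) 1 (tau a b c d q n)
  have e2 := comb_eq h (n := n + 1) (N := n + 3) (by omega) 1 (tau a b c d q (-(n : ℤ) - 1))
  rw [sum_range_succ', sum_range_succ _ (n + 2)] at e1 e2
  rw [awCoef_eq_zero h.q0 (show n < n + 2 + 1 by omega)] at e1
  rw [awCoef_eq_zero h.q0 (show n + 1 < n + 2 + 1 by omega)] at e2
  -- This sum rule is the value at `z = a⁻¹`, where each `E_m` equals `1` and `z⁻¹ T₁⁻¹ E_n` equals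
  -- `a * (-(ab)⁻¹)`.
  have hs := opCT1_scalar_aux h n
  rw [e1, e2]
  simp only [awCoef_zero, pow_zero, sub_self, mul_zero, zero_div, sub_zero, inv_one, mul_one,
    zero_mul, zero_smul, add_zero]
  have ha := h.a0
  have hb := h.b0
  have h0 := h.q0
  set γ := coefG a b c d q (nuSeq a b c d q n) with hγ
  set δ := coefD a b c d q (nuSeq a b c d q n) with hδ
  -- First the coefficients of `χ_k`, then the sums of the coefficients of `χ_k` and `ψ_{k+1}`. In
  -- the sums the contribution of `χ_k` on the left side cancels.
  have main : ∀ k : ℕ, ((a * q ^ (k + 1))⁻¹ * (awCoef a b c d q n k * (q ^ k)⁻¹ *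
          (-(a * b)⁻¹ - -tau a b c d q n * (1 - q ^ k) / (1 - a * b * q ^ k)) +
          awCoef a b c d q n (k + 1) * (q ^ (k + 1))⁻¹ *
            ((1 - q ^ (k + 1)) * (-tau a b c d q n - -(a * b)⁻¹))) =
        γ * (awCoef a b c d q n (k + 1) * (q ^ (k + 1))⁻¹ *
          ((1 - q ^ (k + 1)) * (tau a b c d q n - 1))) +
        δ * (awCoef a b c d q (n + 1) (k + 1) * (q ^ (k + 1))⁻¹ *
          ((1 - q ^ (k + 1)) * (tau a b c d q (-(n : ℤ) - 1) - 1)))) ∧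
        a * (awCoef a b c d q n (k + 1) * (-(a * b)⁻¹ -
          -tau a b c d q n * (1 - q ^ (k + 1)) / (1 - a * b * q ^ (k + 1)))) =
        γ * (awCoef a b c d q n (k + 1) * (q ^ (k + 1))⁻¹ *
          ((1 - tau a b c d q n * (1 - q ^ (k + 1)) / (1 - a * b * q ^ (k + 1))) +
          ((1 - q ^ (k + 1)) * (tau a b c d q n - 1)))) +
        δ * (awCoef a b c d q (n + 1) (k + 1) * (q ^ (k + 1))⁻¹ *
          ((1 - tau a b c d q (-(n : ℤ) - 1) * (1 - q ^ (k + 1)) / (1 - a * b * q ^ (k + 1))) +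
          ((1 - q ^ (k + 1)) * (tau a b c d q (-(n : ℤ) - 1) - 1)))) := by
    intro k
    obtain ⟨e, f1, f2, f3⟩ := awCoef_param h n k
    have n1 := h.ab k
    have n2 := h.ab (k + 1)
    have nK := pow_ne_zero k h0
    have nQ := pow_ne_zero n h0
    have n3 := h.qq n
    have n4 := h.q_sub n
    have n5 : q - q ^ n * (a * b * c * d) * q ^ k ≠ 0 := by
      have := h.q_sub (n + k)
      rwa [pow_add, mul_right_comm] at this
    have n6 := h.one_sub_sq n
    have t1 := tau_natCast (a := a) (b := b) (c := c) (d := d) h0 n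
    have t2 := tau_neg (a := a) (b := b) (c := c) (d := d) (q := q) n
    rw [neg_add, ← sub_eq_add_neg] at t2
    have g1 := coefG_natCast h n
    have g2 := coefD_natCast h n
    rw [← hγ] at g1
    rw [← hδ] at g2
    rw [pow_succ' q k] at *
    rw [pow_succ' q n] at *
    generalize tau a b c d q n = τ at *
    generalize tau a b c d q (-(n : ℤ) - 1) = τ' at *
    generalize awCoef a b c d q n k = c0 at *
    generalize awCoef a b c d q n (k + 1) = c1 at *
    generalize awCoef a b c d q (n + 1) (k + 1) = c2 at *
    clear_value γ δ
    clear e1 e2 hγ hδ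
    generalize q ^ k = K at *
    generalize q ^ n = Q at *
    have i1 : ∀ L : ℂ, 1 - a * b * L ≠ 0 → -(a * b)⁻¹ - -τ * (1 - L) / (1 - a * b * L) =
        -((1 - a * b) * (q - Q * (a * b * c * d) * L)) /
          (a * b * (1 - a * b * L) * (q - Q * (a * b * c * d))) := by
      intro L hL
      rw [t1]
      generalize e1 : 1 - a * b * L = D1 at *
      generalize e2 : q - Q * (a * b * c * d) = D2 at *
      field_simp
      rw [← e1, ← e2]
      ring
    have i2 : -τ - -(a * b)⁻¹ = q * (1 - a * b) / (a * b * (q - Q * (a * b * c * d))) := by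
      rw [t1]
      generalize e2 : q - Q * (a * b * c * d) = D2 at *
      field_simp
      rw [← e2]
      ring
    have i3 : τ - 1 = -(Q * c * d * (1 - a * b)) / (q - Q * (a * b * c * d)) := by
      rw [t1]
      generalize e2 : q - Q * (a * b * c * d) = D2 at *
      field_simp
      rw [← e2]
      ring
    have i4 : τ' - 1 = (1 - a * b) / (a * b * (1 - q * Q)) := by
      rw [t2]
      generalize e2 : 1 - q * Q = D2 at *
      field_simp
      rw [← e2]
      ring
    have i5 : -(a * b)⁻¹ - -τ' * (1 - q * K) / (1 - a * b * (q * K)) =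
        -(q * (1 - a * b) * (K - Q)) / (a * b * (1 - q * Q) * (1 - a * b * (q * K))) := by
      rw [t2]
      generalize e1 : 1 - a * b * (q * K) = D1 at *
      generalize e2 : 1 - q * Q = D2 at *
      field_simp
      rw [← e1, ← e2]
      ring
    have j1 : c0 * (-(a * b)⁻¹ - -τ * (1 - K) / (1 - a * b * K)) =
        -(e * (1 - a * b) * ((1 - a * c * K) * (1 - a * d * K) * (1 - q * K))) / (a * b) := by
      rw [i1 K n1, ← mul_left_inj' n5]
      have : c0 * (-((1 - a * b) * (q - Q * (a * b * c * d) * K)) /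
          (a * b * (1 - a * b * K) * (q - Q * (a * b * c * d)))) = -((1 - a * b) *
          (c0 * (q - Q * (a * b * c * d) * K))) /
          (a * b * (1 - a * b * K) * (q - Q * (a * b * c * d))) := by ring
      rw [this, f3]
      generalize 1 - a * b * K = D1 at *
      generalize q - Q * (a * b * c * d) = D2 at *
      field_simp
    have j2 : c1 * (-τ - -(a * b)⁻¹) = e * (1 - K / Q) * q * (1 - a * b) / (a * b) := by
      rw [i2, f1]
      generalize q - Q * (a * b * c * d) = D2 at *
      field_simp
    have j3 : c1 * (τ - 1) = -(e * (Q - K) * c * d * (1 - a * b)) := by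
      rw [i3, f1]
      generalize q - Q * (a * b * c * d) = D2 at *
      field_simp
    have j4 : c2 * (τ' - 1) = -(e * (1 - Q * (a * b * c * d) * K) * (1 - a * b)) / (a * b * Q) := by
      rw [i4, f2]
      have : q * (1 - (q * Q)⁻¹) = -(1 - q * Q) / Q := by
        field_simp; ring
      rw [this]
      generalize 1 - q * Q = D2 at *
      field_simp
    have j5 : c1 * (-(a * b)⁻¹ - -τ * (1 - q * K) / (1 - a * b * (q * K))) =
        -(e * (1 - K / Q) * (1 - a * b) * (q * (1 - Q * (a * b * c * d) * K))) /
          (a * b * (1 - a * b * (q * K))) := by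
      rw [i1 _ n2, f1]
      have : q - Q * (a * b * c * d) * (q * K) = q * (1 - Q * (a * b * c * d) * K) := by ring
      rw [this]
      generalize 1 - a * b * (q * K) = D1 at *
      generalize q - Q * (a * b * c * d) = D2 at *
      field_simp
    have j6 : c2 * (-(a * b)⁻¹ - -τ' * (1 - q * K) / (1 - a * b * (q * K))) =
        -(e * (1 - K / Q) * (1 - a * b) * (q * (1 - Q * (a * b * c * d) * K))) /
          (a * b * (1 - a * b * (q * K))) := by
      rw [i5, f2]
      have : q * (1 - (q * Q)⁻¹) = -(1 - q * Q) / Q := by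
        field_simp; ring
      rw [this]
      generalize 1 - a * b * (q * K) = D1 at *
      generalize 1 - q * Q = D2 at *
      field_simp
      ring
    constructor
    · have l1 : c0 * K⁻¹ * (-(a * b)⁻¹ - -τ * (1 - K) / (1 - a * b * K)) +
          c1 * (q * K)⁻¹ * ((1 - q * K) * (-τ - -(a * b)⁻¹)) =
          K⁻¹ * (-(e * (1 - a * b) * ((1 - a * c * K) * (1 - a * d * K) * (1 - q * K))) / (a * b)) +
          (q * K)⁻¹ * (1 - q * K) * (e * (1 - K / Q) * q * (1 - a * b) / (a * b)) := by
        rw [← j1, ← j2]; ring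
      have l2 : γ * (c1 * (q * K)⁻¹ * ((1 - q * K) * (τ - 1))) +
          δ * (c2 * (q * K)⁻¹ * ((1 - q * K) * (τ' - 1))) =
          (q * K)⁻¹ * (1 - q * K) * (γ * (-(e * (Q - K) * c * d * (1 - a * b))) +
            δ * (-(e * (1 - Q * (a * b * c * d) * K) * (1 - a * b)) / (a * b * Q))) := by
        rw [← j3, ← j4]; ring
      rw [l1, l2, g1, g2]
      generalize e1 : 1 - Q ^ 2 * (a * b * c * d) = D1 at *
      field_simp
      rw [← e1]
      ring
    · have l : ∀ t : ℂ, (q * K)⁻¹ * (1 - t * (1 - q * K) / (1 - a * b * (q * K)) +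
          (1 - q * K) * (t - 1)) =
          -(a * b) * (-(a * b)⁻¹ - -t * (1 - q * K) / (1 - a * b * (q * K))) := by
        intro t
        generalize e1 : 1 - a * b * (q * K) = D1 at *
        field_simp
        rw [← e1]
        ring
      rw [mul_assoc c1, mul_assoc c2, l, l]
      have hd : a * b * (γ + δ) = -a := by
        rw [hs]; field_simp
      -- By `j5` and `j6` the expressions for `E_n` and `E_{-n-1}` coincide, so that only `γ + δ`
      -- enters.
      linear_combination (a + a * b * γ) * (j5.trans j6.symm) +
        c2 * (-(a * b)⁻¹ - -τ' * (1 - q * K) / (1 - a * b * (q * K))) * hd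
  -- The coefficient of `ψ_0`.
  have h00 : a * -(a * b)⁻¹ = γ + δ := by
    rw [hs]; field_simp
  rw [h00]
  have s1 : ∀ k : ℕ, ∀ x : ℂ, x = γ * (awCoef a b c d q n (k + 1) * (q ^ (k + 1))⁻¹ *
          ((1 - q ^ (k + 1)) * (tau a b c d q n - 1))) +
        δ * (awCoef a b c d q (n + 1) (k + 1) * (q ^ (k + 1))⁻¹ *
          ((1 - q ^ (k + 1)) * (tau a b c d q (-(n : ℤ) - 1) - 1))) →
      (a * (awCoef a b c d q n (k + 1) * (-(a * b)⁻¹ -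
          -tau a b c d q n * (1 - q ^ (k + 1)) / (1 - a * b * q ^ (k + 1)))) - x) •
            psiL a q (k + 1) + x • chiL a q k =
      γ • ((awCoef a b c d q n (k + 1) * (q ^ (k + 1))⁻¹ *
          (1 - tau a b c d q n * (1 - q ^ (k + 1)) / (1 - a * b * q ^ (k + 1)))) •
            psiL a q (k + 1) + (awCoef a b c d q n (k + 1) * (q ^ (k + 1))⁻¹ *
          ((1 - q ^ (k + 1)) * (tau a b c d q n - 1))) • chiL a q k) +
      δ • ((awCoef a b c d q (n + 1) (k + 1) * (q ^ (k + 1))⁻¹ *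
          (1 - tau a b c d q (-(n : ℤ) - 1) * (1 - q ^ (k + 1)) / (1 - a * b * q ^ (k + 1)))) •
            psiL a q (k + 1) + (awCoef a b c d q (n + 1) (k + 1) * (q ^ (k + 1))⁻¹ *
          ((1 - q ^ (k + 1)) * (tau a b c d q (-(n : ℤ) - 1) - 1))) • chiL a q k) := by
    intro k x hx
    rw [(main k).2, hx]
    module
  have s2 := sum_congr (M := ℂ[T;T⁻¹]) (s₁ := range (n + 2)) rfl fun k _ => s1 k _ (main k).1
  rw [sum_add_distrib, sum_add_distrib, ← smul_sum, ← smul_sum, sum_add_distrib,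
    sum_add_distrib] at s2
  rw [add_assoc, s2]
  simp only [one_smul]
  module

end

/-! ### The action of `Ť₁` for all `n`, the coefficients of `M`, and the basis property -/

section
variable {a b c d q : ℂ}

theorem exists_neg_succ {n : ℤ} (hn : n < 0) : ∃ m : ℕ, n = -((m : ℤ) + 1) :=
  ⟨(-n - 1).toNat, by omega⟩

/-- The trace of `Ť₁` on the span of `E_n` and `E_{-n-1}`, as dictated by its quadratic relation;
`coefD_mul` is the determinant. -/
theorem coefG_add (h : Admissible a b c d q) (n : ℕ) :
    coefG a b c d q (nuSeq a b c d q (-((n : ℤ) + 1))) =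
      -(a + b) / (a * b) - coefG a b c d q (nuSeq a b c d q n) := by
  have ha := h.a0
  have hb := h.b0
  have h1 := h.one_sub_sq n
  rw [coefG_natCast h, coefG_neg_succ h]
  generalize q ^ n = Q at *
  generalize e1 : 1 - Q ^ 2 * (a * b * c * d) = D at *
  field_simp
  rw [← e1]
  ring

theorem coefD_mul (h : Admissible a b c d q) (n : ℕ) :
    coefD a b c d q (nuSeq a b c d q n) * coefD a b c d q (nuSeq a b c d q (-((n : ℤ) + 1))) =
      coefG a b c d q (nuSeq a b c d q n) * coefG a b c d q (nuSeq a b c d q (-((n : ℤ) + 1))) -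
        (a * b)⁻¹ := by
  have ha := h.a0
  have hb := h.b0
  have h1 := h.one_sub_sq n
  rw [coefG_natCast h, coefG_neg_succ h, coefD_natCast h, coefD_neg_succ h]
  generalize q ^ n = Q at *
  generalize e1 : 1 - Q ^ 2 * (a * b * c * d) = D at *
  field_simp
  rw [← e1]
  ring

theorem opCT1_opCT1 (h : Admissible a b c d q) (f : ℂ[T;T⁻¹]) :
    opCT1 a b (opCT1 a b f) = (-(a + b) / (a * b)) • opCT1 a b f - (a * b)⁻¹ • f := by
  have h0 := mul_ne_zero h.a0 h.b0
  have := congrArg (fun u : Module.End ℂ ℂ[T;T⁻¹] => (a * b)⁻¹ • u f)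
    (opCT1_quadratic h.a0 h.b0 h.ab_ne_one)
  simp only [LinearMap.smul_apply, LinearMap.sub_apply, Module.End.mul_apply, inv_smul_smul₀ h0,
    Module.End.one_apply] at this
  rw [this, smul_sub, smul_smul]
  congr 2
  ring

/-- For `n = -m - 1 < 0` no new expansion is needed: applying `Ť₁` twice to `E_m` and using the
quadratic relation determines `δ Ť₁ E_{-m-1}`, with `δ ≠ 0`. Trace and determinant identify its
coefficients. -/
theorem opCT1_polyE (h : Admissible a b c d q) (n : ℤ) :
    opCT1 a b (polyE a b c d q n) =
      coefG a b c d q (nuSeq a b c d q n) • polyE a b c d q n +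
      coefD a b c d q (nuSeq a b c d q n) • polyE a b c d q (-n - 1) := by
  rcases lt_or_ge n 0 with hn | hn
  · obtain ⟨m, rfl⟩ := exists_neg_succ hn
    have e1 := opCT1_polyE_natCast h m
    have e2 := opCT1_opCT1 h (polyE a b c d q m)
    have e3 := coefG_add h m
    have e4 := coefD_mul h m
    have e5 : -(-((m : ℤ) + 1)) - 1 = m := by ring
    have e6 : -(m : ℤ) - 1 = -((m : ℤ) + 1) := by ring
    have e7 := coefD_ne_zero h m
    rw [e6] at e1
    rw [e5]
    rw [e1, map_add, map_smul, map_smul, e1] at e2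
    generalize coefG a b c d q (nuSeq a b c d q (-((m : ℤ) + 1))) = γ' at *
    generalize coefD a b c d q (nuSeq a b c d q (-((m : ℤ) + 1))) = δ' at *
    generalize coefG a b c d q (nuSeq a b c d q m) = γ at *
    generalize coefD a b c d q (nuSeq a b c d q m) = δ at *
    rw [← smul_right_inj e7]
    -- Now `e2` expresses `δ Ť₁ E_{-m-1}` by `E_m` and `E_{-m-1}`.
    rw [← eq_sub_iff_add_eq'] at e2
    rw [smul_add δ, smul_smul δ δ', e4, e2]
    rw [show -(a + b) / (a * b) = γ' + γ by rw [e3]; ring]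
    module
  · obtain ⟨m, rfl⟩ := Int.eq_ofNat_of_zero_le hn
    exact opCT1_polyE_natCast h m

/-! ### The coefficients of `M` -/

/-- Needed because two coefficients of `M` come from `Ť₁ E_{-n}` but are written in `ν(n)`. At `n =
0` the relation would say `abcd = q`, so it fails there. -/
theorem nuSeq_mul_neg (h : Admissible a b c d q) {n : ℤ} (hn : n ≠ 0) :
    nuSeq a b c d q (-n) = q / (a * b * c * d * nuSeq a b c d q n) := by
  have h0 := h.q0
  have hX := h.abcd0
  rcases lt_or_ge n 0 with hn' | hn'
  · obtain ⟨m, rfl⟩ := exists_neg_succ hn'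
    rw [nuSeq_neg_succ, neg_neg]
    have := nuSeq_natCast (a := a) (b := b) (c := c) (d := d) h0 (m + 1)
    push_cast at this
    rw [this, mul_comm]
  · obtain ⟨m, rfl⟩ : ∃ m : ℕ, n = (m + 1 : ℕ) := ⟨(n - 1).toNat, by omega⟩
    rw [nuSeq_natCast h0]
    push_cast
    rw [nuSeq_neg_succ]
    have hQ := pow_ne_zero (m + 1) h0
    generalize a * b * c * d = X at *
    generalize q ^ (m + 1) = Q at *
    field_simp

theorem sub_nuSeq_sq (h : Admissible a b c d q) (n : ℤ) :
    q - a * b * c * d * nuSeq a b c d q n ^ 2 ≠ 0 ∧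
    q ^ 2 - a * b * c * d * nuSeq a b c d q n ^ 2 ≠ 0 := by
  have h0 := h.q0
  have hX := h.abcd0
  rcases lt_or_ge n 0 with hn' | hn'
  · obtain ⟨m, rfl⟩ := exists_neg_succ hn'
    rw [nuSeq_neg_succ]
    constructor
    · have := h.q_sub_sq (m + 1)
      rwa [mul_comm] at this
    · have := h.one_sub_sq m
      rw [show q ^ 2 - a * b * c * d * (q ^ (m + 1)) ^ 2 =
        q ^ 2 * (1 - (q ^ m) ^ 2 * (a * b * c * d)) by ring]
      exact mul_ne_zero (pow_ne_zero _ h0) this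
  · obtain ⟨m, rfl⟩ := Int.eq_ofNat_of_zero_le hn'
    have hQ := pow_ne_zero m h0
    have h1 := h.q_sub_sq m
    have h2 := h.one_sub_sq m
    rw [nuSeq_natCast h0]
    generalize a * b * c * d = X at *
    generalize q ^ m = Q at *
    constructor
    · rw [show q - X * (q / (Q * X)) ^ 2 = -(q / (Q ^ 2 * X)) * (q - Q ^ 2 * X) by
        field_simp; ring]
      exact mul_ne_zero (neg_ne_zero.mpr (div_ne_zero h0 (mul_ne_zero (pow_ne_zero _ hQ) hX))) h1
    · rw [show q ^ 2 - X * (q / (Q * X)) ^ 2 = -(q ^ 2 / (Q ^ 2 * X)) * (1 - Q ^ 2 * X) by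
        field_simp; ring]
      exact mul_ne_zero (neg_ne_zero.mpr
        (div_ne_zero (pow_ne_zero _ h0) (mul_ne_zero (pow_ne_zero _ hQ) hX))) h2

theorem coefU_eq (h : Admissible a b c d q) (n : ℤ) :
    coefU a b c d q n = (q - a * b * c * d * nuSeq a b c d q n) *
      (1 - a * b * nuSeq a b c d q n) / (q - a * b * c * d * nuSeq a b c d q n ^ 2) := by
  have h0 := h.q0
  have ha := h.a0
  have hb := h.b0
  have hc := h.c0
  have hd := h.d0
  rcases lt_or_ge n 0 with hn' | hn'
  · obtain ⟨m, rfl⟩ := exists_neg_succ hn'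
    rw [nuSeq_neg_succ, coefU_neg_succ h0]
    ring
  · obtain ⟨m, rfl⟩ := Int.eq_ofNat_of_zero_le hn'
    rw [nuSeq_natCast h0]
    cases m with
    | zero =>
      have hX := h.abcd0
      rw [Nat.cast_zero, coefU_zero]
      have : q - a * b * c * d * (q / (q ^ 0 * (a * b * c * d))) = 0 := by
        generalize a * b * c * d = X at *
        field_simp
        simp
      rw [this]; simp
    | succ m =>
      have := coefU_succ (a := a) (b := b) (c := c) (d := d) h0 m
      push_cast at this ⊢
      rw [this]
      have hQ := pow_ne_zero (m + 1) h0
      have h1 := h.q_sub_sq (m + 1)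
      generalize q ^ (m + 1) = Q at *
      rw [show q - a * b * c * d * (q / (Q * (a * b * c * d))) ^ 2 =
        -(q / (Q ^ 2 * (a * b * c * d))) * (q - Q ^ 2 * (a * b * c * d)) by
        field_simp; ring]
      generalize q - Q ^ 2 * (a * b * c * d) = D at *
      field_simp
      ring

theorem neg_sub_coefU (h : Admissible a b c d q) (n : ℤ) :
    -(a * b) - coefU a b c d q n =
      -(q * (1 + a * b - a * b * (q⁻¹ * c * d + 1) * nuSeq a b c d q n)) /
        (q - a * b * c * d * nuSeq a b c d q n ^ 2) := by
  have h0 := h.q0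
  have h1 := (sub_nuSeq_sq h n).1
  rw [coefU_eq h]
  generalize nuSeq a b c d q n = v at *
  generalize e : q - a * b * c * d * v ^ 2 = D at *
  field_simp
  rw [← e]
  ring

theorem bandOp_apply {X : Type*} [AddCommGroup X] [Module ℂ X] (k₁ k₂ k₃ k₄ : ℤ → ℂ) (g : ℤ → X)
    (n : ℤ) : bandOp X k₁ k₂ k₃ k₄ g n =
      k₁ n • g n + k₂ n • g (n - 1) + k₃ n • g (-n) + k₄ n • g (-n - 1) := rfl

/-- This lemma and the next ones factor the coefficients of `M` according to `Z⁻¹ = Ť₁ T₁`: one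
factor from `T₁ E_n`, one from `Ť₁ E_n` or `Ť₁ E_{-n}`. -/
theorem coefM1_eq (h : Admissible a b c d q) (n : ℤ) :
    coefM1 a b c d q (nuSeq a b c d q n) =
      (-(a * b) - coefU a b c d q n) * coefG a b c d q (nuSeq a b c d q n) := by
  have h0 := h.q0
  obtain ⟨h1, h2⟩ := sub_nuSeq_sq h n
  rw [neg_sub_coefU h, coefG, coefM1]
  generalize nuSeq a b c d q n = v at *
  rw [show q - q⁻¹ * a * b * c * d * v ^ 2 = q⁻¹ * (q ^ 2 - a * b * c * d * v ^ 2) by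
    field_simp, ← neg_sub (q ^ 2)]
  generalize q - a * b * c * d * v ^ 2 = D at *
  generalize q ^ 2 - a * b * c * d * v ^ 2 = D' at *
  field_simp

theorem coefM4_eq (h : Admissible a b c d q) (n : ℤ) :
    coefM4 a b c d q (nuSeq a b c d q n) =
      (-(a * b) - coefU a b c d q n) * coefD a b c d q (nuSeq a b c d q n) := by
  have h0 := h.q0
  have hb := h.b0
  obtain ⟨h1, h2⟩ := sub_nuSeq_sq h n
  rw [neg_sub_coefU h, coefD, coefM4]
  generalize nuSeq a b c d q n = v at *
  rw [show q - q⁻¹ * a * b * c * d * v ^ 2 = q⁻¹ * (q ^ 2 - a * b * c * d * v ^ 2) by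
    field_simp, ← neg_sub (q ^ 2)]
  generalize q - a * b * c * d * v ^ 2 = D at *
  generalize q ^ 2 - a * b * c * d * v ^ 2 = D' at *
  field_simp

/-- The second and third coefficients of `M` contain this factor, so they vanish at `n = 0`, in
agreement with `β(0) = 0`. -/
theorem coefM_zero (h : Admissible a b c d q) :
    1 - q⁻¹ * a * b * c * d * nuSeq a b c d q 0 = 0 := by
  have h0 := h.q0
  have ha := h.a0
  have hb := h.b0
  have hc := h.c0
  have hd := h.d0
  have := nuSeq_natCast (a := a) (b := b) (c := c) (d := d) h0 0
  simp only [Nat.cast_zero, pow_zero] at this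
  rw [this]
  field_simp
  simp

theorem one_sub_nuSeq_sq (h : Admissible a b c d q) {n : ℤ} (hn : n ≠ 0) :
    1 - a * b * c * d * nuSeq a b c d q n ^ 2 ≠ 0 := by
  have h0 := h.q0
  have hX := h.abcd0
  have h1 := (sub_nuSeq_sq h (-n)).2
  have hv := nuSeq_ne_zero h n
  rw [nuSeq_mul_neg h hn] at h1
  intro e
  apply h1
  generalize a * b * c * d = X at *
  generalize nuSeq a b c d q n = v at *
  field_simp
  linear_combination (-q ^ 2) * e

theorem coefM3_eq (h : Admissible a b c d q) (n : ℤ) :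
    coefM3 a b c d q (nuSeq a b c d q n) =
      coefU a b c d q n * coefG a b c d q (nuSeq a b c d q (-n)) := by
  by_cases hn : n = 0
  · subst hn
    rw [coefM3, coefM_zero h, coefU_zero]; simp
  have h0 := h.q0
  have ha := h.a0
  have hb := h.b0
  have hc := h.c0
  have hd := h.d0
  obtain ⟨h1, -⟩ := sub_nuSeq_sq h n
  have h3 := one_sub_nuSeq_sq h hn
  have hv := nuSeq_ne_zero h n
  rw [coefU_eq h, nuSeq_mul_neg h hn, coefG, coefM3]
  generalize nuSeq a b c d q n = v at *
  rw [show 1 - q⁻¹ * a * b * c * d * v ^ 2 = q⁻¹ * (q - a * b * c * d * v ^ 2) by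
    field_simp, show a * b * c * d * (q / (a * b * c * d * v)) ^ 2 - q ^ 2 =
      q ^ 2 * (1 - a * b * c * d * v ^ 2) / (a * b * c * d * v ^ 2) by
    field_simp]
  generalize q - a * b * c * d * v ^ 2 = D at *
  generalize 1 - a * b * c * d * v ^ 2 = D' at *
  field_simp

theorem coefM2_eq (h : Admissible a b c d q) (n : ℤ) :
    coefM2 a b c d q (nuSeq a b c d q n) =
      coefU a b c d q n * coefD a b c d q (nuSeq a b c d q (-n)) := by
  by_cases hn : n = 0
  · subst hn
    rw [coefM2, coefM_zero h, coefU_zero]; simp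
  have h0 := h.q0
  have ha := h.a0
  have hb := h.b0
  have hc := h.c0
  have hd := h.d0
  obtain ⟨h1, -⟩ := sub_nuSeq_sq h n
  have h3 := one_sub_nuSeq_sq h hn
  have hv := nuSeq_ne_zero h n
  rw [coefU_eq h, nuSeq_mul_neg h hn, coefD, coefM2]
  generalize nuSeq a b c d q n = v at *
  rw [show 1 - q⁻¹ * a * b * c * d * v ^ 2 = q⁻¹ * (q - a * b * c * d * v ^ 2) by
    field_simp, show a * b * c * d * (q / (a * b * c * d * v)) ^ 2 - q ^ 2 =
      q ^ 2 * (1 - a * b * c * d * v ^ 2) / (a * b * c * d * v ^ 2) by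
    field_simp]
  generalize q - a * b * c * d * v ^ 2 = D at *
  generalize 1 - a * b * c * d * v ^ 2 = D' at *
  field_simp
  ring

theorem opZInv_polyE (h : Admissible a b c d q) (n : ℤ) :
    opZInv (polyE a b c d q n) = opM ℂ[T;T⁻¹] a b c d q (polyE a b c d q) n := by
  have e : opZInv (polyE a b c d q n) = opCT1 a b (opT1 a b (polyE a b c d q n)) := by
    rw [opCT1_apply, opT1Inv_opT1 h.a0 h.b0 h.ab_ne_one]
  rw [e, opT1_polyE h, map_add, map_smul, map_smul, opCT1_polyE h, opCT1_polyE h]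
  rw [opM, bandOp_apply, coefM1_eq h, coefM2_eq h, coefM3_eq h, coefM4_eq h, neg_neg]
  module

theorem opT1_polyE' (h : Admissible a b c d q) (n : ℤ) :
    opT1 a b (polyE a b c d q n) = opU ℂ[T;T⁻¹] a b c d q (polyE a b c d q) n := by
  rw [opT1_polyE h, opU, bandOp_apply]
  simp

theorem opY_polyE' (h : Admissible a b c d q) (n : ℤ) :
    opY a b c d q (polyE a b c d q n) = opN ℂ[T;T⁻¹] a b c d q (polyE a b c d q) n := by
  rw [opY_polyE h, opN, bandOp_apply]
  simp

/-! ### The basis of non-symmetric Askey-Wilson polynomials -/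

/-- At `z = a⁻¹` the factor `1 - az` kills everything except the term `k = 0` of `R_n`. In
particular `E_n ≠ 0`. -/
theorem evalAt_polyE (h : Admissible a b c d q) (n : ℤ) : evalAt (polyE a b c d q n) a⁻¹ = 1 := by
  have hz := inv_ne_zero h.a0
  have ha := h.a0
  have h1 : evalAt (qAux a b) a⁻¹ = 0 := by
    simp only [qAux, evalAt_mul _ _ hz, evalAt_sub _ _ hz, evalAt_one hz, evalAt_C _ hz,
      evalAt_T _ hz]
    simp [ha]
  have h2 : ∀ k, evalAt (awFactor a q (k + 1)) a⁻¹ = 0 := by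
    intro k
    rw [awFactor, prod_range_succ', evalAt_mul _ _ hz, evalAt_mul _ _ hz, evalAt_sub _ _ hz,
      evalAt_mul _ _ hz, evalAt_C _ hz, evalAt_T _ hz, evalAt_one hz]
    simp [ha]
  have h3 : evalAt (awFactor a q 0) a⁻¹ = 1 := by
    simp [awFactor, evalAt_one hz]
  rw [polyE, comb, one_smul, evalAt_add _ _ hz, evalAt_smul _ _ hz, awR_eq, evalAt_sum _ _ hz,
    evalAt_sum _ _ hz, sum_range_succ']
  simp [evalAt_smul _ _ hz, evalAt_mul _ _ hz, h1, h2, h3, awCoef_zero]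

theorem Admissible.pow_injective (h : Admissible a b c d q) :
    Function.Injective fun n : ℕ => q ^ n := by
  have key : ∀ m n : ℕ, m < n → q ^ m ≠ q ^ n := by
    intro m n hmn e
    obtain ⟨k, rfl⟩ := Nat.exists_eq_add_of_lt hmn
    refine h.qq k (mul_left_cancel₀ (pow_ne_zero m h.q0) ?_)
    rw [mul_zero, mul_sub, mul_one, ← pow_add, ← add_assoc, ← e, sub_self]
  intro m n e
  by_contra hne
  rcases Nat.lt_or_gt_of_ne hne with h1 | h1
  · exact key _ _ h1 e
  · exact key _ _ h1 e.symm

/-- Within each sign the values are distinct because powers of `q` are. A coincidence between the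
two signs would give `abcd q^k = 1` for some `k ≥ 0`. -/
theorem nuSeq_injective (h : Admissible a b c d q) : Function.Injective (nuSeq a b c d q) := by
  have h0 := h.q0
  have hX := h.abcd0
  have mixed : ∀ m n : ℕ, nuSeq a b c d q m ≠ nuSeq a b c d q (-((n : ℤ) + 1)) := by
    intro m n e
    rw [nuSeq_natCast h0, nuSeq_neg_succ, div_eq_iff (mul_ne_zero (pow_ne_zero m h0) hX)] at e
    refine h.abcd (n + m) (mul_left_cancel₀ h0 ?_)
    rw [mul_zero, mul_sub, mul_one]
    rw [show q * (a * b * c * d * q ^ (n + m)) = q ^ (n + 1) * (q ^ m * (a * b * c * d)) by ring,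
      ← e, sub_self]
  intro m n e
  rcases lt_or_ge m 0 with hm | hm <;> rcases lt_or_ge n 0 with hn | hn
  · obtain ⟨m, rfl⟩ := exists_neg_succ hm
    obtain ⟨n, rfl⟩ := exists_neg_succ hn
    rw [nuSeq_neg_succ, nuSeq_neg_succ] at e
    have := h.pow_injective e
    omega
  · obtain ⟨m, rfl⟩ := exists_neg_succ hm
    obtain ⟨n, rfl⟩ := Int.eq_ofNat_of_zero_le hn
    exact (mixed n m e.symm).elim
  · obtain ⟨m, rfl⟩ := Int.eq_ofNat_of_zero_le hm
    obtain ⟨n, rfl⟩ := exists_neg_succ hn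
    exact (mixed m n e).elim
  · obtain ⟨m, rfl⟩ := Int.eq_ofNat_of_zero_le hm
    obtain ⟨n, rfl⟩ := Int.eq_ofNat_of_zero_le hn
    rw [nuSeq_natCast h0, nuSeq_natCast h0, div_eq_div_iff (mul_ne_zero (pow_ne_zero _ h0) hX)
      (mul_ne_zero (pow_ne_zero _ h0) hX), mul_right_inj' h0, mul_left_inj' hX] at e
    rw [h.pow_injective e]

theorem linearIndependent_polyE (h : Admissible a b c d q) :
    LinearIndependent ℂ (polyE a b c d q) := by
  refine Module.End.eigenvectors_linearIndependent' (opY a b c d q)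
    (fun n => (nuSeq a b c d q n)⁻¹) (inv_injective.comp (nuSeq_injective h)) _ fun n => ?_
  refine ⟨Module.End.mem_eigenspace_iff.mpr (opY_polyE h n), fun e => ?_⟩
  have := evalAt_polyE h n
  rw [e] at this
  simp [evalAt] at this

/-- The span is stable under `T₁` and `Ť₁`, which generate `Z` and `Z⁻¹` with the help of their
quadratic relations, and it contains `E_0 = 1`, hence every power of `z`. -/
theorem span_polyE (h : Admissible a b c d q) :
    Submodule.span ℂ (Set.range (polyE a b c d q)) = ⊤ := by
  set S := Submodule.span ℂ (Set.range (polyE a b c d q)) with hS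
  have hmem : ∀ n, polyE a b c d q n ∈ S := fun n => Submodule.subset_span ⟨n, rfl⟩
  have inv : ∀ A : ℂ[T;T⁻¹] →ₗ[ℂ] ℂ[T;T⁻¹], (∀ n, A (polyE a b c d q n) ∈ S) →
      ∀ f ∈ S, A f ∈ S := by
    intro A hA
    have : S ≤ S.comap A := Submodule.span_le.mpr (by rintro _ ⟨n, rfl⟩; exact hA n)
    exact fun f hf => this hf
  have hT1 := inv (opT1 a b) fun n => by
    rw [opT1_polyE h]
    exact add_mem (S.smul_mem _ (hmem _)) (S.smul_mem _ (hmem _))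
  have hCT1 := inv (opCT1 a b) fun n => by
    rw [opCT1_polyE h]
    exact add_mem (S.smul_mem _ (hmem _)) (S.smul_mem _ (hmem _))
  have hT1I : ∀ f ∈ S, opT1Inv a b f ∈ S := fun f hf => by
    rw [opT1Inv_apply]
    exact sub_mem (S.smul_mem _ (hT1 f hf)) (S.smul_mem _ hf)
  have hZI : ∀ f ∈ S, opZInv f ∈ S := fun f hf => by
    have := hCT1 _ (hT1 f hf)
    rwa [opCT1_apply, opT1Inv_opT1 h.a0 h.b0 h.ab_ne_one] at this
  have hZ : ∀ f ∈ S, opZ f ∈ S := fun f hf => by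
    -- `Z = T₁⁻¹ Ť₁⁻¹`, where `Ť₁⁻¹ = -ab Ť₁ - (a + b)`.
    have e : opZ f = opT1Inv a b (-(a * b) • opCT1 a b f - (a + b) • f) := by
      have h0 := mul_ne_zero h.a0 h.b0
      have e1 : opCT1 a b (-(a * b) • opCT1 a b f - (a + b) • f) = f := by
        rw [map_sub, map_smul, map_smul, opCT1_opCT1 h]
        have h1 := h.a0
        have h2 := h.b0
        match_scalars
        · field_simp
          ring
        · field_simp
      rw [opCT1_apply] at e1
      conv_lhs => rw [← e1]
      rw [opZ_opZInv]
    rw [e]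
    exact hT1I _ (sub_mem (S.smul_mem _ (hCT1 f hf)) (S.smul_mem _ hf))
  have hT : ∀ n : ℤ, (T n : ℂ[T;T⁻¹]) ∈ S := by
    intro n
    induction n using Int.induction_on with
    | zero =>
      have := hmem 0
      rwa [polyE_zero] at this
    | succ n ih =>
      have := hZ _ ih
      rwa [opZ_apply, ← T_add, add_comm] at this
    | pred n ih =>
      have := hZI _ ih
      rwa [opZInv_apply, ← T_add, neg_add_eq_sub] at this
  rw [eq_top_iff]
  rintro f -
  induction f using LaurentPolynomial.induction_on' with
  | add p r hp hr => exact add_mem hp hr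
  | C_mul_T n r => rw [← smul_eq]; exact S.smul_mem _ (hT n)

/-- The basis of non-symmetric Askey-Wilson polynomials. -/
def basisE (h : Admissible a b c d q) : Module.Basis ℤ ℂ ℂ[T;T⁻¹] :=
  Module.Basis.mk (linearIndependent_polyE h) (span_polyE h).ge

theorem basisE_apply (h : Admissible a b c d q) (n : ℤ) : basisE h n = polyE a b c d q n :=
  Module.Basis.mk_apply _ _ n

end

section
/-! ### Relations in the DAHA -/

section Quadratic

variable {A : Type*} [Ring A] [Algebra ℂ A] {x : A} {s t : ℂ}

theorem mul_neg_inv_smul_add (h : x * x = -s • x - t • (1 : A)) (ht : t ≠ 0) :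
    x * (-t⁻¹ • (x + s • (1 : A))) = 1 := by
  rw [mul_smul_comm, mul_add, h, mul_smul_comm, mul_one]
  match_scalars <;> field_simp
  ring

theorem neg_inv_smul_add_mul (h : x * x = -s • x - t • (1 : A)) (ht : t ≠ 0) :
    (-t⁻¹ • (x + s • (1 : A))) * x = 1 := by
  rw [smul_mul_assoc, add_mul, h, smul_mul_assoc, one_mul]
  match_scalars <;> field_simp
  ring

theorem mul_self_of_smul_add_mul {r r' k : ℂ} (hr : r * r' ≠ 0)
    (h : (r • x + algebraMap ℂ A k) * (r' • x + algebraMap ℂ A k) = 0) :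
    x * x = -(k * (r + r') / (r * r')) • x - (k ^ 2 / (r * r')) • (1 : A) := by
  have e : (r • x + algebraMap ℂ A k) * (r' • x + algebraMap ℂ A k) =
      (r * r') • (x * x) + (k * (r + r')) • x + (k ^ 2) • (1 : A) := by
    simp only [Algebra.algebraMap_eq_smul_one, add_mul, mul_add, smul_mul_assoc, mul_smul_comm,
      one_mul, mul_one]
    module
  rw [e] at h
  have h' := congrArg (fun u => (r * r')⁻¹ • u) h
  simp only [smul_add, smul_zero, smul_smul, inv_mul_cancel₀ hr, one_smul] at h'
  rw [add_assoc] at h'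
  rw [eq_neg_of_add_eq_zero_left h']
  module

end Quadratic

namespace Daha

variable (a b c d q : ℂ)

/-- The element `T₀`. -/
def T0 : Daha a b c d q := gen a b c d q Gen.t0

/-- The element `Ť₁`. -/
def CT1 : Daha a b c d q := gen a b c d q Gen.ct1

/-- The element `Ť₀`. -/
def CT0 : Daha a b c d q := gen a b c d q Gen.ct0

/-- The element `T₀⁻¹`. -/
def T0Inv : Daha a b c d q := -(c * d / q)⁻¹ • (T0 a b c d q + (1 + c * d / q) • 1)

/-- The element `Ť₁⁻¹`. -/
def CT1Inv : Daha a b c d q := -(a * b) • CT1 a b c d q - (a + b) • 1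

/-- The element `Y⁻¹`. -/
def YInv : Daha a b c d q := T0Inv a b c d q * T1Inv a b c d q

variable {a b c d q}

theorem algHom_ext {B : Type*} [Ring B] [Algebra ℂ B] {f g : Daha a b c d q →ₐ[ℂ] B}
    (h1 : f (T1 a b c d q) = g (T1 a b c d q)) (h2 : f (T0 a b c d q) = g (T0 a b c d q))
    (h3 : f (CT1 a b c d q) = g (CT1 a b c d q)) (h4 : f (CT0 a b c d q) = g (CT0 a b c d q)) :
    f = g := by
  apply RingQuot.ringQuot_ext'
  apply FreeAlgebra.hom_ext
  funext x
  cases x with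
  | t1 => exact h1
  | t0 => exact h2
  | ct1 => exact h3
  | ct0 => exact h4

theorem T1_mul_T1 : T1 a b c d q * T1 a b c d q = -(1 + a * b) • T1 a b c d q - (a * b) • 1 := by
  have h := RingQuot.mkAlgHom_rel ℂ (DahaRel.t1 (a := a) (b := b) (c := c) (d := d) (q := q))
  simp only [map_mul, map_add, map_one, map_zero, AlgHom.commutes] at h
  have h' := mul_self_of_smul_add_mul (x := T1 a b c d q) (r := 1) (r' := 1) (k := 1)
  change (T1 a b c d q + _) * (T1 a b c d q + 1) = 0 at h
  simp only [Algebra.algebraMap_eq_smul_one, add_mul, mul_add, mul_one, smul_mul_assoc,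
    one_mul] at h
  rw [← sub_eq_zero, ← h]
  module

variable (h : Admissible a b c d q)

include h

theorem T1_mul_T1Inv : T1 a b c d q * T1Inv a b c d q = 1 := by
  have h0 := mul_ne_zero h.a0 h.b0
  have ha := h.a0
  have hb := h.b0
  have hc := h.c0
  have hd := h.d0
  have hq := h.q0
  rw [T1Inv, mul_sub, mul_smul_comm, T1_mul_T1, Algebra.algebraMap_eq_smul_one, mul_smul_comm,
    mul_one]
  match_scalars <;> field_simp
  ring

theorem T1Inv_mul_T1 : T1Inv a b c d q * T1 a b c d q = 1 := by
  have h0 := mul_ne_zero h.a0 h.b0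
  have ha := h.a0
  have hb := h.b0
  have hc := h.c0
  have hd := h.d0
  have hq := h.q0
  rw [T1Inv, sub_mul, smul_mul_assoc, T1_mul_T1, Algebra.algebraMap_eq_smul_one, smul_mul_assoc,
    one_mul]
  match_scalars <;> field_simp
  ring

omit h in
theorem T0_mul_T0 : T0 a b c d q * T0 a b c d q =
    -(1 + c * d / q) • T0 a b c d q - (c * d / q) • 1 := by
  have h := RingQuot.mkAlgHom_rel ℂ (DahaRel.t0 (a := a) (b := b) (c := c) (d := d) (q := q))
  simp only [map_mul, map_add, map_one, map_zero, AlgHom.commutes] at h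
  rw [← map_mul, ← map_mul] at h
  change (T0 a b c d q + _) * (T0 a b c d q + 1) = 0 at h
  simp only [Algebra.algebraMap_eq_smul_one, add_mul, mul_add, mul_one, smul_mul_assoc,
    one_mul] at h
  rw [← sub_eq_zero, ← h]
  match_scalars <;> ring

theorem T0_mul_T0Inv : T0 a b c d q * T0Inv a b c d q = 1 :=
  mul_neg_inv_smul_add T0_mul_T0 (div_ne_zero (mul_ne_zero h.c0 h.d0) h.q0)

theorem T0Inv_mul_T0 : T0Inv a b c d q * T0 a b c d q = 1 :=
  neg_inv_smul_add_mul T0_mul_T0 (div_ne_zero (mul_ne_zero h.c0 h.d0) h.q0)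

theorem CT1_mul_CT1 : CT1 a b c d q * CT1 a b c d q =
    -((a + b) / (a * b)) • CT1 a b c d q - (1 / (a * b)) • 1 := by
  have e := RingQuot.mkAlgHom_rel ℂ (DahaRel.ct1 (a := a) (b := b) (c := c) (d := d) (q := q))
  simp only [map_mul, map_add, map_one, map_zero, map_smul] at e
  have := mul_self_of_smul_add_mul (x := CT1 a b c d q) (k := 1) (mul_ne_zero h.a0 h.b0) (by
    rw [map_one]; exact e)
  rwa [one_mul, one_pow] at this

theorem CT1Inv_eq : CT1Inv a b c d q =
    -(1 / (a * b))⁻¹ • (CT1 a b c d q + ((a + b) / (a * b)) • (1 : Daha a b c d q)) := by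
  have h0 := mul_ne_zero h.a0 h.b0
  have ha := h.a0
  have hb := h.b0
  have hc := h.c0
  have hd := h.d0
  have hq := h.q0
  rw [CT1Inv]
  match_scalars <;> field_simp

theorem CT1_mul_CT1Inv : CT1 a b c d q * CT1Inv a b c d q = 1 := by
  rw [CT1Inv_eq h]
  exact mul_neg_inv_smul_add (CT1_mul_CT1 h) (one_div_ne_zero (mul_ne_zero h.a0 h.b0))

theorem CT1Inv_mul_CT1 : CT1Inv a b c d q * CT1 a b c d q = 1 := by
  rw [CT1Inv_eq h]
  exact neg_inv_smul_add_mul (CT1_mul_CT1 h) (one_div_ne_zero (mul_ne_zero h.a0 h.b0))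

omit h in
theorem Y_eq : Y a b c d q = T1 a b c d q * T0 a b c d q := rfl

theorem Y_mul_YInv : Y a b c d q * YInv a b c d q = 1 := by
  rw [Y_eq, YInv, mul_assoc, ← mul_assoc (T0 a b c d q), T0_mul_T0Inv h, one_mul, T1_mul_T1Inv h]

theorem YInv_mul_Y : YInv a b c d q * Y a b c d q = 1 := by
  rw [Y_eq, YInv, mul_assoc, ← mul_assoc (T1Inv a b c d q), T1Inv_mul_T1 h, one_mul,
    T0Inv_mul_T0 h]

omit h in
theorem CT1_mul_Y_mul_CT0 : CT1 a b c d q * Y a b c d q * CT0 a b c d q = 1 := by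
  have e := RingQuot.mkAlgHom_rel ℂ (DahaRel.prod (a := a) (b := b) (c := c) (d := d) (q := q))
  simp only [map_mul, map_one] at e
  change CT1 a b c d q * T1 a b c d q * T0 a b c d q * CT0 a b c d q = 1 at e
  rwa [mul_assoc (CT1 a b c d q)] at e

theorem CT0_eq : CT0 a b c d q = YInv a b c d q * CT1Inv a b c d q := by
  have e := congrArg (fun u => YInv a b c d q * CT1Inv a b c d q * u)
    (CT1_mul_Y_mul_CT0 (a := a) (b := b) (c := c) (d := d) (q := q))
  simp only [mul_one] at e
  rw [← e]
  simp only [mul_assoc]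
  rw [← mul_assoc (CT1Inv a b c d q), CT1Inv_mul_CT1 h, one_mul, ← mul_assoc (YInv a b c d q),
    YInv_mul_Y h, one_mul]

theorem CT0_mul_CT0 : CT0 a b c d q * CT0 a b c d q =
    -(q * (c + d) / (c * d)) • CT0 a b c d q - (q ^ 2 / (c * d)) • 1 := by
  have e := RingQuot.mkAlgHom_rel ℂ (DahaRel.ct0 (a := a) (b := b) (c := c) (d := d) (q := q))
  simp only [map_mul, map_add, map_zero, map_smul, AlgHom.commutes] at e
  exact mul_self_of_smul_add_mul (x := CT0 a b c d q) (mul_ne_zero h.c0 h.d0) e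

theorem T0_eq : T0 a b c d q = T1Inv a b c d q * Y a b c d q := by
  rw [Y_eq, ← mul_assoc, T1Inv_mul_T1 h, one_mul]

theorem T0Inv_eq : T0Inv a b c d q = YInv a b c d q * T1 a b c d q := by
  rw [YInv, mul_assoc, T1Inv_mul_T1 h, mul_one]

theorem CT1_eq : CT1 a b c d q = ZInv a b c d q * T1Inv a b c d q := by
  rw [ZInv, mul_assoc, T1_mul_T1Inv h, mul_one]; rfl

/-- Moving `T₁` to the right of `Y`. -/
theorem T1_mul_Y : T1 a b c d q * Y a b c d q =
    (a * b * (c * d / q)) • (YInv a b c d q * T1 a b c d q) +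
      (a * b * (1 + c * d / q)) • 1 - (1 + a * b) • Y a b c d q := by
  have h0 := mul_ne_zero h.a0 h.b0
  have ha := h.a0
  have hb := h.b0
  have hc := h.c0
  have hd := h.d0
  have hq := h.q0
  have h1 := div_ne_zero (mul_ne_zero h.c0 h.d0) h.q0
  -- Two expressions for `T₀⁻¹`: it is `Y⁻¹ T₁`, and by the quadratic relation it is affine in `T₀ =
  -- T₁⁻¹ Y`, with `T₁⁻¹` affine in `T₁`.
  have e := T0Inv_eq h
  rw [T0Inv, T0_eq h, T1Inv, Algebra.algebraMap_eq_smul_one, sub_mul, smul_mul_assoc,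
    smul_mul_assoc, one_mul] at e
  rw [← e]
  generalize c * d / q = t at *
  match_scalars <;> field_simp <;> ring

/-- The relation `T1_mul_Y`, multiplied by `Y` on the left and `Y⁻¹` on the right. -/
theorem T1_mul_YInv : T1 a b c d q * YInv a b c d q =
    (a * b * (c * d / q))⁻¹ • (Y a b c d q * T1 a b c d q -
      (a * b * (1 + c * d / q)) • 1 + (1 + a * b) • Y a b c d q) := by
  have h0 := mul_ne_zero h.a0 h.b0
  have ha := h.a0
  have hb := h.b0
  have hc := h.c0
  have hd := h.d0
  have hq := h.q0
  have h1 := div_ne_zero (mul_ne_zero h.c0 h.d0) h.q0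
  have e := congrArg (fun u => Y a b c d q * u * YInv a b c d q) (T1_mul_Y h)
  simp only [mul_sub, mul_add, sub_mul, add_mul, mul_smul_comm, smul_mul_assoc, mul_one] at e
  rw [mul_assoc (Y a b c d q) (T1 a b c d q * Y a b c d q), mul_assoc (T1 a b c d q),
    Y_mul_YInv h, mul_one, ← mul_assoc (Y a b c d q) (YInv a b c d q), Y_mul_YInv h, one_mul,
    mul_assoc (Y a b c d q) (Y a b c d q), Y_mul_YInv h, mul_one] at e
  rw [e, eq_inv_smul_iff₀ (mul_ne_zero h0 h1)]
  module

theorem CT0_mul_inv : CT0 a b c d q * (CT1 a b c d q * Y a b c d q) = 1 := by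
  rw [CT0_eq h, mul_assoc, ← mul_assoc (CT1Inv a b c d q), CT1Inv_mul_CT1 h, one_mul, YInv_mul_Y h]

/-- Moving `Ť₁` to the right of `Y`. -/
theorem CT1_mul_Y : CT1 a b c d q * Y a b c d q =
    (q ^ 2 / (c * d))⁻¹ • ((a * b) • (YInv a b c d q * CT1 a b c d q) +
      (a + b) • YInv a b c d q - (q * (c + d) / (c * d)) • 1) := by
  have h1 := div_ne_zero (pow_ne_zero 2 h.q0) (mul_ne_zero h.c0 h.d0)
  -- As for `T₁`: the inverse of `Ť₀` is `Ť₁ Y`, and it is also affine in `Ť₀ = Y⁻¹ Ť₁⁻¹`.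
  have e := neg_inv_smul_add_mul (CT0_mul_CT0 h) h1
  have e' := congrArg (fun u => u * (CT1 a b c d q * Y a b c d q)) e
  simp only [one_mul] at e'
  rw [mul_assoc, CT0_mul_inv h, mul_one, CT0_eq h, CT1Inv, mul_sub, mul_smul_comm, mul_smul_comm,
    mul_one] at e'
  rw [← e']
  module

theorem CT1_mul_YInv : CT1 a b c d q * YInv a b c d q =
    (a * b)⁻¹ • ((q ^ 2 / (c * d)) • (Y a b c d q * CT1 a b c d q) +
      (q * (c + d) / (c * d)) • 1 - (a + b) • YInv a b c d q) := by
  have h0 := mul_ne_zero h.a0 h.b0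
  have ha := h.a0
  have hb := h.b0
  have hc := h.c0
  have hd := h.d0
  have hq := h.q0
  have h1 := div_ne_zero (pow_ne_zero 2 h.q0) (mul_ne_zero h.c0 h.d0)
  have e := congrArg (fun u => Y a b c d q * u * YInv a b c d q) (CT1_mul_Y h)
  simp only [mul_sub, mul_add, sub_mul, add_mul, mul_smul_comm, smul_mul_assoc, mul_one] at e
  rw [mul_assoc (Y a b c d q) (CT1 a b c d q * Y a b c d q), mul_assoc (CT1 a b c d q),
    Y_mul_YInv h, mul_one, ← mul_assoc (Y a b c d q) (YInv a b c d q), Y_mul_YInv h, one_mul] at e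
  rw [e, eq_inv_smul_iff₀ h0, one_mul]
  match_scalars <;> field_simp <;> ring

end Daha

end

section
/-! ### A spanning set of the DAHA and faithfulness of the basic representation -/

theorem evalAt_toLaurent (p : Polynomial ℂ) {z : ℂ} (hz : z ≠ 0) :
    evalAt (Polynomial.toLaurent p) z = p.eval z := by
  induction p using Polynomial.induction_on' with
  | add p r hp hr => rw [map_add, evalAt_add _ _ hz, hp, hr, Polynomial.eval_add]
  | monomial n r =>
    rw [← Polynomial.C_mul_X_pow_eq_monomial, Polynomial.toLaurent_C_mul_X_pow, evalAt_mul _ _ hz,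
      evalAt_C _ hz, evalAt_T _ hz]
    simp

theorem eq_zero_of_evalAt_eq_zero {f : ℂ[T;T⁻¹]} {S : Set ℂ} (hS : S.Infinite)
    (h0 : ∀ z ∈ S, z ≠ 0) (hf : ∀ z ∈ S, evalAt f z = 0) : f = 0 := by
  obtain ⟨n, p, hp⟩ := exists_T_pow f
  have : p = 0 := by
    refine Polynomial.eq_zero_of_infinite_isRoot p (hS.mono fun z hz => ?_)
    rw [Set.mem_ofPred_eq, Polynomial.IsRoot, ← evalAt_toLaurent p (h0 z hz), hp,
      evalAt_mul _ _ (h0 z hz), hf z hz, zero_mul]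
  rw [this, map_zero] at hp
  exact (mul_eq_zero.mp hp.symm).resolve_right (isUnit_T _).ne_zero

variable {a b c d q : ℂ}

namespace Daha

/-- `Y` as a unit. -/
def unitY (h : Admissible a b c d q) : (Daha a b c d q)ˣ :=
  ⟨Y a b c d q, YInv a b c d q, Y_mul_YInv h, YInv_mul_Y h⟩

/-- Substitution of `Y` into Laurent polynomials. -/
def polyY (h : Admissible a b c d q) : ℂ[T;T⁻¹] →ₐ[ℂ] Daha a b c d q :=
  AddMonoidAlgebra.lift ℂ (Daha a b c d q) ℤ
    ((Units.coeHom (Daha a b c d q)).comp (zpowersHom _ (unitY h)))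

theorem polyY_T (h : Admissible a b c d q) (n : ℤ) :
    polyY h (T n) = ((unitY h ^ n : (Daha a b c d q)ˣ) : Daha a b c d q) := by
  rw [polyY, T, AddMonoidAlgebra.lift_single, one_smul]
  rfl

theorem polyY_T_one (h : Admissible a b c d q) : polyY h (T 1) = Y a b c d q := by
  rw [polyY_T, zpow_one]; rfl

theorem polyY_T_neg_one (h : Admissible a b c d q) : polyY h (T (-1)) = YInv a b c d q := by
  rw [polyY_T, zpow_neg_one]; rfl

theorem polyY_C (h : Admissible a b c d q) (r : ℂ) : polyY h (C r) = r • 1 := by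
  rw [← mul_one (C r), ← smul_eq, map_smul, map_one]

/-- The Laurent polynomials that `x` can be moved across in this way are closed under sums and
products, so `Y` and `Y⁻¹` suffice. -/
theorem exists_mul_polyY (h : Admissible a b c d q) {x : Daha a b c d q}
    (h1 : ∃ P Q, x * Y a b c d q = polyY h P * x + polyY h Q)
    (h2 : ∃ P Q, x * YInv a b c d q = polyY h P * x + polyY h Q) (f : ℂ[T;T⁻¹]) :
    ∃ P Q, x * polyY h f = polyY h P * x + polyY h Q := by
  have step : ∀ e g : ℂ[T;T⁻¹], (∃ P Q, x * polyY h e = polyY h P * x + polyY h Q) →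
      (∃ P Q, x * polyY h g = polyY h P * x + polyY h Q) →
      ∃ P Q, x * polyY h (e * g) = polyY h P * x + polyY h Q := by
    rintro e g ⟨P, Q, hPQ⟩ ⟨P', Q', hPQ'⟩
    refine ⟨P * P', P * Q' + Q * g, ?_⟩
    rw [map_mul, ← mul_assoc, hPQ, add_mul, mul_assoc, hPQ', map_add, map_mul, map_mul, map_mul]
    noncomm_ring
  rw [← polyY_T_one h] at h1
  rw [← polyY_T_neg_one h] at h2
  induction f using LaurentPolynomial.induction_on' with
  | add f g hf hg =>
    obtain ⟨P, Q, hPQ⟩ := hf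
    obtain ⟨P', Q', hPQ'⟩ := hg
    refine ⟨P + P', Q + Q', ?_⟩
    rw [map_add, mul_add, hPQ, hPQ', map_add, map_add]
    noncomm_ring
  | C_mul_T n r =>
    refine step _ _ ⟨C r, 0, ?_⟩ ?_
    · rw [map_zero, add_zero, polyY_C, smul_mul_assoc, mul_smul_comm, one_mul, mul_one]
    · induction n using Int.induction_on with
      | zero => exact ⟨1, 0, by rw [T_zero]; simp⟩
      | succ n ih => rw [T_add]; exact step _ _ ih h1
      | pred n ih => rw [sub_eq_add_neg, T_add]; exact step _ _ ih h2

variable (a b c d q) in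
/-- The letters `T₁` and `Ť₁`. -/
def letter (s : Bool) : Daha a b c d q := if s then T1 a b c d q else CT1 a b c d q

variable (a b c d q) in
/-- The alternating words in `T₁` and `Ť₁`, given by their first letter and their length. -/
def word : Bool → ℕ → Daha a b c d q
  | _, 0 => 1
  | s, m + 1 => letter a b c d q s * word (!s) m

theorem exists_letter_mul_letter (h : Admissible a b c d q) (s : Bool) :
    ∃ x y : ℂ, letter a b c d q s * letter a b c d q s = x • letter a b c d q s + y • 1 := by
  cases s with
  | true =>
    refine ⟨-(1 + a * b), -(a * b), ?_⟩
    simp only [letter, if_true]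
    rw [T1_mul_T1]; module
  | false =>
    refine ⟨-((a + b) / (a * b)), -(1 / (a * b)), ?_⟩
    simp only [letter, Bool.false_eq_true, if_false]
    rw [CT1_mul_CT1 h]; module

theorem exists_letter_mul_polyY (h : Admissible a b c d q) (s : Bool) (f : ℂ[T;T⁻¹]) :
    ∃ P Q, letter a b c d q s * polyY h f = polyY h P * letter a b c d q s + polyY h Q := by
  cases s with
  | true =>
    refine exists_mul_polyY h ⟨C (a * b * (c * d / q)) * T (-1),
        C (a * b * (1 + c * d / q)) - C (1 + a * b) * T 1, ?_⟩
      ⟨C (a * b * (c * d / q))⁻¹ * T 1, C (a * b * (c * d / q))⁻¹ *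
        (-C (a * b * (1 + c * d / q)) + C (1 + a * b) * T 1), ?_⟩ f
    · simp only [letter, if_true, map_mul (polyY h), map_sub, polyY_T_one, polyY_T_neg_one, polyY_C,
        smul_mul_assoc, one_mul, T1_mul_Y h]
      abel
    · simp only [letter, if_true, map_mul (polyY h), map_add (polyY h), map_neg (polyY h),
        polyY_T_one, polyY_C, smul_mul_assoc, one_mul, T1_mul_YInv h]
      module
  | false =>
    refine exists_mul_polyY h ⟨C ((q ^ 2 / (c * d))⁻¹ * (a * b)) * T (-1),
        C (q ^ 2 / (c * d))⁻¹ * (C (a + b) * T (-1) - C (q * (c + d) / (c * d))), ?_⟩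
      ⟨C ((a * b)⁻¹ * (q ^ 2 / (c * d))) * T 1, C (a * b)⁻¹ *
        (C (q * (c + d) / (c * d)) - C (a + b) * T (-1)), ?_⟩ f
    · simp only [letter, Bool.false_eq_true, if_false, map_mul (polyY h), map_sub (polyY h),
        polyY_T_neg_one, polyY_C, smul_mul_assoc, one_mul, CT1_mul_Y h]
      module
    · simp only [letter, Bool.false_eq_true, if_false, map_mul (polyY h), map_sub (polyY h),
        polyY_T_one, polyY_T_neg_one, polyY_C, smul_mul_assoc, one_mul, CT1_mul_YInv h]
      module

/-- The span of the products of a Laurent polynomial in `Y` with an alternating word of length at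
most `m`. -/
def filt (h : Admissible a b c d q) (m : ℕ) : Submodule ℂ (Daha a b c d q) :=
  Submodule.span ℂ {x | ∃ (f : ℂ[T;T⁻¹]) (s : Bool) (k : ℕ), k ≤ m ∧
    x = polyY h f * word a b c d q s k}

theorem polyY_mul_word_mem_filt (h : Admissible a b c d q) (f : ℂ[T;T⁻¹]) (s : Bool) {k m : ℕ}
    (hk : k ≤ m) : polyY h f * word a b c d q s k ∈ filt h m :=
  Submodule.subset_span ⟨f, s, k, hk, rfl⟩

theorem filt_mono (h : Admissible a b c d q) {m n : ℕ} (hmn : m ≤ n) : filt h m ≤ filt h n :=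
  Submodule.span_mono fun _ ⟨f, s, k, hk, e⟩ => ⟨f, s, k, hk.trans hmn, e⟩

theorem polyY_mul_mem_filt (h : Admissible a b c d q) (g : ℂ[T;T⁻¹]) {m : ℕ}
    {x : Daha a b c d q} (hx : x ∈ filt h m) : polyY h g * x ∈ filt h m := by
  induction hx using Submodule.span_induction with
  | mem x hx =>
    obtain ⟨f, s, k, hk, rfl⟩ := hx
    rw [← mul_assoc, ← map_mul]
    exact polyY_mul_word_mem_filt h _ s hk
  | zero => rw [mul_zero]; exact zero_mem _
  | add x y _ _ hx hy => rw [mul_add]; exact add_mem hx hy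
  | smul r x _ hx => rw [mul_smul_comm]; exact Submodule.smul_mem _ _ hx

theorem word_mem_filt (h : Admissible a b c d q) (s : Bool) {k m : ℕ} (hk : k ≤ m) :
    word a b c d q s k ∈ filt h m := by
  have := polyY_mul_word_mem_filt h 1 s hk
  rwa [map_one, one_mul] at this

theorem letter_mul_word_mem_filt (h : Admissible a b c d q) (s s' : Bool) (k : ℕ) :
    letter a b c d q s * word a b c d q s' k ∈ filt h (k + 1) := by
  -- A different first letter lengthens the alternating word; an equal one is absorbed by the
  -- quadratic relation.
  by_cases hs : s' = !s
  · subst hs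
    exact word_mem_filt h s (le_refl (k + 1))
  · have hs' : s' = s := by simpa using hs
    subst hs'
    cases k with
    | zero => exact word_mem_filt h s' (k := 1) le_rfl
    | succ k =>
      obtain ⟨x, y, e⟩ := exists_letter_mul_letter h s'
      rw [word, ← mul_assoc, e, add_mul, smul_mul_assoc, smul_mul_assoc, one_mul]
      exact add_mem (Submodule.smul_mem _ _ (word_mem_filt h s' (k := k + 1) (by omega)))
        (Submodule.smul_mem _ _ (word_mem_filt h _ (by omega)))

theorem letter_mul_mem_filt (h : Admissible a b c d q) (s : Bool) {m : ℕ} {x : Daha a b c d q}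
    (hx : x ∈ filt h m) : letter a b c d q s * x ∈ filt h (m + 1) := by
  induction hx using Submodule.span_induction with
  | mem x hx =>
    obtain ⟨f, s', k, hk, rfl⟩ := hx
    obtain ⟨P, Q, e⟩ := exists_letter_mul_polyY h s f
    rw [← mul_assoc, e, add_mul, mul_assoc]
    exact add_mem (polyY_mul_mem_filt h _ (filt_mono h (by omega)
      (letter_mul_word_mem_filt h s s' k))) (polyY_mul_word_mem_filt h _ _ (by omega))
  | zero => rw [mul_zero]; exact zero_mem _
  | add x y _ _ hx hy => rw [mul_add]; exact add_mem hx hy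
  | smul r x _ hx => rw [mul_smul_comm]; exact Submodule.smul_mem _ _ hx

/-- The union of the filtration is a left ideal: `T₀ = T₁⁻¹ Y` and `Ť₀ = Y⁻¹ Ť₁⁻¹` are expressed by
the letters and `Y`. As it contains `1`, it is the whole algebra. -/
theorem exists_mul_mem_filt (h : Admissible a b c d q) (u : FreeAlgebra ℂ Gen) :
    ∀ (m : ℕ) (x : Daha a b c d q), x ∈ filt h m →
      ∃ n, RingQuot.mkAlgHom ℂ (DahaRel a b c d q) u * x ∈ filt h n := by
  have hT : ∀ (m : ℕ) (x : Daha a b c d q), x ∈ filt h m → T1 a b c d q * x ∈ filt h (m + 1) :=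
    fun m x hx => letter_mul_mem_filt h true hx
  have hK : ∀ (m : ℕ) (x : Daha a b c d q), x ∈ filt h m → CT1 a b c d q * x ∈ filt h (m + 1) :=
    fun m x hx => letter_mul_mem_filt h false hx
  induction u using FreeAlgebra.induction with
  | grade0 r =>
    intro m x hx
    refine ⟨m, ?_⟩
    rw [AlgHom.commutes, ← Algebra.smul_def]
    exact Submodule.smul_mem _ _ hx
  | grade1 g =>
    intro m x hx
    refine ⟨m + 1, ?_⟩
    cases g with
    | t1 => exact hT m x hx
    | t0 =>
      change T0 a b c d q * x ∈ _
      rw [T0_eq h, mul_assoc, T1Inv, Algebra.algebraMap_eq_smul_one, sub_mul, smul_mul_assoc,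
        smul_mul_assoc, one_mul, ← polyY_T_one h]
      have := polyY_mul_mem_filt h (T 1) hx
      exact sub_mem (Submodule.smul_mem _ _ (hT m _ this))
        (Submodule.smul_mem _ _ (filt_mono h (by omega) this))
    | ct1 => exact hK m x hx
    | ct0 =>
      change CT0 a b c d q * x ∈ _
      rw [CT0_eq h, mul_assoc, ← polyY_T_neg_one h]
      apply polyY_mul_mem_filt
      rw [CT1Inv, sub_mul, smul_mul_assoc, smul_mul_assoc, one_mul]
      exact sub_mem (Submodule.smul_mem _ _ (hK m _ hx))
        (Submodule.smul_mem _ _ (filt_mono h (by omega) hx))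
  | mul u v hu hv =>
    intro m x hx
    obtain ⟨n, hn⟩ := hv m x hx
    obtain ⟨n', hn'⟩ := hu n _ hn
    exact ⟨n', by rwa [map_mul, mul_assoc]⟩
  | add u v hu hv =>
    intro m x hx
    obtain ⟨n, hn⟩ := hu m x hx
    obtain ⟨n', hn'⟩ := hv m x hx
    refine ⟨max n n', ?_⟩
    rw [map_add, add_mul]
    exact add_mem (filt_mono h (le_max_left _ _) hn) (filt_mono h (le_max_right _ _) hn')

theorem exists_mem_filt (h : Admissible a b c d q) (x : Daha a b c d q) : ∃ m, x ∈ filt h m := by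
  obtain ⟨u, rfl⟩ := RingQuot.mkAlgHom_surjective ℂ (DahaRel a b c d q) x
  obtain ⟨n, hn⟩ := exists_mul_mem_filt h u 0 1 (word_mem_filt h true (k := 0) le_rfl)
  exact ⟨n, by rwa [mul_one] at hn⟩

theorem eq_polyY_of_mem_filt_zero (h : Admissible a b c d q) {x : Daha a b c d q}
    (hx : x ∈ filt h 0) : ∃ f, x = polyY h f := by
  induction hx using Submodule.span_induction with
  | mem x hx =>
    obtain ⟨f, s, k, hk, rfl⟩ := hx
    obtain rfl : k = 0 := by omega
    exact ⟨f, by rw [word, mul_one]⟩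
  | zero => exact ⟨0, by rw [map_zero]⟩
  | add x y _ _ hx hy =>
    obtain ⟨f, rfl⟩ := hx
    obtain ⟨g, rfl⟩ := hy
    exact ⟨f + g, by rw [map_add]⟩
  | smul r x _ hx =>
    obtain ⟨f, rfl⟩ := hx
    exact ⟨r • f, by rw [map_smul]⟩

theorem exists_of_mem_filt_succ (h : Admissible a b c d q) {m : ℕ} {x : Daha a b c d q}
    (hx : x ∈ filt h (m + 1)) : ∃ y ∈ filt h m, ∃ f : Bool → ℂ[T;T⁻¹],
      x = y + polyY h (f true) * word a b c d q true (m + 1) +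
        polyY h (f false) * word a b c d q false (m + 1) := by
  induction hx using Submodule.span_induction with
  | mem x hx =>
    obtain ⟨f, s, k, hk, rfl⟩ := hx
    rcases Nat.lt_or_ge m k with hk' | hk'
    · obtain rfl : k = m + 1 := by omega
      refine ⟨0, zero_mem _, fun s' => if s' = s then f else 0, ?_⟩
      cases s <;> simp
    · exact ⟨_, polyY_mul_word_mem_filt h f s hk', 0, by simp⟩
  | zero => exact ⟨0, zero_mem _, 0, by simp⟩
  | add x y _ _ hx hy =>
    obtain ⟨x', hx', f, rfl⟩ := hx
    obtain ⟨y', hy', g, rfl⟩ := hy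
    refine ⟨_, add_mem hx' hy', f + g, ?_⟩
    simp only [Pi.add_apply, map_add, add_mul]
    abel
  | smul r x _ hx =>
    obtain ⟨x', hx', f, rfl⟩ := hx
    refine ⟨_, Submodule.smul_mem _ r hx', r • f, ?_⟩
    simp only [Pi.smul_apply, map_smul, smul_add, smul_mul_assoc]

end Daha

end

/-! ### Triangular action of the letters, and faithfulness of the basic representation -/

section
variable {a b c d q : ℂ}

theorem intEquivNat_symm_two_mul (n : ℕ) : Equiv.intEquivNat.symm (2 * n) = n := by
  rw [Equiv.symm_apply_eq]; rfl

theorem intEquivNat_symm_two_mul_add_one (n : ℕ) :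
    Equiv.intEquivNat.symm (2 * n + 1) = -((n : ℤ) + 1) := by
  rw [Equiv.symm_apply_eq, ← Int.negSucc_eq]; rfl

/-- The basis `E_0, E_{-1}, E_1, E_{-2}, …`. -/
def basisV (h : Admissible a b c d q) : Module.Basis ℕ ℂ ℂ[T;T⁻¹] :=
  (basisE h).reindex Equiv.intEquivNat

theorem basisV_apply (h : Admissible a b c d q) (p : ℕ) :
    basisV h p = polyE a b c d q (Equiv.intEquivNat.symm p) := by
  rw [basisV, Module.Basis.reindex_apply, basisE_apply]

theorem basisV_two_mul (h : Admissible a b c d q) (n : ℕ) :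
    basisV h (2 * n) = polyE a b c d q n := by
  rw [basisV_apply, intEquivNat_symm_two_mul]

theorem basisV_two_mul_add_one (h : Admissible a b c d q) (n : ℕ) :
    basisV h (2 * n + 1) = polyE a b c d q (-((n : ℤ) + 1)) := by
  rw [basisV_apply, intEquivNat_symm_two_mul_add_one]

/-- The span of the first `p` elements of `basisV`. -/
def initV (h : Admissible a b c d q) (p : ℕ) : Submodule ℂ ℂ[T;T⁻¹] :=
  Submodule.span ℂ (basisV h '' Set.Iio p)

theorem basisV_mem_initV (h : Admissible a b c d q) {j p : ℕ} (hj : j < p) :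
    basisV h j ∈ initV h p :=
  Submodule.subset_span ⟨j, hj, rfl⟩

theorem initV_mono (h : Admissible a b c d q) {p p' : ℕ} (hp : p ≤ p') : initV h p ≤ initV h p' :=
  Submodule.span_mono (Set.image_mono (Set.Iio_subset_Iio hp))

theorem repr_eq_zero_of_mem_initV (h : Admissible a b c d q) {p : ℕ} {f : ℂ[T;T⁻¹]}
    (hf : f ∈ initV h p) : (basisV h).repr f p = 0 := by
  induction hf using Submodule.span_induction with
  | mem x hx =>
    obtain ⟨j, hj, rfl⟩ := hx
    rw [Module.Basis.repr_self, Finsupp.single_eq_of_ne' (ne_of_lt hj)]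
  | zero => simp
  | add x y _ _ hx hy => simp [hx, hy]
  | smul r x _ hx => simp [hx]

theorem map_mem_initV (h : Admissible a b c d q) {A : Module.End ℂ ℂ[T;T⁻¹]} {p p' : ℕ}
    (hA : ∀ j < p, A (basisV h j) ∈ initV h p') {f : ℂ[T;T⁻¹]} (hf : f ∈ initV h p) :
    A f ∈ initV h p' := by
  have : initV h p ≤ (initV h p').comap A :=
    Submodule.span_le.mpr (by rintro _ ⟨j, hj, rfl⟩; exact hA j hj)
  exact this hf

theorem coefU_neg_succ_ne_zero (h : Admissible a b c d q) (n : ℕ) :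
    coefU a b c d q (-((n : ℤ) + 1)) ≠ 0 := by
  rw [coefU_neg_succ h.q0]
  refine div_ne_zero (mul_ne_zero ?_ (h.q_sub _)) (h.q_sub_sq _)
  rw [mul_comm]
  exact h.ab _

namespace Admissible

variable (h : Admissible a b c d q)

/-- The basic representation. -/
def rep : Daha a b c d q →ₐ[ℂ] Module.End ℂ ℂ[T;T⁻¹] :=
  basicRep h.a0 h.b0 h.c0 h.d0 h.q0 h.ab_ne_one

theorem rep_T1 : h.rep (Daha.T1 a b c d q) = opT1 a b := basicRep_gen ..
theorem rep_T0 : h.rep (Daha.T0 a b c d q) = opT0 c d q := basicRep_gen ..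
theorem rep_CT1 : h.rep (Daha.CT1 a b c d q) = opCT1 a b := basicRep_gen ..

theorem rep_Y : h.rep (Daha.Y a b c d q) = opY a b c d q := by
  rw [Daha.Y_eq, map_mul, rep_T1, rep_T0]; rfl

theorem rep_ZInv : h.rep (Daha.ZInv a b c d q) = opZInv := by
  rw [Daha.ZInv, map_mul, rep_T1]
  change h.rep (Daha.CT1 a b c d q) * _ = _
  rw [rep_CT1]
  refine LinearMap.ext fun f => ?_
  rw [Module.End.mul_apply, opCT1_apply, opT1Inv_opT1 h.a0 h.b0 h.ab_ne_one]

theorem rep_YInv_polyE (n : ℤ) :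
    h.rep (Daha.YInv a b c d q) (polyE a b c d q n) = nuSeq a b c d q n • polyE a b c d q n := by
  have e := congrArg (fun x => h.rep x (polyE a b c d q n)) (Daha.YInv_mul_Y h)
  simp only [map_mul, Module.End.mul_apply, rep_Y, opY_polyE h, map_smul, map_one,
    Module.End.one_apply] at e
  conv_rhs => rw [← e]
  rw [smul_inv_smul₀ (nuSeq_ne_zero h n)]

theorem rep_polyY_polyE (f : ℂ[T;T⁻¹]) (n : ℤ) :
    h.rep (Daha.polyY h f) (polyE a b c d q n) =
      evalAt f (nuSeq a b c d q n)⁻¹ • polyE a b c d q n := by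
  have hz := inv_ne_zero (nuSeq_ne_zero h n)
  induction f using LaurentPolynomial.induction_on' with
  | add f g hf hg => simp only [map_add, LinearMap.add_apply, hf, hg, evalAt_add _ _ hz, add_smul]
  | C_mul_T k r =>
    simp only [map_mul, Daha.polyY_C, evalAt_mul _ _ hz, evalAt_C _ hz, smul_mul_assoc, one_mul,
      map_smul, LinearMap.smul_apply, mul_smul, evalAt_T _ hz]
    congr 1
    induction k using Int.induction_on with
    | zero => simp
    | succ k ih =>
      rw [T_add, map_mul, map_mul, Module.End.mul_apply, Daha.polyY_T_one, rep_Y, opY_polyE h,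
        map_smul, ih, smul_smul, zpow_add₀ hz, zpow_one, mul_comm]
    | pred k ih =>
      rw [sub_eq_add_neg, T_add, map_mul, map_mul, Module.End.mul_apply, Daha.polyY_T_neg_one,
        rep_YInv_polyE, map_smul, ih, smul_smul, zpow_add₀ hz, zpow_neg_one, inv_inv, mul_comm]

theorem rep_polyY_basisV (f : ℂ[T;T⁻¹]) (p : ℕ) :
    h.rep (Daha.polyY h f) (basisV h p) =
      evalAt f (nuSeq a b c d q (Equiv.intEquivNat.symm p))⁻¹ • basisV h p := by
  rw [basisV_apply, rep_polyY_polyE]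

/-- Even positions carry `E_n` and odd ones `E_{-n-1}`. Thus `Ť₁` raises the index from even
positions and `T₁` from odd ones, with leading coefficients `coefD` and `coefU`; from the other
parity the index does not increase. -/
theorem rep_letter (s : Bool) (p : ℕ) :
    (p.bodd = s → ∃ y : ℂ, y ≠ 0 ∧
      h.rep (Daha.letter a b c d q s) (basisV h p) - y • basisV h (p + 1) ∈ initV h (p + 1)) ∧
    (p.bodd = !s → h.rep (Daha.letter a b c d q s) (basisV h p) ∈ initV h (p + 1)) := by
  obtain ⟨n, rfl | rfl⟩ : ∃ n, p = 2 * n ∨ p = 2 * n + 1 := ⟨p / 2, by omega⟩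
  · have hp : (2 * n).bodd = false := by simp
    rw [hp]
    cases s with
    | true =>
      simp only [reduceCtorEq, IsEmpty.forall_iff, Bool.not_true, forall_const, true_and,
        Daha.letter, if_true, rep_T1]
      rw [basisV_two_mul, opT1_polyE h, ← basisV_two_mul h]
      refine add_mem (Submodule.smul_mem _ _ (basisV_mem_initV h (by omega))) ?_
      cases n with
      | zero =>
        rw [Nat.cast_zero, coefU_zero, zero_smul]; exact zero_mem _
      | succ n =>
        push_cast
        rw [← basisV_two_mul_add_one h]
        exact Submodule.smul_mem _ _ (basisV_mem_initV h (by omega))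
    | false =>
      simp only [Bool.not_false, reduceCtorEq, IsEmpty.forall_iff, and_true, forall_const,
        Daha.letter, if_false, rep_CT1]
      refine ⟨_, coefD_ne_zero h n, ?_⟩
      rw [basisV_two_mul, basisV_two_mul_add_one, opCT1_polyE h,
        show -(n : ℤ) - 1 = -((n : ℤ) + 1) by ring, add_sub_cancel_right, ← basisV_two_mul h]
      exact Submodule.smul_mem _ _ (basisV_mem_initV h (by omega))
  · have hp : (2 * n + 1).bodd = true := by simp
    rw [hp]
    cases s with
    | true =>
      simp only [Bool.not_true, reduceCtorEq, IsEmpty.forall_iff, and_true, forall_const,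
        Daha.letter, if_true, rep_T1]
      refine ⟨_, coefU_neg_succ_ne_zero h n, ?_⟩
      rw [show 2 * n + 1 + 1 = 2 * (n + 1) by ring, basisV_two_mul, basisV_two_mul_add_one,
        opT1_polyE h, neg_neg]
      push_cast
      rw [add_sub_cancel_right, ← basisV_two_mul_add_one h]
      exact Submodule.smul_mem _ _ (basisV_mem_initV h (by omega))
    | false =>
      simp only [Bool.not_false, reduceCtorEq, IsEmpty.forall_iff, true_and, forall_const,
        Daha.letter, if_false, rep_CT1]
      rw [basisV_two_mul_add_one, opCT1_polyE h,
        show -(-((n : ℤ) + 1)) - 1 = n by ring, ← basisV_two_mul h, ← basisV_two_mul_add_one h]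
      exact add_mem (Submodule.smul_mem _ _ (basisV_mem_initV h (by omega)))
        (Submodule.smul_mem _ _ (basisV_mem_initV h (by omega)))

theorem rep_letter_mem (s : Bool) (p : ℕ) {f : ℂ[T;T⁻¹]} (hf : f ∈ initV h p) :
    h.rep (Daha.letter a b c d q s) f ∈ initV h (p + 1) := by
  refine map_mem_initV h (fun j hj => ?_) hf
  obtain ⟨h1, h2⟩ := h.rep_letter s j
  by_cases hb : j.bodd = s
  · obtain ⟨y, -, hy⟩ := h1 hb
    rw [← sub_add_cancel (h.rep _ _) (y • basisV h (j + 1))]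
    exact add_mem (initV_mono h (by omega) hy)
      (Submodule.smul_mem _ _ (basisV_mem_initV h (by omega)))
  · exact initV_mono h (by omega) (h2 (by cases s <;> simpa using hb))

/-- The leading term of an alternating word applied to an element of `basisV`. -/
theorem rep_word (m : ℕ) (s : Bool) (p : ℕ) : ∃ y : ℂ, (y ≠ 0 ↔ m = 0 ∨ (p + m).bodd = !s) ∧
    h.rep (Daha.word a b c d q s m) (basisV h p) - y • basisV h (p + m) ∈ initV h (p + m) := by
  induction m generalizing s with
  | zero => exact ⟨1, by simp, by simp [Daha.word]⟩
  | succ m ih =>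
    obtain ⟨y, hy, hmem⟩ := ih (!s)
    have e : h.rep (Daha.word a b c d q s (m + 1)) (basisV h p) =
        y • h.rep (Daha.letter a b c d q s) (basisV h (p + m)) +
          h.rep (Daha.letter a b c d q s)
            (h.rep (Daha.word a b c d q (!s) m) (basisV h p) - y • basisV h (p + m)) := by
      rw [Daha.word, map_mul, Module.End.mul_apply, map_sub, map_smul]; abel
    have hmem' := h.rep_letter_mem s (p + m) hmem
    obtain ⟨h1, h2⟩ := h.rep_letter s (p + m)
    rw [e, ← add_assoc]
    -- The leftmost letter acts last, at position `p + m`, and raises it exactly when the parity is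
    -- `s`. The inner word then has a nonzero leading coefficient, since its first letter is `!s`.
    by_cases hb : (p + m).bodd = s
    · obtain ⟨y', hy', hmem''⟩ := h1 hb
      refine ⟨y * y', ?_, ?_⟩
      · rw [Nat.bodd_succ, hb]
        simp only [or_true, iff_true]
        refine mul_ne_zero (hy.mpr (Or.inr ?_)) hy'
        rw [hb, Bool.not_not]
      · have := add_mem (Submodule.smul_mem _ y hmem'') hmem'
        rw [smul_sub, smul_smul] at this
        convert this using 1
        abel
    · have hb' : (p + m).bodd = !s := by cases s <;> simpa using hb
      refine ⟨0, ?_, ?_⟩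
      · rw [Nat.bodd_succ, hb']
        cases s <;> simp
      · rw [zero_smul, sub_zero]
        exact add_mem (Submodule.smul_mem _ _ (h2 hb')) hmem'

theorem rep_polyY_mem (f : ℂ[T;T⁻¹]) {p : ℕ} {g : ℂ[T;T⁻¹]} (hg : g ∈ initV h p) :
    h.rep (Daha.polyY h f) g ∈ initV h p := by
  refine map_mem_initV h (fun j hj => ?_) hg
  rw [rep_polyY_basisV]
  exact Submodule.smul_mem _ _ (basisV_mem_initV h hj)

theorem rep_word_mem (m : ℕ) (s : Bool) (p : ℕ) :
    h.rep (Daha.word a b c d q s m) (basisV h p) ∈ initV h (p + m + 1) := by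
  obtain ⟨y, -, hy⟩ := h.rep_word m s p
  rw [← sub_add_cancel (h.rep _ _) (y • basisV h (p + m))]
  exact add_mem (initV_mono h (by omega) hy)
    (Submodule.smul_mem _ _ (basisV_mem_initV h (by omega)))

theorem rep_filt_mem {m : ℕ} {x : Daha a b c d q} (hx : x ∈ Daha.filt h m) (p : ℕ) :
    h.rep x (basisV h p) ∈ initV h (p + m + 1) := by
  induction hx using Submodule.span_induction with
  | mem x hx =>
    obtain ⟨f, s, k, hk, rfl⟩ := hx
    rw [map_mul]
    exact initV_mono h (by omega) (h.rep_polyY_mem f (h.rep_word_mem k s p))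
  | zero => rw [map_zero]; exact zero_mem _
  | add x y _ _ hx hy => rw [map_add]; exact add_mem hx hy
  | smul r x _ hx => rw [map_smul]; exact Submodule.smul_mem _ _ hx

/-- The leading coefficient of `f(Y) w`, for an alternating word `w`. -/
theorem repr_rep_polyY_mul_word (f : ℂ[T;T⁻¹]) (m : ℕ) (s : Bool) (p : ℕ) :
    ∃ y : ℂ, (y ≠ 0 ↔ m = 0 ∨ (p + m).bodd = !s) ∧
      (basisV h).repr (h.rep (Daha.polyY h f * Daha.word a b c d q s m) (basisV h p)) (p + m) =
        y * evalAt f (nuSeq a b c d q (Equiv.intEquivNat.symm (p + m)))⁻¹ := by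
  obtain ⟨y, hy, hmem⟩ := h.rep_word m s p
  refine ⟨y, hy, ?_⟩
  have := repr_eq_zero_of_mem_initV h (h.rep_polyY_mem f hmem)
  rw [map_sub, map_smul, rep_polyY_basisV, smul_smul, map_sub, map_smul, Module.Basis.repr_self,
    Finsupp.sub_apply, Finsupp.smul_apply, Finsupp.single_eq_same, smul_eq_mul, mul_one,
    sub_eq_zero] at this
  rw [map_mul]
  exact this

include h in
theorem eq_zero_of_evalAt_nuSeq {f : ℂ[T;T⁻¹]} {g : ℕ → ℕ} (hg : Function.Injective g)
    (hf : ∀ p, evalAt f (nuSeq a b c d q (Equiv.intEquivNat.symm (g p)))⁻¹ = 0) : f = 0 := by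
  refine eq_zero_of_evalAt_eq_zero (S := Set.range fun p =>
    (nuSeq a b c d q (Equiv.intEquivNat.symm (g p)))⁻¹) (Set.infinite_range_of_injective ?_) ?_ ?_
  · exact inv_injective.comp ((nuSeq_injective h).comp (Equiv.intEquivNat.symm.injective.comp hg))
  · rintro _ ⟨p, rfl⟩
    exact inv_ne_zero (nuSeq_ne_zero h _)
  · rintro _ ⟨p, rfl⟩
    exact hf p

/-- There are two words of top length, and on a given basis vector exactly one of them reaches the
top index; the parity decides which. Hence each of the two coefficients in `Y` vanishes at
infinitely many eigenvalues, and the filtration degree drops. -/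
theorem rep_injective : Function.Injective h.rep := by
  rw [injective_iff_map_eq_zero]
  intro x hx
  obtain ⟨m, hm⟩ := Daha.exists_mem_filt h x
  induction m generalizing x with
  | zero =>
    obtain ⟨f, rfl⟩ := Daha.eq_polyY_of_mem_filt_zero h hm
    rw [h.eq_zero_of_evalAt_nuSeq (f := f) (g := id) Function.injective_id, map_zero]
    intro p
    have := h.rep_polyY_basisV f p
    rw [hx, LinearMap.zero_apply] at this
    exact (smul_eq_zero.mp this.symm).resolve_right ((basisV h).ne_zero p)
  | succ m ih =>
    obtain ⟨y, hy, f, rfl⟩ := Daha.exists_of_mem_filt_succ h hm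
    have key : ∀ p s, (p + (m + 1)).bodd = !s →
        evalAt (f s) (nuSeq a b c d q (Equiv.intEquivNat.symm (p + (m + 1))))⁻¹ = 0 := by
      intro p s hps
      have e := congrArg (fun A => (basisV h).repr (A (basisV h p)) (p + (m + 1))) hx
      simp only [map_add (h.rep), LinearMap.add_apply, map_add (basisV h).repr, Finsupp.add_apply,
        LinearMap.zero_apply, map_zero, Finsupp.zero_apply] at e
      rw [repr_eq_zero_of_mem_initV h (p := p + (m + 1)) (h.rep_filt_mem hy p), zero_add] at e
      obtain ⟨y1, hy1, e1⟩ := h.repr_rep_polyY_mul_word (f true) (m + 1) true p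
      obtain ⟨y2, hy2, e2⟩ := h.repr_rep_polyY_mul_word (f false) (m + 1) false p
      rw [e1, e2] at e
      rw [hps] at hy1 hy2
      cases s with
      | true =>
        have : y2 = 0 := by by_contra h0; simpa using hy2.mp h0
        rw [this, zero_mul, add_zero] at e
        exact (mul_eq_zero.mp e).resolve_left (hy1.mpr (by simp))
      | false =>
        have : y1 = 0 := by by_contra h0; simpa using hy1.mp h0
        rw [this, zero_mul, zero_add] at e
        exact (mul_eq_zero.mp e).resolve_left (hy2.mpr (by simp))
    have hf : ∀ s, f s = 0 := by
      intro s
      -- The shift `r ∈ {0, 1}` selects the parity at which the word beginning with `s` is the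
      -- surviving one.
      obtain ⟨r, hr⟩ : ∃ r : ℕ, (r + (m + 1)).bodd = !s := by
        by_cases hb : (m + 1).bodd = !s
        · exact ⟨0, by rwa [zero_add]⟩
        · refine ⟨1, ?_⟩
          rw [add_comm, Nat.bodd_succ]
          revert hb
          cases (m + 1).bodd <;> cases s <;> simp
      refine h.eq_zero_of_evalAt_nuSeq (g := fun p => 2 * p + r + (m + 1)) ?_ fun p =>
        key (2 * p + r) s ?_
      · intro p p' e
        have e' : 2 * p + r + (m + 1) = 2 * p' + r + (m + 1) := e
        omega
      · rw [add_assoc, Nat.bodd_add, hr]; simp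
    rw [hf, hf, map_zero, zero_mul, zero_mul, add_zero, add_zero] at hx ⊢
    exact ih y hx hy

end Admissible

end

section
variable {a b c d q : ℂ}

/-! ### The anti-representation on functions and the anti-involution of the DAHA -/

theorem map_bandOp {X X' : Type*} [AddCommGroup X] [Module ℂ X] [AddCommGroup X'] [Module ℂ X']
    (F : X →ₗ[ℂ] X') (k₁ k₂ k₃ k₄ : ℤ → ℂ) (g : ℤ → X) (n : ℤ) :
    F (bandOp X k₁ k₂ k₃ k₄ g n) = bandOp X' k₁ k₂ k₃ k₄ (fun m => F (g m)) n := by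
  simp only [bandOp_apply, map_add, map_smul]

/-- The transpose of an endomorphism with respect to a basis, acting on functions on the index
set. -/
def transposeFun {ι V : Type*} [AddCommGroup V] [Module ℂ V] (e : Module.Basis ι ℂ V) :
    Module.End ℂ V →ₐ[ℂ] (Module.End ℂ (ι → ℂ))ᵐᵒᵖ :=
  AlgHom.ofLinearMap
    { toFun := fun A => MulOpposite.op
        { toFun := fun g n => e.constr ℂ g (A (e n))
          map_add' := fun g g' => by ext n; simp
          map_smul' := fun r g => by ext n; simp }
      map_add' := fun A B => by
        rw [← MulOpposite.op_add]; congr 1; ext g n; simp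
      map_smul' := fun r A => by
        rw [RingHom.id_apply, ← MulOpposite.op_smul]; congr 1; ext g n; simp }
    (by
      rw [← MulOpposite.op_one]
      refine congrArg MulOpposite.op (LinearMap.ext fun g => funext fun n => ?_)
      exact e.constr_basis ℂ g n)
    (fun A B => by
      refine congrArg MulOpposite.op (LinearMap.ext fun g => funext fun n => ?_)
      change e.constr ℂ g (A (B (e n))) = e.constr ℂ (fun m => e.constr ℂ g (A (e m))) (B (e n))
      have : e.constr ℂ g ∘ₗ A = e.constr ℂ (fun m => e.constr ℂ g (A (e m))) :=
        e.ext fun m => by rw [e.constr_basis]; rfl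
      exact LinearMap.congr_fun this (B (e n)))

theorem transposeFun_apply {ι V : Type*} [AddCommGroup V] [Module ℂ V] (e : Module.Basis ι ℂ V)
    (A : Module.End ℂ V) (g : ι → ℂ) (n : ι) :
    (transposeFun e A).unop g n = e.constr ℂ g (A (e n)) := rfl

/-- Functions on the index set are the linear forms on `V`, and linear forms separate vectors. -/
theorem transposeFun_injective {ι V : Type*} [AddCommGroup V] [Module ℂ V]
    (e : Module.Basis ι ℂ V) : Function.Injective (transposeFun e) := by
  rw [injective_iff_map_eq_zero]
  intro A hA
  refine e.ext fun n => ?_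
  rw [LinearMap.zero_apply, ← Module.forall_dual_apply_eq_zero_iff ℂ]
  intro φ
  have h1 := transposeFun_apply e A (fun m => φ (e m)) n
  rw [hA] at h1
  have h2 : e.constr ℂ (fun m => φ (e m)) = φ := e.ext fun m => by rw [e.constr_basis]
  rw [h2] at h1
  rw [← h1]; rfl

theorem transposeFun_eq_bandOp (h : Admissible a b c d q) {A : Module.End ℂ ℂ[T;T⁻¹]}
    {k₁ k₂ k₃ k₄ : ℤ → ℂ} (hA : ∀ n, A (polyE a b c d q n) =
      bandOp ℂ[T;T⁻¹] k₁ k₂ k₃ k₄ (polyE a b c d q) n) :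
    transposeFun (basisE h) A = MulOpposite.op (bandOp ℂ k₁ k₂ k₃ k₄) := by
  apply MulOpposite.unop_injective
  refine LinearMap.ext fun g => funext fun n => ?_
  rw [transposeFun_apply, basisE_apply, hA, map_bandOp, MulOpposite.unop_op]
  have : (fun m => (basisE h).constr ℂ g (polyE a b c d q m)) = g := funext fun m => by
    rw [← basisE_apply h, Module.Basis.constr_basis]
  rw [this]

namespace Daha

theorem mul_cancel_of_mul_eq_one {A : Type*} [Ring A] {x y : A} (hxy : x * y = 1) (z : A) :
    x * (y * z) = z := by
  rw [← mul_assoc, hxy, one_mul]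

theorem smul_add_conj {A : Type*} [Ring A] [Algebra ℂ A] {x y : A} (hxy : x * y = 1) (r k : ℂ)
    (z : A) : r • (x * z * y) + algebraMap ℂ A k = x * (r • z + algebraMap ℂ A k) * y := by
  simp only [Algebra.algebraMap_eq_smul_one, mul_add, add_mul, mul_smul_comm, smul_mul_assoc,
    mul_one, hxy]

theorem conj_mul_conj {A : Type*} [Ring A] {x y : A} (hyx : y * x = 1) (z w : A) :
    x * z * y * (x * w * y) = x * (z * w) * y := by
  simp only [mul_assoc, mul_cancel_of_mul_eq_one hyx]

theorem smul_add_mul_comm {A : Type*} [Ring A] [Algebra ℂ A] (x : A) (r s k l : ℂ) :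
    (r • x + algebraMap ℂ A k) * (s • x + algebraMap ℂ A l) =
      (s • x + algebraMap ℂ A l) * (r • x + algebraMap ℂ A k) := by
  simp only [Algebra.algebraMap_eq_smul_one, mul_add, add_mul, mul_smul_comm, smul_mul_assoc,
    mul_one, one_mul]
  module

variable (a b c d q) in
/-- The images of the generators under the anti-involution. -/
def antiGen : Gen → (Daha a b c d q)ᵐᵒᵖ
  | .t1 => MulOpposite.op (T1 a b c d q)
  | .t0 => MulOpposite.op (T1 a b c d q * T0 a b c d q * T1Inv a b c d q)
  | .ct1 => MulOpposite.op (CT1 a b c d q)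
  | .ct0 => MulOpposite.op (CT1Inv a b c d q * CT0 a b c d q * CT1 a b c d q)

/-- The images of `T₀` and `Ť₀` are conjugates, so they keep their quadratic relations. The reversed
product is `Ť₁⁻¹ (Ť₀ Ť₁ T₁ T₀) Ť₁`, which is `1` because `Ť₀ (Ť₁ Y) = 1`. -/
theorem antiGen_rel (h : Admissible a b c d q) ⦃x y : FreeAlgebra ℂ Gen⦄
    (hxy : DahaRel a b c d q x y) :
    FreeAlgebra.lift ℂ (antiGen a b c d q) x = FreeAlgebra.lift ℂ (antiGen a b c d q) y := by
  apply MulOpposite.unop_injective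
  have e1 := T1_mul_T1Inv h
  have e2 := T1Inv_mul_T1 h
  have e3 := CT1_mul_CT1Inv h
  have e4 := CT1Inv_mul_CT1 h
  cases hxy with
  | t1 =>
    have e := RingQuot.mkAlgHom_rel ℂ (DahaRel.t1 (a := a) (b := b) (c := c) (d := d) (q := q))
    simp only [_root_.map_mul (RingQuot.mkAlgHom ℂ (DahaRel a b c d q)), map_add, map_one, map_zero, AlgHom.commutes] at e
    simp only [_root_.map_mul (FreeAlgebra.lift ℂ (antiGen a b c d q)), map_add, FreeAlgebra.lift_ι_apply,
      AlgHom.commutes, map_one, map_zero, MulOpposite.unop_mul, MulOpposite.unop_add,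
      MulOpposite.algebraMap_apply, MulOpposite.unop_op, MulOpposite.unop_one,
      MulOpposite.unop_zero, antiGen]
    refine Eq.trans ?_ e
    have := smul_add_mul_comm (T1 a b c d q) 1 1 1 (a * b)
    rwa [one_smul, map_one] at this
  | t0 =>
    have e := RingQuot.mkAlgHom_rel ℂ (DahaRel.t0 (a := a) (b := b) (c := c) (d := d) (q := q))
    simp only [_root_.map_mul (RingQuot.mkAlgHom ℂ (DahaRel a b c d q)), map_add, map_one, map_zero, AlgHom.commutes] at e
    change (T0 a b c d q + _) * (T0 a b c d q + 1) = 0 at e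
    simp only [_root_.map_mul (FreeAlgebra.lift ℂ (antiGen a b c d q)), map_add, FreeAlgebra.lift_ι_apply,
      AlgHom.commutes, map_one, map_zero, MulOpposite.unop_mul, MulOpposite.unop_add,
      MulOpposite.algebraMap_apply, MulOpposite.unop_op, MulOpposite.unop_one,
      MulOpposite.unop_zero, antiGen]
    have c1 := smul_add_conj e1 1 1 (T0 a b c d q)
    have c2 := smul_add_conj e1 1 (q⁻¹ * c * d) (T0 a b c d q)
    have c3 := smul_add_mul_comm (T0 a b c d q) 1 1 1 (q⁻¹ * c * d)
    simp only [one_smul, map_one] at c1 c2 c3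
    rw [c1, c2, conj_mul_conj e2, c3, e, mul_zero, zero_mul]
  | ct1 =>
    have e := RingQuot.mkAlgHom_rel ℂ (DahaRel.ct1 (a := a) (b := b) (c := c) (d := d) (q := q))
    simp only [map_mul, map_add, map_one, map_zero, map_smul] at e
    simp only [map_mul, map_add, map_smul, FreeAlgebra.lift_ι_apply, map_one, map_zero,
      MulOpposite.unop_mul, MulOpposite.unop_add, MulOpposite.unop_smul,
      MulOpposite.unop_op, MulOpposite.unop_one, MulOpposite.unop_zero, antiGen]
    refine Eq.trans ?_ e
    have := smul_add_mul_comm (CT1 a b c d q) b a 1 1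
    rwa [map_one] at this
  | ct0 =>
    have e := RingQuot.mkAlgHom_rel ℂ (DahaRel.ct0 (a := a) (b := b) (c := c) (d := d) (q := q))
    simp only [map_mul, map_add, map_zero, map_smul, AlgHom.commutes] at e
    change (c • CT0 a b c d q + _) * (d • CT0 a b c d q + _) = 0 at e
    simp only [map_mul, map_add, map_smul, FreeAlgebra.lift_ι_apply, AlgHom.commutes, map_zero,
      MulOpposite.unop_mul, MulOpposite.unop_add, MulOpposite.unop_smul,
      MulOpposite.algebraMap_apply, MulOpposite.unop_op, MulOpposite.unop_zero, antiGen]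
    rw [smul_add_conj e4, smul_add_conj e4, conj_mul_conj e3, smul_add_mul_comm, e, mul_zero,
      zero_mul]
  | prod =>
    simp only [map_mul, FreeAlgebra.lift_ι_apply, map_one, MulOpposite.unop_mul,
      MulOpposite.unop_op, MulOpposite.unop_one, antiGen]
    have e5 : CT0 a b c d q * (CT1 a b c d q * Y a b c d q) = 1 := CT0_mul_inv h
    rw [Y_eq] at e5
    simp only [mul_assoc, mul_cancel_of_mul_eq_one e2] at e5 ⊢
    have e6 := congrArg (fun u => CT1Inv a b c d q * (u * CT1 a b c d q)) e5
    simp only [mul_assoc, one_mul, e4] at e6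
    exact e6

/-- The anti-involution of the DAHA fixing `T₁`, `Ť₁` and `Y`, as a homomorphism to the opposite
algebra. -/
def anti (h : Admissible a b c d q) : Daha a b c d q →ₐ[ℂ] (Daha a b c d q)ᵐᵒᵖ :=
  RingQuot.liftAlgHom ℂ ⟨FreeAlgebra.lift ℂ (antiGen a b c d q), antiGen_rel h⟩

theorem anti_gen (h : Admissible a b c d q) (g : Gen) :
    anti h (gen a b c d q g) = antiGen a b c d q g := by
  simp [anti, gen]

section
variable (h : Admissible a b c d q)

theorem anti_T1 : anti h (T1 a b c d q) = MulOpposite.op (T1 a b c d q) := anti_gen h Gen.t1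

theorem anti_T0 : anti h (T0 a b c d q) =
    MulOpposite.op (T1 a b c d q * T0 a b c d q * T1Inv a b c d q) := anti_gen h Gen.t0

theorem anti_CT1 : anti h (CT1 a b c d q) = MulOpposite.op (CT1 a b c d q) := anti_gen h Gen.ct1

theorem anti_CT0 : anti h (CT0 a b c d q) =
    MulOpposite.op (CT1Inv a b c d q * CT0 a b c d q * CT1 a b c d q) := anti_gen h Gen.ct0

theorem anti_T1Inv : anti h (T1Inv a b c d q) = MulOpposite.op (T1Inv a b c d q) := by
  rw [T1Inv, map_sub, map_smul, anti_T1, AlgHom.commutes]; rfl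

theorem anti_CT1Inv : anti h (CT1Inv a b c d q) = MulOpposite.op (CT1Inv a b c d q) := by
  rw [CT1Inv, map_sub, map_smul, map_smul, anti_CT1, map_one]; rfl

theorem anti_Y : anti h (Y a b c d q) = MulOpposite.op (Y a b c d q) := by
  rw [Y_eq, map_mul, anti_T1, anti_T0, ← MulOpposite.op_mul, mul_assoc, T1Inv_mul_T1 h, mul_one]

theorem ZInv_eq : ZInv a b c d q = CT1 a b c d q * T1 a b c d q := rfl

theorem anti_conj_ZInv : anti h (T1 a b c d q * ZInv a b c d q * T1Inv a b c d q) =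
    MulOpposite.op (ZInv a b c d q) := by
  rw [ZInv_eq, map_mul, map_mul, map_mul, anti_T1, anti_T1Inv, anti_CT1, ← MulOpposite.op_mul,
    ← MulOpposite.op_mul, ← MulOpposite.op_mul, mul_assoc (T1 a b c d q),
    mul_cancel_of_mul_eq_one (T1Inv_mul_T1 h)]

/-- The anti-involution as an isomorphism with the opposite algebra. -/
def antiEquiv : Daha a b c d q ≃ₐ[ℂ] (Daha a b c d q)ᵐᵒᵖ := by
  -- The map is its own inverse; on `T₀` and `Ť₀` the two conjugations undo each other.
  have key : (AlgHom.opComm (anti h)).comp (anti h) = AlgHom.id ℂ (Daha a b c d q) := by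
    refine algHom_ext ?_ ?_ ?_ ?_
    · change ((anti h) (anti h _).unop).unop = _
      rw [anti_T1, MulOpposite.unop_op, anti_T1]; rfl
    · change ((anti h) (anti h _).unop).unop = _
      rw [anti_T0, MulOpposite.unop_op, map_mul, map_mul, anti_T1, anti_T0, anti_T1Inv,
        ← MulOpposite.op_mul, ← MulOpposite.op_mul, MulOpposite.unop_op]
      simp only [mul_assoc, T1Inv_mul_T1 h, mul_one, mul_cancel_of_mul_eq_one (T1Inv_mul_T1 h)]
      rfl
    · change ((anti h) (anti h _).unop).unop = _
      rw [anti_CT1, MulOpposite.unop_op, anti_CT1]; rfl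
    · change ((anti h) (anti h _).unop).unop = _
      rw [anti_CT0, MulOpposite.unop_op, map_mul, map_mul, anti_CT1, anti_CT0, anti_CT1Inv,
        ← MulOpposite.op_mul, ← MulOpposite.op_mul, MulOpposite.unop_op]
      simp only [mul_assoc, CT1_mul_CT1Inv h, mul_one, mul_cancel_of_mul_eq_one (CT1_mul_CT1Inv h)]
      rfl
  refine AlgEquiv.ofAlgHom (anti h) (AlgHom.opComm (anti h)) ?_ key
  refine AlgHom.ext fun x => MulOpposite.unop_injective ?_
  exact DFunLike.congr_fun key x.unop

theorem antiEquiv_apply (x : Daha a b c d q) : antiEquiv h x = anti h x := rfl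

include h in
-- `T₁ Z⁻¹ T₁⁻¹` equals `T₁ Ť₁`, which yields `Ť₁`; `T₀` comes from `Y`, and `Ť₀` from the product
-- relation.
theorem adjoin_eq_top : Algebra.adjoin ℂ {T1 a b c d q, Y a b c d q,
    T1 a b c d q * ZInv a b c d q * T1Inv a b c d q} = ⊤ := by
  set S := Algebra.adjoin ℂ {T1 a b c d q, Y a b c d q,
    T1 a b c d q * ZInv a b c d q * T1Inv a b c d q}
  have h1 : T1 a b c d q ∈ S := Algebra.subset_adjoin (by simp)
  have h2 : Y a b c d q ∈ S := Algebra.subset_adjoin (by simp)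
  have h3 : T1 a b c d q * ZInv a b c d q * T1Inv a b c d q ∈ S := Algebra.subset_adjoin (by simp)
  have h4 : T1Inv a b c d q ∈ S :=
    S.sub_mem (S.smul_mem h1 _) (S.algebraMap_mem _)
  have h5 : T0 a b c d q ∈ S := by rw [T0_eq h]; exact S.mul_mem h4 h2
  have h6 : CT1 a b c d q ∈ S := by
    rw [CT1_eq h, ← mul_cancel_of_mul_eq_one (T1Inv_mul_T1 h) (_ * _), ← mul_assoc (T1 a b c d q)]
    exact S.mul_mem h4 h3
  have h7 : CT0 a b c d q ∈ S := by
    rw [CT0_eq h, YInv, T0Inv, CT1Inv]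
    exact S.mul_mem (S.mul_mem (S.smul_mem (S.add_mem h5 (S.smul_mem S.one_mem _)) _) h4)
      (S.sub_mem (S.smul_mem h6 _) (S.smul_mem S.one_mem _))
  have h8 : ∀ g, gen a b c d q g ∈ S := by
    intro g
    cases g with
    | t1 => exact h1
    | t0 => exact h5
    | ct1 => exact h6
    | ct0 => exact h7
  rw [eq_top_iff]
  rintro x -
  obtain ⟨u, rfl⟩ := RingQuot.mkAlgHom_surjective ℂ (DahaRel a b c d q) x
  induction u using FreeAlgebra.induction with
  | grade0 r => rw [AlgHom.commutes]; exact S.algebraMap_mem r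
  | grade1 g => exact h8 g
  | mul u v hu hv => rw [map_mul]; exact S.mul_mem hu hv
  | add u v hu hv => rw [map_add]; exact S.add_mem hu hv

end

end Daha

namespace Admissible

variable (h : Admissible a b c d q)

/-- The anti-representation of the DAHA on functions on `ℤ`. -/
def antiRep : Daha a b c d q →ₐ[ℂ] (Module.End ℂ (ℤ → ℂ))ᵐᵒᵖ :=
  (transposeFun (basisE h)).comp h.rep

theorem antiRep_T1 : h.antiRep (Daha.T1 a b c d q) = MulOpposite.op (opU ℂ a b c d q) := by
  rw [antiRep, AlgHom.comp_apply, rep_T1]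
  exact transposeFun_eq_bandOp h (opT1_polyE' h)

theorem antiRep_Y : h.antiRep (Daha.Y a b c d q) = MulOpposite.op (opN ℂ a b c d q) := by
  rw [antiRep, AlgHom.comp_apply, rep_Y]
  exact transposeFun_eq_bandOp h (opY_polyE' h)

theorem antiRep_ZInv : h.antiRep (Daha.ZInv a b c d q) = MulOpposite.op (opM ℂ a b c d q) := by
  rw [antiRep, AlgHom.comp_apply, rep_ZInv]
  exact transposeFun_eq_bandOp h (opZInv_polyE h)

theorem antiRep_injective : Function.Injective h.antiRep :=
  (transposeFun_injective (basisE h)).comp h.rep_injective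

include h in
-- Existence is the transpose of the basic representation. For uniqueness, the three prescribed
-- values determine the value at `T₁⁻¹`, hence on a generating set.
theorem existsUnique_antiRep : ∃! ρ : Daha a b c d q →ₐ[ℂ] (Module.End ℂ (ℤ → ℂ))ᵐᵒᵖ,
    ρ (Daha.T1 a b c d q) = MulOpposite.op (opU ℂ a b c d q) ∧
    ρ (Daha.Y a b c d q) = MulOpposite.op (opN ℂ a b c d q) ∧
    ρ (Daha.ZInv a b c d q) = MulOpposite.op (opM ℂ a b c d q) := by
  refine ⟨h.antiRep, ⟨h.antiRep_T1, h.antiRep_Y, h.antiRep_ZInv⟩, ?_⟩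
  rintro ρ ⟨h1, h2, h3⟩
  have h4 : ρ (Daha.T1Inv a b c d q) = h.antiRep (Daha.T1Inv a b c d q) := by
    rw [Daha.T1Inv, map_sub, map_sub, map_smul, map_smul, h1, antiRep_T1, AlgHom.commutes,
      AlgHom.commutes]
  refine AlgHom.ext_of_adjoin_eq_top (Daha.adjoin_eq_top h) ?_
  rintro x (rfl | rfl | rfl)
  · rw [h1, antiRep_T1]
  · rw [h2, antiRep_Y]
  · rw [map_mul, map_mul, map_mul, map_mul, h1, h3, h4, antiRep_T1, antiRep_ZInv]

/-- The faithful representation of the DAHA by operators on functions on `ℤ`. -/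
def funRep : Daha a b c d q →ₐ[ℂ] Module.End ℂ (ℤ → ℂ) :=
  (AlgHom.opComm h.antiRep).comp (Daha.anti h)

theorem funRep_apply (x : Daha a b c d q) :
    h.funRep x = (h.antiRep (Daha.anti h x).unop).unop := rfl

theorem funRep_T1 : h.funRep (Daha.T1 a b c d q) = opU ℂ a b c d q := by
  rw [funRep_apply, Daha.anti_T1, MulOpposite.unop_op, antiRep_T1, MulOpposite.unop_op]

theorem funRep_Y : h.funRep (Daha.Y a b c d q) = opN ℂ a b c d q := by
  rw [funRep_apply, Daha.anti_Y, MulOpposite.unop_op, antiRep_Y, MulOpposite.unop_op]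

theorem funRep_conj_ZInv :
    h.funRep (Daha.T1 a b c d q * Daha.ZInv a b c d q * Daha.T1Inv a b c d q) =
      opM ℂ a b c d q := by
  rw [funRep_apply, Daha.anti_conj_ZInv, MulOpposite.unop_op, antiRep_ZInv, MulOpposite.unop_op]

theorem funRep_injective : Function.Injective h.funRep := by
  intro x y e
  rw [funRep_apply, funRep_apply] at e
  exact (Daha.antiEquiv h).injective
    (MulOpposite.unop_injective (h.antiRep_injective (MulOpposite.unop_injective e)))

theorem funRep_range : h.funRep.range = opAlgebra a b c d q := by
  rw [← Algebra.map_top, ← Daha.adjoin_eq_top h, AlgHom.map_adjoin, opAlgebra]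
  congr 1
  rw [Set.image_insert_eq, Set.image_insert_eq, Set.image_singleton, funRep_T1, funRep_Y,
    funRep_conj_ZInv]

/-- The isomorphism of the operator algebra with the DAHA. -/
def opAlgebraEquiv : opAlgebra a b c d q ≃ₐ[ℂ] Daha a b c d q :=
  ((AlgEquiv.ofInjective h.funRep h.funRep_injective).trans
    (Subalgebra.equivOfEq _ _ h.funRep_range)).symm

theorem opAlgebraEquiv_symm_apply (x : Daha a b c d q) :
    (h.opAlgebraEquiv.symm x : Module.End ℂ (ℤ → ℂ)) = h.funRep x := rfl

end Admissible

end

section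
/-! ### Infinite `q`-shifted factorials -/

section QPoch

variable {q : ℂ}

theorem summable_norm_neg_mul_pow (hq : ‖q‖ < 1) (x : ℂ) :
    Summable fun j : ℕ => ‖-(x * q ^ j)‖ := by
  simp only [norm_neg, norm_mul, norm_pow]
  exact (summable_geometric_of_lt_one (norm_nonneg _) hq).mul_left _

theorem multipliable_one_sub (hq : ‖q‖ < 1) (x : ℂ) : Multipliable fun j : ℕ => 1 - x * q ^ j := by
  simp only [sub_eq_add_neg]
  exact multipliable_one_add_of_summable (summable_norm_neg_mul_pow hq x)

theorem qPochInf_eq_mul (hq : ‖q‖ < 1) (x : ℂ) :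
    qPochInf x q = (1 - x) * qPochInf (q * x) q := by
  have e : ∀ j : ℕ, 1 - x * q ^ (j + 1) = 1 - q * x * q ^ j := fun j => by ring
  have h := tprod_eq_zero_mul' (f := fun j : ℕ => 1 - x * q ^ j) (by
    simp only [e]; exact multipliable_one_sub hq (q * x))
  simp only [e, pow_zero, mul_one] at h
  exact h

theorem qPochInf_ne_zero (hq : ‖q‖ < 1) {x : ℂ} (hx : ∀ j : ℕ, 1 - x * q ^ j ≠ 0) :
    qPochInf x q ≠ 0 := by
  have := tprod_one_add_ne_zero_of_summable (f := fun j : ℕ => -(x * q ^ j))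
    (fun j => by rw [← sub_eq_add_neg]; exact hx j) (summable_norm_neg_mul_pow hq x)
  simp only [← sub_eq_add_neg] at this
  exact this

theorem one_sub_mul_pow_ne_zero (hq : ‖q‖ < 1) {x : ℂ} (hx : ‖x‖ < 1) (j : ℕ) :
    1 - x * q ^ j ≠ 0 := by
  intro e
  have h1 : x * q ^ j = 1 := (sub_eq_zero.mp e).symm
  have h2 : ‖x * q ^ j‖ < 1 := by
    rw [norm_mul, norm_pow]
    calc ‖x‖ * ‖q‖ ^ j ≤ ‖x‖ * 1 := by
          gcongr
          exact pow_le_one₀ (norm_nonneg _) hq.le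
      _ < 1 := by rwa [mul_one]
  rw [h1, norm_one] at h2
  exact lt_irrefl _ h2

theorem qPochInf_ne_zero_of_norm_lt (hq : ‖q‖ < 1) {x : ℂ} (hx : ‖x‖ < 1) : qPochInf x q ≠ 0 :=
  qPochInf_ne_zero hq (one_sub_mul_pow_ne_zero hq hx)

/-- The product converges uniformly on compact sets, by comparison with a geometric series. -/
theorem differentiable_qPochInf (hq : ‖q‖ < 1) : Differentiable ℂ fun x => qPochInf x q := by
  rw [← differentiableOn_univ]
  have key : MultipliableLocallyUniformlyOn (fun (j : ℕ) (x : ℂ) => 1 - x * q ^ j) Set.univ := by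
    use fun x => ∏' j : ℕ, (1 - x * q ^ j)
    simp_rw [sub_eq_add_neg]
    apply hasProdLocallyUniformlyOn_of_forall_compact isOpen_univ
    intro K _ hcK
    obtain ⟨M, hM⟩ := hcK.isBounded.exists_norm_le
    refine ((summable_geometric_of_lt_one (norm_nonneg _) hq).mul_left M).hasProdUniformlyOn_nat_one_add
      hcK (.of_forall fun n x hx => ?_) fun _ => by fun_prop
    rw [norm_neg, norm_mul, norm_pow]
    gcongr
    exact hM x hx
  exact key.hasProdLocallyUniformlyOn.differentiableOn
    (.of_forall fun _ => by
      simpa [Finset.prod_fn] using DifferentiableOn.finsetProd (fun _ _ => by fun_prop)) isOpen_univ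

theorem conj_qPochInf {r : ℝ} (hr : ‖(r : ℂ)‖ < 1) (x : ℂ) :
    starRingEnd ℂ (qPochInf x r) = qPochInf (starRingEnd ℂ x) r := by
  rw [qPochInf, (multipliable_one_sub hr x).map_tprod _ Complex.continuous_conj, qPochInf]
  simp

end QPoch

/-! ### The square root of the weight function -/

/-- Conditions on the parameters and on `q` under which the orthogonality measure has no singular
part: no product of two different parameters equals `1`, all parameters lie in the closed unit disc,
and those on the unit circle are `1` or `-1`. -/
structure UnitDisc {ι : Type*} (t : ι → ℂ) (q : ℝ) : Prop where
  pos : 0 < q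
  lt_one : q < 1
  norm_le : ∀ i, ‖t i‖ ≤ 1
  eq_or : ∀ i, ‖t i‖ = 1 → t i = 1 ∨ t i = -1
  mul_ne_one : ∀ i j, i ≠ j → t i * t j ≠ 1

section Rho

variable {ι : Type*} [Fintype ι] {t : ι → ℂ} {q : ℝ}

open Classical in
/-- The quotient `(1 - z²) / ∏ (1 - t_i z)`, with the common factors cancelled. -/
def rhoZero (t : ι → ℂ) (z : ℂ) : ℂ :=
  (if ∃ i, t i = 1 then 1 else 1 - z) * (if ∃ i, t i = -1 then 1 else 1 + z) *
    ∏ i, if t i = 1 ∨ t i = -1 then 1 else (1 - t i * z)⁻¹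

/-- The quotient `(z²;q)_∞ / ∏ (t_i z;q)_∞`, extended continuously to the closed unit disc. -/
def rho (t : ι → ℂ) (q : ℝ) (z : ℂ) : ℂ :=
  rhoZero t z * (qPochInf (q * z ^ 2) q / ∏ i, qPochInf (q * (t i * z)) q)

open Classical in
theorem prod_ite_eq_ite_exists {s : ℂ} (hs : ∀ i j, t i = s → t j = s → i = j) (x : ℂ) :
    ∏ i, (if t i = s then x else 1) = if ∃ i, t i = s then x else 1 := by
  by_cases h : ∃ i, t i = s
  · obtain ⟨i, hi⟩ := h
    rw [if_pos ⟨i, hi⟩, Finset.prod_eq_single i, if_pos hi]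
    · intro j _ hj
      rw [if_neg fun e => hj (hs j i e hi)]
    · exact fun h => (h (mem_univ i)).elim
  · rw [if_neg h]
    exact prod_eq_one fun i _ => if_neg fun e => h ⟨i, e⟩

namespace UnitDisc

variable (h : UnitDisc t q)
include h

omit [Fintype ι] in
theorem norm_q_lt : ‖(q : ℂ)‖ < 1 := by
  rw [Complex.norm_real, Real.norm_eq_abs, abs_of_pos h.pos]; exact h.lt_one

omit [Fintype ι] in
theorem norm_q_mul_lt {x : ℂ} (hx : ‖x‖ ≤ 1) : ‖(q : ℂ) * x‖ < 1 := by
  rw [norm_mul]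
  calc ‖(q : ℂ)‖ * ‖x‖ ≤ ‖(q : ℂ)‖ * 1 := by gcongr
    _ < 1 := by rw [mul_one]; exact h.norm_q_lt

omit [Fintype ι] in
theorem norm_mul_le {z : ℂ} (hz : ‖z‖ ≤ 1) (i : ι) : ‖t i * z‖ ≤ 1 := by
  rw [norm_mul]; exact mul_le_one₀ (h.norm_le i) (norm_nonneg _) hz

omit [Fintype ι] in
theorem one_sub_mul_ne_zero {z : ℂ} (hz : ‖z‖ ≤ 1) {i : ι} (hi : ¬ (t i = 1 ∨ t i = -1)) :
    1 - t i * z ≠ 0 := by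
  intro e
  have h1 : t i * z = 1 := (sub_eq_zero.mp e).symm
  have h2 : ‖t i‖ * ‖z‖ = 1 := by rw [← norm_mul, h1, norm_one]
  have h3 : ‖t i‖ < 1 := lt_of_le_of_ne (h.norm_le i) fun e => hi (h.eq_or i e)
  nlinarith [norm_nonneg (t i), norm_nonneg z]

theorem prod_qPochInf_ne_zero {z : ℂ} (hz : ‖z‖ ≤ 1) : ∏ i, qPochInf (q * (t i * z)) q ≠ 0 :=
  prod_ne_zero_iff.mpr fun i _ =>
    qPochInf_ne_zero_of_norm_lt h.norm_q_lt (h.norm_q_mul_lt (h.norm_mul_le hz i))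

/-- At most one parameter equals `1` and at most one equals `-1`, since products of two different
parameters are not `1`. So every boundary zero of the denominator is a simple factor of `1 - z²`. -/
theorem rhoZero_mul_prod (z : ℂ) (hz : ‖z‖ ≤ 1) :
    rhoZero t z * ∏ i, (1 - t i * z) = 1 - z ^ 2 := by
  classical
  have u1 : ∀ i j, t i = 1 → t j = 1 → i = j := fun i j hi hj => by
    by_contra hij
    exact h.mul_ne_one i j hij (by rw [hi, hj, one_mul])
  have u2 : ∀ i j, t i = -1 → t j = -1 → i = j := fun i j hi hj => by
    by_contra hij
    exact h.mul_ne_one i j hij (by rw [hi, hj]; norm_num)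
  have e : ∀ i, (if t i = 1 ∨ t i = -1 then 1 else (1 - t i * z)⁻¹) * (1 - t i * z) =
      (if t i = 1 then 1 - z else 1) * (if t i = -1 then 1 + z else 1) := by
    intro i
    by_cases h1 : t i = 1
    · rw [if_pos (Or.inl h1), if_pos h1, if_neg (by rw [h1]; norm_num), h1]; ring
    by_cases h2 : t i = -1
    · rw [if_pos (Or.inr h2), if_neg h1, if_pos h2, h2]; ring
    have h3 : ¬ (t i = 1 ∨ t i = -1) := not_or.mpr ⟨h1, h2⟩
    rw [if_neg h3, if_neg h1, if_neg h2, inv_mul_cancel₀ (h.one_sub_mul_ne_zero hz h3), one_mul]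
  rw [rhoZero, mul_assoc, ← prod_mul_distrib, prod_congr rfl fun i _ => e i, prod_mul_distrib,
    prod_ite_eq_ite_exists u1, prod_ite_eq_ite_exists u2]
  split_ifs <;> ring

theorem differentiableAt_rhoZero {z : ℂ} (hz : ‖z‖ ≤ 1) : DifferentiableAt ℂ (rhoZero t) z := by
  classical
  unfold rhoZero
  refine DifferentiableAt.mul (DifferentiableAt.mul ?_ ?_) ?_
  · split_ifs <;> fun_prop
  · split_ifs <;> fun_prop
  · refine DifferentiableAt.fun_finsetProd fun i _ => ?_
    split_ifs with hi
    · fun_prop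
    · exact DifferentiableAt.inv (by fun_prop) (h.one_sub_mul_ne_zero hz hi)

theorem differentiableAt_rho {z : ℂ} (hz : ‖z‖ ≤ 1) : DifferentiableAt ℂ (rho t q) z := by
  have hP := differentiable_qPochInf h.norm_q_lt
  refine (h.differentiableAt_rhoZero hz).mul (DifferentiableAt.div ?_ ?_ ?_)
  · exact (hP _).comp z (f := fun z => (q : ℂ) * z ^ 2) (by fun_prop)
  · refine DifferentiableAt.fun_finsetProd fun i _ => ?_
    exact (hP _).comp z (f := fun z => (q : ℂ) * (t i * z)) (by fun_prop)
  · exact h.prod_qPochInf_ne_zero hz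

theorem rho_mul_prod {z : ℂ} (hz : ‖z‖ ≤ 1) :
    rho t q z * ∏ i, qPochInf (t i * z) q = qPochInf (z ^ 2) q := by
  have e : ∏ i, qPochInf (t i * z) q = (∏ i, (1 - t i * z)) * ∏ i, qPochInf (q * (t i * z)) q := by
    rw [← prod_mul_distrib]
    exact prod_congr rfl fun i _ => qPochInf_eq_mul h.norm_q_lt _
  rw [e, qPochInf_eq_mul h.norm_q_lt (z ^ 2), ← h.rhoZero_mul_prod z hz, rho]
  have h0 := h.prod_qPochInf_ne_zero hz
  generalize ∏ i, qPochInf (q * (t i * z)) q = D at *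
  generalize ∏ i, (1 - t i * z) = D'
  field_simp

/-- The functional equation of the weight under `z ↦ qz`, free of denominators. It converts the
shifted contour integrand back to the density. -/
theorem rho_q_mul {z : ℂ} (hz : ‖z‖ ≤ 1) :
    rho t q (q * z) * ((1 - z ^ 2) * (1 - q * z ^ 2)) = rho t q z * ∏ i, (1 - t i * z) := by
  have hz' := (h.norm_q_mul_lt hz).le
  have h0 := h.prod_qPochInf_ne_zero hz
  have e1 := h.rho_mul_prod hz'
  have e2 : ∏ i, qPochInf (t i * (q * z)) q = ∏ i, qPochInf (q * (t i * z)) q :=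
    prod_congr rfl fun i _ => by rw [mul_left_comm]
  have e3 : qPochInf (q * z ^ 2) q = (1 - q * z ^ 2) * qPochInf ((q * z) ^ 2) q := by
    rw [qPochInf_eq_mul h.norm_q_lt]; congr 2; ring
  have e4 := h.rhoZero_mul_prod z hz
  have e5 : rho t q z * ∏ i, qPochInf (q * (t i * z)) q = rhoZero t z * qPochInf (q * z ^ 2) q := by
    rw [rho, mul_assoc, div_mul_cancel₀ _ h0]
  rw [e2] at e1
  apply mul_right_cancel₀ h0
  generalize ∏ i, qPochInf (q * (t i * z)) q = D at *
  linear_combination (1 - z ^ 2) * (1 - q * z ^ 2) * e1 - (∏ i, (1 - t i * z)) * e5 -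
    qPochInf (q * z ^ 2) q * e4 - (1 - z ^ 2) * e3

end UnitDisc

end Rho

end

section
/-! ### Contour integrals -/

section Contour

open MeasureTheory Metric

/-- The integral of a function over the circle of radius `r` with respect to the angle. -/
def circInt (r : ℝ) (F : ℂ → ℂ) : ℂ := ∫ θ in (0 : ℝ)..2 * Real.pi, F (circleMap 0 r θ)

/-- The map `z ↦ r/z` sends the unit circle to the circle of radius `r` with the angle reversed;
periodicity restores the interval. -/
theorem circInt_comp_div (r : ℝ) (F : ℂ → ℂ) :
    circInt 1 (fun z => F (r * z⁻¹)) = circInt r F := by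
  have e : ∀ θ : ℝ, (r : ℂ) * (circleMap 0 1 θ)⁻¹ = circleMap 0 r (-θ) := by
    intro θ
    simp [circleMap, Complex.exp_neg]
  have hp : Function.Periodic (fun θ : ℝ => F (circleMap 0 r θ)) (2 * Real.pi) := fun θ =>
    congrArg F (periodic_circleMap 0 r θ)
  have h := hp.intervalIntegral_add_eq (-(2 * Real.pi)) 0
  rw [neg_add_cancel, zero_add] at h
  simp only [circInt, e]
  rw [intervalIntegral.integral_comp_neg (fun θ => F (circleMap 0 r θ)), neg_zero]
  exact h

theorem circInt_comp_inv (F : ℂ → ℂ) : circInt 1 (fun z => F z⁻¹) = circInt 1 F := by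
  have := circInt_comp_div 1 F
  simpa using this

/-- Cauchy's theorem for `F(z)/z` on the annulus. -/
theorem circInt_eq_of_differentiable {r : ℝ} (h0 : 0 < r) (h1 : r ≤ 1) {F : ℂ → ℂ}
    (hF : ∀ z, r ≤ ‖z‖ → ‖z‖ ≤ 1 → DifferentiableAt ℂ F z) : circInt 1 F = circInt r F := by
  have h := Complex.circleIntegral_sub_center_inv_smul_eq_of_differentiable_on_annulus_off_countable
    (c := 0) h0 h1 (f := F) Set.countable_empty
    (fun z hz => (hF z (by simpa using hz.2) (by simpa using hz.1)).continuousAt.continuousWithinAt)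
    (fun z hz => hF z (by have := hz.1.2; simp at this; exact this.le)
      (by have := hz.1.1; simp at this; exact this.le))
  have e : ∀ s : ℝ, s ≠ 0 → (∮ z in C(0, s), (z - 0)⁻¹ • F z) = Complex.I * circInt s F := by
    intro s hs
    rw [circleIntegral, circInt, ← intervalIntegral.integral_const_mul]
    refine intervalIntegral.integral_congr fun θ _ => ?_
    have : circleMap 0 s θ ≠ 0 := circleMap_ne_center hs
    simp only [deriv_circleMap, sub_zero, smul_eq_mul]
    field_simp
  rw [e 1 one_ne_zero, e r h0.ne'] at h
  exact mul_left_cancel₀ Complex.I_ne_zero h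

/-- The points `±1` form a null set. There the quotient in the weight can be `0/0`, with value `0`,
whereas `ρ` takes the continuous value. -/
theorem circInt_congr {F G : ℂ → ℂ} (h : ∀ z, ‖z‖ = 1 → z ≠ 1 → z ≠ -1 → F z = G z) :
    circInt 1 F = circInt 1 G := by
  have hc : (circleMap 0 1 ⁻¹' {1, -1}).Countable :=
    (Set.toFinite ({1, -1} : Set ℂ)).countable.preimage_circleMap 0 one_ne_zero
  refine intervalIntegral.integral_congr_ae ?_
  have hae : ∀ᵐ θ : ℝ, θ ∉ circleMap 0 1 ⁻¹' {1, -1} := hc.ae_notMem _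
  filter_upwards [hae] with θ hθ _
  simp only [Set.mem_preimage, Set.mem_insert_iff, Set.mem_singleton_iff, not_or] at hθ
  exact h _ (by simp) hθ.1 hθ.2

theorem intervalIntegrable_comp_circleMap {F : ℂ → ℂ} (hF : ∀ z, ‖z‖ = 1 → ContinuousAt F z) :
    IntervalIntegrable (fun θ => F (circleMap 0 1 θ)) volume 0 (2 * Real.pi) := by
  refine Continuous.intervalIntegrable (continuous_iff_continuousAt.mpr fun θ => ?_) _ _
  exact ContinuousAt.comp (hF _ (by simp)) (continuous_circleMap 0 1).continuousAt

theorem circInt_add {F G : ℂ → ℂ} (hF : ∀ z, ‖z‖ = 1 → ContinuousAt F z)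
    (hG : ∀ z, ‖z‖ = 1 → ContinuousAt G z) :
    circInt 1 (fun z => F z + G z) = circInt 1 F + circInt 1 G :=
  intervalIntegral.integral_add (intervalIntegrable_comp_circleMap hF)
    (intervalIntegrable_comp_circleMap hG)

theorem circInt_const_mul (r : ℂ) (F : ℂ → ℂ) :
    circInt 1 (fun z => r * F z) = r * circInt 1 F :=
  intervalIntegral.integral_const_mul _ _

end Contour

/-! ### The moment functional -/

section Moment

variable {ι : Type*} [Fintype ι] {t : ι → ℂ} {q : ℝ}

theorem ne_zero_of_norm_eq_one {z : ℂ} (hz : ‖z‖ = 1) : z ≠ 0 :=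
  norm_ne_zero_iff.mp (by rw [hz]; exact one_ne_zero)

theorem continuousAt_evalAt (f : ℂ[T;T⁻¹]) {z : ℂ} (hz : z ≠ 0) : ContinuousAt (evalAt f) z :=
  (differentiableAt_evalAt f hz).continuousAt

theorem UnitDisc.differentiableAt_rho_inv (h : UnitDisc t q) {z : ℂ} (hz : q ≤ ‖z‖) :
    DifferentiableAt ℂ (fun z => rho t q (q * z⁻¹)) z := by
  have hpos : 0 < ‖z‖ := h.pos.trans_le hz
  have h0 : z ≠ 0 := norm_pos_iff.mp hpos
  refine (h.differentiableAt_rho ?_).comp z (f := fun z => (q : ℂ) * z⁻¹) ?_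
  · rw [norm_mul, norm_inv, Complex.norm_real, Real.norm_eq_abs, abs_of_pos h.pos,
      ← div_eq_mul_inv, div_le_one hpos]
    exact hz
  · exact (differentiableAt_inv h0).const_mul _

/-- The density of the orthogonality measure on the unit circle, up to a constant factor. -/
def density (t : ι → ℂ) (q : ℝ) (z : ℂ) : ℂ := rho t q z * rho t q z⁻¹

theorem UnitDisc.continuousAt_density (h : UnitDisc t q) {z : ℂ} (hz : ‖z‖ = 1) :
    ContinuousAt (density t q) z := by
  have h0 := ne_zero_of_norm_eq_one hz
  refine (h.differentiableAt_rho hz.le).continuousAt.mul ?_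
  exact ContinuousAt.comp (h.differentiableAt_rho (by rw [norm_inv, hz, inv_one])).continuousAt
    (continuousAt_inv₀ h0)

/-- Integration of Laurent polynomials against the orthogonality measure, up to a constant
factor. -/
def moment (h : UnitDisc t q) : ℂ[T;T⁻¹] →ₗ[ℂ] ℂ where
  toFun f := circInt 1 fun z => density t q z * evalAt f z
  map_add' f g := by
    rw [← circInt_add]
    · refine circInt_congr fun z hz _ _ => ?_
      rw [evalAt_add _ _ (ne_zero_of_norm_eq_one hz), mul_add]
    · exact fun z hz => (h.continuousAt_density hz).mul
        (continuousAt_evalAt f (ne_zero_of_norm_eq_one hz))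
    · exact fun z hz => (h.continuousAt_density hz).mul
        (continuousAt_evalAt g (ne_zero_of_norm_eq_one hz))
  map_smul' r f := by
    rw [RingHom.id_apply, smul_eq_mul, ← circInt_const_mul]
    refine circInt_congr fun z hz _ _ => ?_
    rw [evalAt_smul _ _ (ne_zero_of_norm_eq_one hz), mul_left_comm]

theorem moment_apply (h : UnitDisc t q) (f : ℂ[T;T⁻¹]) :
    moment h f = circInt 1 fun z => density t q z * evalAt f z := rfl

variable (t q) in
/-- The kernel whose integral over the unit circle vanishes by a shift of the contour. -/
def shiftKernel (P : ℂ[T;T⁻¹]) (z : ℂ) : ℂ :=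
  rho t q z * rho t q (q * z⁻¹) * (evalAt P z - evalAt P (q * z⁻¹))

theorem UnitDisc.continuousAt_shiftKernel (h : UnitDisc t q) (P : ℂ[T;T⁻¹]) {z : ℂ}
    (hz : ‖z‖ = 1) : ContinuousAt (shiftKernel t q P) z := by
  have h0 := ne_zero_of_norm_eq_one hz
  have hq : (q : ℂ) ≠ 0 := Complex.ofReal_ne_zero.mpr h.pos.ne'
  refine ((h.differentiableAt_rho hz.le).continuousAt.mul
    (h.differentiableAt_rho_inv (by rw [hz]; exact h.lt_one.le)).continuousAt).mul
    ((continuousAt_evalAt P h0).sub ?_)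
  exact ContinuousAt.comp (f := fun z => (q : ℂ) * z⁻¹)
    (continuousAt_evalAt P (mul_ne_zero hq (inv_ne_zero h0)))
    ((continuousAt_inv₀ h0).const_mul _)

/-- With `H(z) = ρ(z) ρ(q/z) P(z)` the kernel is `H(z) - H(q/z)`. The second integral is that of `H`
over radius `q`, and `H` is holomorphic on the closed annulus in between. -/
theorem UnitDisc.circInt_shiftKernel (h : UnitDisc t q) (P : ℂ[T;T⁻¹]) :
    circInt 1 (shiftKernel t q P) = 0 := by
  have hq : (q : ℂ) ≠ 0 := Complex.ofReal_ne_zero.mpr h.pos.ne'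
  set H : ℂ → ℂ := fun z => rho t q z * rho t q (q * z⁻¹) * evalAt P z with hH
  have hd : ∀ z, q ≤ ‖z‖ → ‖z‖ ≤ 1 → DifferentiableAt ℂ H z := by
    intro z h1 h2
    exact ((h.differentiableAt_rho h2).mul (h.differentiableAt_rho_inv h1)).mul
      (differentiableAt_evalAt P (norm_pos_iff.mp (h.pos.trans_le h1)))
  have hc : ∀ z, ‖z‖ = 1 → ContinuousAt H z := fun z hz =>
    (hd z (by rw [hz]; exact h.lt_one.le) hz.le).continuousAt
  have hc' : ∀ z, ‖z‖ = 1 → ContinuousAt (fun z => -1 * H (q * z⁻¹)) z := by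
    intro z hz
    have h0 := ne_zero_of_norm_eq_one hz
    have hn : ‖(q : ℂ) * z⁻¹‖ = q := by
      rw [norm_mul, norm_inv, hz, inv_one, mul_one, Complex.norm_real, Real.norm_eq_abs,
        abs_of_pos h.pos]
    refine ContinuousAt.const_mul (ContinuousAt.comp (g := H) (f := fun z => (q : ℂ) * z⁻¹) ?_
      ((continuousAt_inv₀ h0).const_mul _)) _
    exact (hd _ (by rw [hn]) (by rw [hn]; exact h.lt_one.le)).continuousAt
  have e : circInt 1 (shiftKernel t q P) = circInt 1 fun z => H z + -1 * H (q * z⁻¹) := by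
    refine circInt_congr fun z hz _ _ => ?_
    have h0 := ne_zero_of_norm_eq_one hz
    have : (q : ℂ) * (q * z⁻¹)⁻¹ = z := by field_simp
    simp only [shiftKernel, hH, this]
    ring
  rw [e, circInt_add hc hc', circInt_const_mul, circInt_comp_div q H,
    circInt_eq_of_differentiable h.pos h.lt_one.le hd]
  ring

end Moment

/-! ### Self-adjointness of `T₀` -/

section Adjoint

variable {a b c d : ℂ} {q : ℝ}

/-- The first component antisymmetrizes over `z ↦ z⁻¹`. In each half the functional equation of `ρ`
replaces `ρ(z⁻¹)` by `ρ(q/z)`, or `ρ(z)` by `ρ(qz)`, and absorbs all four linear factors. -/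
theorem density_mul_vecFst (h : UnitDisc ![a, b, c, d] q) (hab : a * b ≠ 1) {u P : ℂ[T;T⁻¹]}
    (hu : (C (q : ℂ) - T 2) * u = (C c - T 1) * (C d - T 1) * (P - qinv q P)) {z : ℂ}
    (hz : ‖z‖ = 1) (h1 : z ≠ 1) (h2 : z ≠ -1) :
    (1 - a * b) * (density ![a, b, c, d] q z * evalAt (vecFst a b u) z) =
      -1 * (shiftKernel ![a, b, c, d] q P z + shiftKernel ![a, b, c, d] q P z⁻¹) := by
  have h0 := ne_zero_of_norm_eq_one hz
  have hq : (q : ℂ) ≠ 0 := Complex.ofReal_ne_zero.mpr h.pos.ne'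
  have hzi : ‖z⁻¹‖ = 1 := by rw [norm_inv, hz, inv_one]
  have hi0 := inv_ne_zero h0
  have hxx : 1 - z ^ 2 ≠ 0 := by
    rw [show 1 - z ^ 2 = (1 - z) * (1 + z) by ring]
    refine mul_ne_zero (sub_ne_zero.mpr h1.symm) fun e => h2 (by linear_combination e)
  have hyy : 1 - z⁻¹ ^ 2 ≠ 0 := by
    rw [show 1 - z⁻¹ ^ 2 = -(z⁻¹ ^ 2) * (1 - z ^ 2) by field_simp; ring]
    exact mul_ne_zero (neg_ne_zero.mpr (pow_ne_zero 2 hi0)) hxx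
  have hqq : ∀ w : ℂ, ‖w‖ = 1 → 1 - (q : ℂ) * w ^ 2 ≠ 0 := by
    intro w hw e
    have h3 : ‖(q : ℂ) * w ^ 2‖ < 1 := h.norm_q_mul_lt (by rw [norm_pow, hw, one_pow])
    rw [← sub_eq_zero.mp e, norm_one] at h3
    exact lt_irrefl _ h3
  have hqx := hqq z hz
  have hqy := hqq _ hzi
  have E1 := congrArg (fun f => evalAt f z) (mul_vecFst hab u)
  have E2 := congrArg (fun f => evalAt f z) hu
  have E3 := congrArg (fun f => evalAt f z⁻¹) hu
  have R1 := h.rho_q_mul hz.le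
  have R2 := h.rho_q_mul hzi.le
  simp only [evalAt_mul _ _ h0, evalAt_sub _ _ h0, evalAt_one h0, evalAt_C _ h0, evalAt_T _ h0,
    evalAt_reflect _ h0, evalAt_qinv hq _ h0] at E1 E2
  simp only [evalAt_mul _ _ hi0, evalAt_sub _ _ hi0, evalAt_C _ hi0, evalAt_T _ hi0,
    evalAt_qinv hq _ hi0] at E3
  simp only [Fin.prod_univ_four, Matrix.cons_val] at R1 R2
  simp only [shiftKernel, density, inv_inv]
  rw [div_eq_mul_inv] at E2 E3
  rw [inv_inv] at E3
  have hxy : z * z⁻¹ = 1 := mul_inv_cancel₀ h0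
  simp only [zpow_ofNat, pow_one] at E1 E2 E3
  generalize z⁻¹ = y at *
  generalize rho ![a, b, c, d] q z = ρx at *
  generalize rho ![a, b, c, d] q y = ρy at *
  generalize rho ![a, b, c, d] q (q * z) = ρqx at *
  generalize rho ![a, b, c, d] q (q * y) = ρqy at *
  generalize evalAt P z - evalAt P (q * y) = Δ at *
  generalize evalAt P y - evalAt P (q * z) = Δ' at *
  generalize evalAt u z = U at *
  generalize evalAt u y = U' at *
  generalize evalAt (vecFst a b u : ℂ[T;T⁻¹]) z = V at *
  -- `y` stands for `z⁻¹`; `Δ` and `Δ'` are the differences `P(w) - P(q/w)` at `w = z` and `w = y`.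
  have A : (1 - q * y ^ 2) * U = -((1 - c * y) * (1 - d * y) * Δ) := by
    linear_combination (-y ^ 2) * E2 + (-(z * y + 1) * U - (z * y + 1 - (c + d) * y) * Δ) * hxy
  have A' : (1 - q * z ^ 2) * U' = -((1 - c * z) * (1 - d * z) * Δ') := by
    linear_combination (-z ^ 2) * E3 + (-(z * y + 1) * U' - (z * y + 1 - (c + d) * z) * Δ') * hxy
  have B : (1 - a * b) * ((1 - z ^ 2) * (1 - y ^ 2)) * V =
      (1 - z ^ 2) * ((1 - a * y) * (1 - b * y) * U) +
        (1 - y ^ 2) * ((1 - a * z) * (1 - b * z) * U') := by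
    have e1 : (z - a) * (z - b) = z ^ 2 * ((1 - a * y) * (1 - b * y)) := by
      linear_combination (-(a * b) * (z * y + 1) + (a + b) * z) * hxy
    have e2 : z ^ 2 * (1 - y ^ 2) = -(1 - z ^ 2) := by
      linear_combination (-(z * y + 1)) * hxy
    rw [e1] at E1
    linear_combination (-(1 - y ^ 2)) * E1 - (1 - a * y) * (1 - b * y) * U * e2
  -- `A` supplies the factors of `c` and `d`, the left side those of `a` and `b`; the product of all
  -- four is the one in `R2`.
  have D : ρy * ((1 - a * y) * (1 - b * y) * U) = -(ρqy * (1 - y ^ 2) * Δ) := by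
    apply mul_left_cancel₀ hqy
    linear_combination ρy * (1 - a * y) * (1 - b * y) * A + Δ * R2
  have D' : ρx * ((1 - a * z) * (1 - b * z) * U') = -(ρqx * (1 - z ^ 2) * Δ') := by
    apply mul_left_cancel₀ hqx
    linear_combination ρx * (1 - a * z) * (1 - b * z) * A' + Δ' * R1
  apply mul_left_cancel₀ (mul_ne_zero hxx hyy)
  linear_combination ρx * ρy * B + ρx * (1 - z ^ 2) * D + ρy * (1 - y ^ 2) * D'

theorem moment_vecFst_eq_zero (h : UnitDisc ![a, b, c, d] q) (hab : a * b ≠ 1) {u P : ℂ[T;T⁻¹]}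
    (hu : (C (q : ℂ) - T 2) * u = (C c - T 1) * (C d - T 1) * (P - qinv q P)) :
    moment h (vecFst a b u) = 0 := by
  have hc := fun z hz => h.continuousAt_shiftKernel P (z := z) hz
  have hc' : ∀ z, ‖z‖ = 1 → ContinuousAt (fun z => shiftKernel ![a, b, c, d] q P z⁻¹) z := by
    intro z hz
    exact ContinuousAt.comp (g := shiftKernel ![a, b, c, d] q P)
      (hc _ (by rw [norm_inv, hz, inv_one])) (continuousAt_inv₀ (ne_zero_of_norm_eq_one hz))
  have e : (1 - a * b) * moment h (vecFst a b u) = 0 := by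
    rw [moment_apply, ← circInt_const_mul,
      circInt_congr fun z hz h1 h2 => density_mul_vecFst h hab hu hz h1 h2, circInt_const_mul,
      circInt_add hc hc', circInt_comp_inv, h.circInt_shiftKernel]
    ring
  exact (mul_eq_zero.mp e).resolve_left (sub_ne_zero.mpr hab.symm)

/-- In `T₀ f * g - f * T₀ g` the multiplication terms cancel. What remains is `(c - z)(d - z)(P -
P[q/z]) / (q - z²)` with `P = f[z] g[q/z]`. -/
theorem moment_vecFst_opT0 (h : UnitDisc ![a, b, c, d] q) (hab : a * b ≠ 1) (f g : ℂ[T;T⁻¹]) :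
    moment h (vecFst a b (opT0 c d q f * g)) = moment h (vecFst a b (f * opT0 c d q g)) := by
  have hq : (q : ℂ) ≠ 0 := Complex.ofReal_ne_zero.mpr h.pos.ne'
  rw [← sub_eq_zero, ← map_sub, ← Submodule.coe_sub, ← map_sub]
  refine moment_vecFst_eq_zero h hab (P := f * qinv q g) ?_
  have e1 := mul_opT0 c d q f
  have e2 := mul_opT0 c d q g
  rw [qinv_mul hq, qinv_qinv hq]
  linear_combination g * e1 - f * e2

end Adjoint

end

section
/-! ### The transform in terms of the moment functional -/

section VecFst

variable {a b : ℂ} (ha : a ≠ 0) (hab : a * b ≠ 1)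

/-- The identity `key` says that `qAux` has zero first component, so the mixed terms drop out. As
`qAux + reflect qAux` is symmetric, `qAux² = (qAux + reflect qAux) qAux - qAux * reflect qAux`
contributes only its last term. -/
theorem vecFst_ofVec_mul_ofVec (hab : a * b ≠ 1) (u v : Vec2) :
    (vecFst a b (ofVec a b u * ofVec a b v) : ℂ[T;T⁻¹]) =
      u.1 * v.1 - qAux a b * reflect (qAux a b) * (u.2 * v.2) := by
  have h := mul_vecFst hab (ofVec a b u * ofVec a b v)
  have r1 : reflect (u.1 : ℂ[T;T⁻¹]) = u.1 := u.1.2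
  have r2 : reflect (u.2 : ℂ[T;T⁻¹]) = u.2 := u.2.2
  have r3 : reflect (v.1 : ℂ[T;T⁻¹]) = v.1 := v.1.2
  have r4 : reflect (v.2 : ℂ[T;T⁻¹]) = v.2 := v.2.2
  have hne : (C (a * b - 1) * (1 - T 2) : ℂ[T;T⁻¹]) ≠ 0 :=
    mul_ne_zero (AskeyWilson.C_ne_zero.mpr (sub_ne_zero.mpr hab)) one_sub_T_two_ne_zero
  have key : (T 1 - C a) * (T 1 - C b) * qAux a b =
      (1 - C a * T 1) * (1 - C b * T 1) * reflect (qAux a b) := by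
    have e := T_neg_one_mul_T_one
    rw [reflect_qAux, qAux]
    generalize (T (-1) : ℂ[T;T⁻¹]) = s at *
    generalize (T 1 : ℂ[T;T⁻¹]) = t at *
    generalize (C a : ℂ[T;T⁻¹]) = A at *
    generalize (C b : ℂ[T;T⁻¹]) = B at *
    linear_combination A * (1 - A * t) * (1 - B * t) * (t - A * B * s) * e
  apply mul_left_cancel₀ hne
  rw [h, ofVec_apply, ofVec_apply, reflect_mul, map_add, map_add, reflect_mul, reflect_mul, r1, r2,
    r3, r4, T_two_eq]
  generalize reflect (qAux a b) = k' at *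
  generalize qAux a b = k at *
  simp only [map_sub, map_mul, map_one]
  generalize (u.1 : ℂ[T;T⁻¹]) = u1
  generalize (u.2 : ℂ[T;T⁻¹]) = u2
  generalize (v.1 : ℂ[T;T⁻¹]) = v1
  generalize (v.2 : ℂ[T;T⁻¹]) = v2
  linear_combination (u1 * v2 + u2 * v1 + (k + k') * u2 * v2) * key

include ha hab in
-- The form on vectors is diagonal, and `T₁` multiplies each component by a scalar.
theorem vecFst_opT1_mul (f g : ℂ[T;T⁻¹]) :
    vecFst a b (opT1 a b f * g) = vecFst a b (f * opT1 a b g) := by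
  apply Subtype.ext
  rw [← ofVec_vec ha hab f, ← ofVec_vec ha hab g, opT1_ofVec, opT1_ofVec,
    vecFst_ofVec_mul_ofVec hab, vecFst_ofVec_mul_ofVec hab]
  simp only [Submodule.coe_smul, Submodule.coe_neg, smul_eq]
  ring

include ha hab in
theorem vecFst_opT1Inv_mul (f g : ℂ[T;T⁻¹]) :
    vecFst a b (opT1Inv a b f * g) = vecFst a b (f * opT1Inv a b g) := by
  rw [opT1Inv_apply, opT1Inv_apply, sub_mul, mul_sub, map_sub, map_sub, smul_mul_assoc,
    smul_mul_assoc, mul_smul_comm, mul_smul_comm, map_smul, map_smul, map_smul,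
    vecFst_opT1_mul ha hab]

end VecFst

section Weight

variable {a b c d : ℂ} {q : ℝ}

/-- The constant factor of the weight function. -/
def weightConst (a b c d q : ℂ) : ℂ :=
  (qPochInf q q * qPochInf (a * b) q * qPochInf (a * c) q * qPochInf (a * d) q *
      qPochInf (b * c) q * qPochInf (b * d) q * qPochInf (c * d) q) /
    (4 * (Real.pi : ℂ) * qPochInf (a * b * c * d) q)

/-- The squared modulus is made holomorphic: on the circle `conj z = z⁻¹`, and conjugation fixes `q`
and permutes the parameters. -/
theorem weight_eq (hq : ‖(q : ℂ)‖ < 1) (ha : starRingEnd ℂ a = a) (hb : starRingEnd ℂ b = b)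
    (hcd : (starRingEnd ℂ c = c ∧ starRingEnd ℂ d = d) ∨ d = starRingEnd ℂ c) {z : ℂ}
    (hz : ‖z‖ = 1) : weight a b c d q z = weightConst a b c d q *
      (qPochInf (z ^ 2) q / (qPochInf (a * z) q * qPochInf (b * z) q * qPochInf (c * z) q *
        qPochInf (d * z) q) * (qPochInf (z⁻¹ ^ 2) q / (qPochInf (a * z⁻¹) q *
          qPochInf (b * z⁻¹) q * qPochInf (c * z⁻¹) q * qPochInf (d * z⁻¹) q))) := by
  have hzi : z⁻¹ = starRingEnd ℂ z := Complex.inv_eq_conj hz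
  rw [weight, weightConst, hzi]
  congr 1
  push_cast
  rw [← Complex.mul_conj']
  congr 1
  simp only [map_div₀, map_mul, conj_qPochInf hq, map_pow, ha, hb]
  rcases hcd with ⟨hc, hd⟩ | hd
  · rw [hc, hd]
  · subst hd
    rw [Complex.conj_conj, mul_right_comm (_ * _)]

theorem UnitDisc.qPochInf_ne_zero_of_ne {ι : Type*} {t : ι → ℂ} (h : UnitDisc t q)
    {z : ℂ} (hz : ‖z‖ = 1) (h1 : z ≠ 1) (h2 : z ≠ -1) (i : ι) :
    1 - t i * z ≠ 0 ∧ qPochInf (t i * z) q ≠ 0 := by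
  have h3 : 1 - t i * z ≠ 0 := by
    by_cases hi : t i = 1 ∨ t i = -1
    · rcases hi with hi | hi <;> rw [hi]
      · rw [one_mul]; exact sub_ne_zero.mpr h1.symm
      · intro e; exact h2 (by linear_combination e)
    · exact h.one_sub_mul_ne_zero hz.le hi
  refine ⟨h3, ?_⟩
  rw [qPochInf_eq_mul h.norm_q_lt]
  exact mul_ne_zero h3 (qPochInf_ne_zero_of_norm_lt h.norm_q_lt
    (h.norm_q_mul_lt (h.norm_mul_le hz.le i)))

theorem UnitDisc.div_eq_rho (h : UnitDisc ![a, b, c, d] q) {z : ℂ} (hz : ‖z‖ = 1) (h1 : z ≠ 1)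
    (h2 : z ≠ -1) :
    qPochInf (z ^ 2) q / (qPochInf (a * z) q * qPochInf (b * z) q * qPochInf (c * z) q *
      qPochInf (d * z) q) = rho ![a, b, c, d] q z ∧
    qPochInf (z ^ 2) q / (qPochInf (q * a * z) q * qPochInf (q * b * z) q * qPochInf (c * z) q *
      qPochInf (d * z) q) = (1 - a * z) * (1 - b * z) * rho ![a, b, c, d] q z := by
  have e := h.rho_mul_prod hz.le
  have n := h.qPochInf_ne_zero_of_ne hz h1 h2
  obtain ⟨a1, a2⟩ := n 0
  obtain ⟨b1, b2⟩ := n 1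
  obtain ⟨-, c2⟩ := n 2
  obtain ⟨-, d2⟩ := n 3
  simp only [Fin.prod_univ_four, Matrix.cons_val] at e a1 a2 b1 b2 c2 d2
  constructor
  · rw [← e, mul_div_cancel_right₀]
    exact mul_ne_zero (mul_ne_zero (mul_ne_zero a2 b2) c2) d2
  · rw [← e]
    rw [qPochInf_eq_mul h.norm_q_lt (a * z), qPochInf_eq_mul h.norm_q_lt (b * z),
      ← mul_assoc (q : ℂ), ← mul_assoc (q : ℂ)] at *
    have a3 := right_ne_zero_of_mul a2
    have b3 := right_ne_zero_of_mul b2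
    generalize qPochInf (q * a * z) q = A at *
    generalize qPochInf (q * b * z) q = B at *
    generalize qPochInf (c * z) q = C at *
    generalize qPochInf (d * z) q = D at *
    field_simp

/-- The linear factors in `C` are exactly those split off from the infinite products when `a, b` are
replaced by `qa, qb`. No nonvanishing is needed, since nothing is cancelled. -/
theorem constC_mul_weightConst (hq : ‖(q : ℂ)‖ < 1) :
    constC a b c d q * weightConst (q * a) (q * b) c d q =
      -(a ^ 3 * b) * weightConst a b c d q := by
  have p := qPochInf_eq_mul hq
  have hab : qPochInf (a * b) q = (1 - a * b) * ((1 - q * a * b) * qPochInf (q * a * (q * b)) q) := by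
    rw [p, p (q * (a * b))]; ring_nf
  have hac : qPochInf (a * c) q = (1 - a * c) * qPochInf (q * a * c) q := by rw [p]; ring_nf
  have had : qPochInf (a * d) q = (1 - a * d) * qPochInf (q * a * d) q := by rw [p]; ring_nf
  have hbc : qPochInf (b * c) q = (1 - b * c) * qPochInf (q * b * c) q := by rw [p]; ring_nf
  have hbd : qPochInf (b * d) q = (1 - b * d) * qPochInf (q * b * d) q := by rw [p]; ring_nf
  have habcd : qPochInf (a * b * c * d) q = (1 - a * b * c * d) * ((1 - q * a * b * c * d) *
      qPochInf (q * a * (q * b) * c * d) q) := by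
    rw [p, p (q * (a * b * c * d))]; ring_nf
  rw [weightConst, weightConst, constC, hab, hac, had, hbc, hbd, habcd]
  generalize qPochInf (q * a * (q * b) * c * d) q = X
  generalize 1 - a * b * c * d = X1
  generalize 1 - q * a * b * c * d = X2
  generalize qPochInf (q * a * (q * b)) q = p1
  generalize qPochInf (q * a * c) q = p2
  generalize qPochInf (q * a * d) q = p3
  generalize qPochInf (q * b * c) q = p4
  generalize qPochInf (q * b * d) q = p5
  generalize qPochInf (c * d) q = p6
  generalize qPochInf q q = p7
  generalize 1 - a * b = f1
  generalize 1 - q * a * b = f2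
  generalize 1 - a * c = f3
  generalize 1 - a * d = f4
  generalize 1 - b * c = f5
  generalize 1 - b * d = f6
  simp only [div_eq_mul_inv, mul_inv]
  ring

theorem awTransform_eq_circInt (f : Vec2) (n : ℤ) : awTransform a b c d q f n =
    circInt 1 fun z => evalVec f z ⬝ᵥ
      (matW a b c d q z).mulVec (evalVec (vecE a b c d q n) z) := by
  rw [awTransform, circleIntegral, circInt]
  refine intervalIntegral.integral_congr fun θ _ => ?_
  have : circleMap 0 1 θ ≠ 0 := circleMap_ne_center one_ne_zero
  have hI := Complex.I_ne_zero
  simp only [deriv_circleMap, smul_eq_mul]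
  field_simp

/-- The constant factor of the transform. -/
def transformConst (a b c d q : ℂ) : ℂ := -(a * b) * weightConst a b c d q

theorem awTransform_eq (h : UnitDisc ![a, b, c, d] q) (h' : Admissible a b c d q)
    (ha : starRingEnd ℂ a = a) (hb : starRingEnd ℂ b = b)
    (hcd : (starRingEnd ℂ c = c ∧ starRingEnd ℂ d = d) ∨ d = starRingEnd ℂ c) (f : Vec2) (n : ℤ) :
    awTransform a b c d q f n = transformConst a b c d q *
      moment h (vecFst a b (ofVec a b f * opT1Inv a b (polyE a b c d q n))) := by
  rw [awTransform_eq_circInt, moment_apply, ← circInt_const_mul]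
  refine circInt_congr fun z hz h1 h2 => ?_
  have h0 := ne_zero_of_norm_eq_one hz
  have hzi : ‖z⁻¹‖ = 1 := by rw [norm_inv, hz, inv_one]
  have hi1 : z⁻¹ ≠ 1 := fun e => h1 (by rw [← inv_inv z, e, inv_one])
  have hi2 : z⁻¹ ≠ -1 := fun e => h2 (by rw [← inv_inv z, e, inv_neg, inv_one])
  have hqr : starRingEnd ℂ (q : ℂ) = q := Complex.conj_ofReal q
  obtain ⟨e1, e2⟩ := h.div_eq_rho hz h1 h2
  obtain ⟨e3, e4⟩ := h.div_eq_rho hzi hi1 hi2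
  have w1 := weight_eq h.norm_q_lt ha hb hcd hz
  have w2 := weight_eq (a := q * a) (b := q * b) h.norm_q_lt (by rw [map_mul, hqr, ha])
    (by rw [map_mul, hqr, hb]) hcd hz
  rw [e1, e3] at w1
  rw [e2, e4] at w2
  -- The first components match because `T₁⁻¹` contributes `-(ab)⁻¹`. For the second components,
  -- `T₁⁻¹` contributes `-1` and `qAux * reflect qAux` contributes `a² (1-az)(1-bz)(1-a/z)(1-b/z)`,
  -- which gives the factor `-a³b`.
  have hC := constC_mul_weightConst (a := a) (b := b) (c := c) (d := d) h.norm_q_lt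
  have hp : polyE a b c d q n = ofVec a b (vecE a b c d q n) := (ofVec_vecE h' n).symm
  have hab0 := mul_ne_zero h'.a0 h'.b0
  rw [hp, opT1Inv_ofVec h'.a0 h'.b0 h'.ab_ne_one, vecFst_ofVec_mul_ofVec h'.ab_ne_one]
  simp only [matW, Matrix.mulVec, dotProduct, Fin.sum_univ_two, evalVec, Matrix.of_apply,
    Matrix.cons_val_zero, Matrix.cons_val_one, zero_mul, add_zero, zero_add, w1, w2]
  simp only [evalAt_sub _ _ h0, evalAt_mul _ _ h0, evalAt_reflect _ h0, qAux, evalAt_one h0,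
    evalAt_C _ h0, evalAt_T _ h0, Submodule.coe_smul, Submodule.coe_neg, evalAt_smul _ _ h0,
    evalAt_mul _ _ (inv_ne_zero h0), evalAt_sub _ _ (inv_ne_zero h0), evalAt_one (inv_ne_zero h0),
    evalAt_C _ (inv_ne_zero h0), evalAt_T _ (inv_ne_zero h0), zpow_neg, zpow_one, inv_inv,
    transformConst, density]
  rw [← neg_one_smul ℂ ((vecE a b c d q n).2 : ℂ[T;T⁻¹]), evalAt_smul _ _ h0]
  have hzz : z * z⁻¹ = 1 := mul_inv_cancel₀ h0
  have hi : a * b * (a * b)⁻¹ = 1 := mul_inv_cancel₀ hab0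
  clear e1 e2 e3 e4 w1 w2 hp hzi hi1 hi2
  generalize weightConst a b c d q = κ at *
  generalize weightConst (q * a) (q * b) c d q = κ' at *
  generalize constC a b c d q = γ at *
  generalize rho ![a, b, c, d] q z = ρ
  generalize rho ![a, b, c, d] q z⁻¹ = ρ'
  generalize evalAt (f.1 : ℂ[T;T⁻¹]) z = f₁
  generalize evalAt (f.2 : ℂ[T;T⁻¹]) z = f₂
  generalize evalAt ((vecE a b c d q n).1 : ℂ[T;T⁻¹]) z = e₁
  generalize evalAt ((vecE a b c d q n).2 : ℂ[T;T⁻¹]) z = e₂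
  generalize z⁻¹ = y at *
  generalize (a * b)⁻¹ = w at *
  linear_combination
    ((1 - a * z) * (1 - b * z) * (1 - a * y) * (1 - b * y) * ρ * ρ' * f₂ * e₂) * hC +
    ((1 - a * z) * (1 - b * z) * (1 - a * y) * (1 - b * y) * ρ * ρ' * f₂ * e₂ *
      a ^ 3 * b * κ) * hzz - (f₁ * e₁ * κ * ρ * ρ') * hi

end Weight

end

section
/-! ### The intertwining properties of the transform -/

section Intertwining

variable {a b c d : ℂ} {q : ℝ}

theorem opU_vecE (h : Admissible a b c d q) (n : ℤ) :
    opU Vec2 a b c d q (vecE a b c d q) n = boldT1 a b (vecE a b c d q n) := by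
  apply ofVec_injective h.a0 h.ab_ne_one
  rw [boldT1, ofVec_bold h.a0 h.ab_ne_one, opU, map_bandOp]
  simp only [ofVec_vecE h]
  exact (opT1_polyE' h n).symm

variable (h : UnitDisc ![a, b, c, d] q) (h' : Admissible a b c d q)
  (ha : starRingEnd ℂ a = a) (hb : starRingEnd ℂ b = b)
  (hcd : (starRingEnd ℂ c = c ∧ starRingEnd ℂ d = d) ∨ d = starRingEnd ℂ c)

/-- The linear form `g ↦ ⟨p, T₁⁻¹ g⟩` defining the transform. -/
def transformForm (h : UnitDisc ![a, b, c, d] q) (p : ℂ[T;T⁻¹]) : ℂ[T;T⁻¹] →ₗ[ℂ] ℂ :=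
  transformConst a b c d q • (moment h ∘ₗ Sym.subtype ∘ₗ vecFst a b ∘ₗ LinearMap.mulLeft ℂ p ∘ₗ
    opT1Inv a b)

theorem transformForm_apply (p g : ℂ[T;T⁻¹]) : transformForm h p g =
    transformConst a b c d q * moment h (vecFst a b (p * opT1Inv a b g)) := rfl

include h' in
theorem transformForm_opT1 (p g : ℂ[T;T⁻¹]) :
    transformForm h p (opT1 a b g) = transformForm h (opT1 a b p) g := by
  rw [transformForm_apply, transformForm_apply, opT1Inv_opT1 h'.a0 h'.b0 h'.ab_ne_one,
    vecFst_opT1_mul h'.a0 h'.ab_ne_one, opT1_opT1Inv h'.a0 h'.b0 h'.ab_ne_one]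

include h' in
-- `⟨p, T₁⁻¹ T₁ T₀ g⟩ = ⟨p, T₀ g⟩ = ⟨T₀ p, g⟩ = ⟨T₁ T₀ p, T₁⁻¹ g⟩`.
theorem transformForm_opY (p g : ℂ[T;T⁻¹]) :
    transformForm h p (opY a b c d q g) = transformForm h (opY a b c d q p) g := by
  rw [transformForm_apply, transformForm_apply, opY, LinearMap.comp_apply, LinearMap.comp_apply,
    opT1Inv_opT1 h'.a0 h'.b0 h'.ab_ne_one, vecFst_opT1_mul h'.a0 h'.ab_ne_one,
    opT1_opT1Inv h'.a0 h'.b0 h'.ab_ne_one, moment_vecFst_opT0 h h'.ab_ne_one]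

include h' in
-- `⟨p, T₁⁻¹ Z⁻¹ g⟩ = ⟨Z⁻¹ T₁⁻¹ p, g⟩ = ⟨T₁ Z⁻¹ T₁⁻¹ p, T₁⁻¹ g⟩`; this is where the conjugate of
-- `Z⁻¹` comes from.
theorem transformForm_opZInv (p g : ℂ[T;T⁻¹]) :
    transformForm h p (opZInv g) = transformForm h (opT1 a b (opZInv (opT1Inv a b p))) g := by
  rw [transformForm_apply, transformForm_apply, ← vecFst_opT1Inv_mul h'.a0 h'.ab_ne_one,
    vecFst_opT1_mul h'.a0 h'.ab_ne_one, opT1_opT1Inv h'.a0 h'.b0 h'.ab_ne_one, opZInv_apply,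
    opZInv_apply, mul_left_comm, mul_assoc]

include h h' ha hb hcd in
theorem awTransform_eq_transformForm (f : Vec2) :
    awTransform a b c d q f = fun n => transformForm h (ofVec a b f) (polyE a b c d q n) :=
  funext fun n => awTransform_eq h h' ha hb hcd f n

include h h' ha hb hcd in
theorem opU_awTransform (f : Vec2) : opU ℂ a b c d q (awTransform a b c d q f) =
    awTransform a b c d q (boldT1 a b f) := by
  simp only [awTransform_eq_transformForm h h' ha hb hcd]
  funext n
  rw [boldT1, ofVec_bold h'.a0 h'.ab_ne_one, ← transformForm_opT1 h h', opT1_polyE' h', opU, opU,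
    map_bandOp]

include h h' ha hb hcd in
theorem opN_awTransform (f : Vec2) : opN ℂ a b c d q (awTransform a b c d q f) =
    awTransform a b c d q (boldY a b c d q f) := by
  simp only [awTransform_eq_transformForm h h' ha hb hcd]
  funext n
  rw [boldY, ofVec_bold h'.a0 h'.ab_ne_one, ← transformForm_opY h h', opY_polyE' h', opN, opN,
    map_bandOp]

include h h' ha hb hcd in
theorem opM_awTransform (f : Vec2) : opM ℂ a b c d q (awTransform a b c d q f) =
    awTransform a b c d q (boldT1 a b (boldZInv a b (boldT1Inv a b f))) := by
  simp only [awTransform_eq_transformForm h h' ha hb hcd]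
  funext n
  rw [boldT1, boldZInv, boldT1Inv, ofVec_bold h'.a0 h'.ab_ne_one, ofVec_bold h'.a0 h'.ab_ne_one,
    ofVec_bold h'.a0 h'.ab_ne_one, ← transformForm_opZInv h h', opZInv_polyE h', opM, opM,
    map_bandOp]

end Intertwining

/-! ### The parameter conditions -/

section Parameters

theorem one_sub_mul_pow_ne_zero_of_ne_one {q : ℝ} (hq0 : 0 < q) (hq1 : q < 1) {x : ℂ}
    (hx : ‖x‖ ≤ 1) (h1 : x ≠ 1) (k : ℕ) : 1 - x * (q : ℂ) ^ k ≠ 0 := by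
  rw [sub_ne_zero]
  intro e
  cases k with
  | zero => exact h1 (by simpa using e.symm)
  | succ k =>
    have e' := congrArg norm e
    rw [norm_one, norm_mul, norm_pow, Complex.norm_real, Real.norm_of_nonneg hq0.le] at e'
    have : q ^ (k + 1) < 1 := pow_lt_one₀ hq0.le hq1 k.succ_ne_zero
    nlinarith [norm_nonneg x, pow_pos hq0 (k + 1)]

theorem eq_one_or_neg_one_of_im_eq_zero {x : ℂ} (hx : x.im = 0) (h1 : ‖x‖ = 1) :
    x = 1 ∨ x = -1 := by
  have e : x = (x.re : ℂ) := Complex.ext rfl (by simpa using hx)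
  rw [e, Complex.norm_real, Real.norm_eq_abs] at h1
  rw [e]
  rcases eq_or_eq_neg_of_abs_eq h1 with h | h <;> rw [h] <;> simp

variable {a b q : ℝ} {c d : ℂ} (hq0 : 0 < q) (hq1 : q < 1)
  (ha : |a| ≤ 1) (hb : |b| ≤ 1) (hc : ‖c‖ ≤ 1) (hd : ‖d‖ ≤ 1) (hab : a * b < 0)
  (hcd_conj : (c.im = 0 ∧ d.im = 0) ∨ d = starRingEnd ℂ c)
  (hac : (a : ℂ) * c ≠ 1) (had : (a : ℂ) * d ≠ 1)
  (hbc : (b : ℂ) * c ≠ 1) (hbd : (b : ℂ) * d ≠ 1) (hcd : c * d ≠ 1)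

include hab in
theorem ofReal_mul_ne_one_of_neg : (a : ℂ) * b ≠ 1 := by
  intro e
  rw [← Complex.ofReal_mul, Complex.ofReal_eq_one] at e
  linarith

include hcd hcd_conj in
-- In the conjugate case `cd = |c|²`, so `cd ≠ 1` excludes the unit circle altogether.
theorem eq_one_or_neg_one_of_conj : (‖c‖ = 1 → c = 1 ∨ c = -1) ∧ (‖d‖ = 1 → d = 1 ∨ d = -1) := by
  rcases hcd_conj with ⟨h1, h2⟩ | rfl
  · exact ⟨eq_one_or_neg_one_of_im_eq_zero h1, eq_one_or_neg_one_of_im_eq_zero h2⟩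
  · have : ‖c‖ ≠ 1 := fun e => hcd (by rw [Complex.mul_conj', e]; simp)
    rw [Complex.norm_conj]
    exact ⟨fun e => (this e).elim, fun e => (this e).elim⟩

include hq0 hq1 ha hb hc hd hab hcd_conj hac had hbc hbd hcd in
theorem unitDisc_of_parameters : UnitDisc ![(a : ℂ), b, c, d] q where
  pos := hq0
  lt_one := hq1
  norm_le := by
    simpa [Fin.forall_fin_succ, Complex.norm_real] using ⟨ha, hb, hc, hd⟩
  eq_or := by
    obtain ⟨h1, h2⟩ := eq_one_or_neg_one_of_conj hcd_conj hcd
    intro i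
    fin_cases i
    · exact eq_one_or_neg_one_of_im_eq_zero (Complex.ofReal_im a)
    · exact eq_one_or_neg_one_of_im_eq_zero (Complex.ofReal_im b)
    · exact h1
    · exact h2
  mul_ne_one := by
    have hab' := ofReal_mul_ne_one_of_neg hab
    have key : ∀ i j : Fin 4, i < j → (![(a : ℂ), b, c, d]) i * (![(a : ℂ), b, c, d]) j ≠ 1 := by
      intro i j hij
      fin_cases i <;> fin_cases j <;> first | exact absurd hij (by decide) | assumption
    intro i j hij
    rcases lt_or_gt_of_ne hij with h | h
    · exact key i j h
    · rw [mul_comm]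
      exact key j i h

include hc hd in
theorem norm_mul_le_one : ‖c * d‖ ≤ 1 := by
  rw [norm_mul]
  exact mul_le_one₀ hc (norm_nonneg d) hd

include ha hb hc hd hab hcd_conj hac had hcd in
-- If `abcd = 1`, all moduli are `1`, so `ab = -1` because `ab < 0`, and then `cd = -1`. The
-- parameters are signs, and `a` equals one of `c`, `d`, contradicting `ac ≠ 1` and `ad ≠ 1`.
theorem mul_mul_mul_ne_one : (a : ℂ) * b * c * d ≠ 1 := by
  intro e
  have na : ‖(a : ℂ)‖ ≤ 1 := by simpa using ha
  have nb : ‖(b : ℂ)‖ ≤ 1 := by simpa using hb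
  have e' := congrArg norm e
  rw [norm_mul, norm_mul, norm_one] at e'
  have n1 := norm_mul_le_one na nb
  have n2 := mul_le_one₀ n1 (norm_nonneg c) hc
  have n0 := norm_nonneg ((a : ℂ) * b)
  have m1 := norm_nonneg c
  have m2 := norm_nonneg d
  -- A product of numbers in `[0, 1]` equals `1` only if every factor does.
  have hd1 : ‖d‖ = 1 := by nlinarith [mul_nonneg n0 m1]
  have hc1 : ‖c‖ = 1 := by rw [hd1] at e'; nlinarith
  have hab1 : ‖(a : ℂ) * b‖ = 1 := by rw [hd1, hc1] at e'; linarith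
  have ha1 : ‖(a : ℂ)‖ = 1 := by
    rw [norm_mul] at hab1
    nlinarith [norm_nonneg (a : ℂ), norm_nonneg (b : ℂ)]
  have hab2 : (a : ℂ) * b = -1 := by
    rw [← Complex.ofReal_mul, Complex.norm_real, Real.norm_eq_abs, abs_of_neg hab] at hab1
    rw [← Complex.ofReal_mul, ← neg_neg (a * b), hab1]
    simp
  have hcd2 : c * d = -1 := by rw [hab2] at e; linear_combination -e
  obtain ⟨h1, h2⟩ := eq_one_or_neg_one_of_conj hcd_conj hcd
  rcases eq_one_or_neg_one_of_im_eq_zero (Complex.ofReal_im a) ha1 with h | h <;> rw [h] at hac had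
    <;> rcases h1 hc1 with h3 | h3 <;> rw [h3] at hac hcd2
  · exact hac (one_mul 1)
  · exact had (by linear_combination -hcd2)
  · exact had (by linear_combination -hcd2)
  · exact hac (by norm_num)

include hq0 hq1 ha hb hc hd hab hcd_conj hac had hbc hbd hcd in
theorem admissible_of_parameters (hc0 : c ≠ 0) (hd0 : d ≠ 0) (habcd : (a : ℂ) * b * c * d ≠ q) :
    Admissible (a : ℂ) b c d q := by
  have na : ‖(a : ℂ)‖ ≤ 1 := by simpa using ha
  have nb : ‖(b : ℂ)‖ ≤ 1 := by simpa using hb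
  have key := fun {x : ℂ} => one_sub_mul_pow_ne_zero_of_ne_one (x := x) hq0 hq1
  exact {
    a0 := Complex.ofReal_ne_zero.mpr (left_ne_zero_of_mul hab.ne)
    b0 := Complex.ofReal_ne_zero.mpr (right_ne_zero_of_mul hab.ne)
    c0 := hc0
    d0 := hd0
    q0 := Complex.ofReal_ne_zero.mpr hq0.ne'
    qq := fun k => by
      rw [pow_succ']
      refine key (by simpa [abs_of_pos hq0] using hq1.le) ?_ k
      exact fun e => hq1.ne (Complex.ofReal_eq_one.mp e)
    ab := key (norm_mul_le_one na nb) (ofReal_mul_ne_one_of_neg hab)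
    ac := key (norm_mul_le_one na hc) hac
    ad := key (norm_mul_le_one na hd) had
    bc := key (norm_mul_le_one nb hc) hbc
    bd := key (norm_mul_le_one nb hd) hbd
    abcd := key (norm_mul_le_one (norm_mul_le_one (norm_mul_le_one na nb) hc) hd)
      (mul_mul_mul_ne_one ha hb hc hd hab hcd_conj hac had hcd)
    abcdq := sub_ne_zero.mpr habcd.symm }

end Parameters

end

end AskeyWilson

end

theorem mainTheorem8 (a b q : ℝ) (c d : ℂ)
    (hq0 : 0 < q) (hq1 : q < 1)
    (ha : |a| ≤ 1) (hb : |b| ≤ 1) (hc : ‖c‖ ≤ 1) (hd : ‖d‖ ≤ 1)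
    (hab : a * b < 0) (hc0 : c ≠ 0) (hd0 : d ≠ 0)
    (hcd_conj : (c.im = 0 ∧ d.im = 0) ∨ d = starRingEnd ℂ c)
    (hac : (a : ℂ) * c ≠ 1) (had : (a : ℂ) * d ≠ 1)
    (hbc : (b : ℂ) * c ≠ 1) (hbd : (b : ℂ) * d ≠ 1) (hcd : c * d ≠ 1)
    (habcd : (a : ℂ) * b * c * d ≠ q) :
    -- `U` extends the action of `𝐓₁` on the vectors `E_n`
    (∀ n : ℤ, opU Vec2 a b c d q (vecE a b c d q) n = boldT1 a b (vecE a b c d q n)) ∧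
    -- the transform intertwines `𝐓₁ 𝐙⁻¹ 𝐓₁⁻¹`, `𝐘`, `𝐓₁` with `M`, `N`, `U`
    (∀ f : Vec2, opM ℂ a b c d q (awTransform a b c d q f) =
      awTransform a b c d q (boldT1 a b (boldZInv a b (boldT1Inv a b f)))) ∧
    (∀ f : Vec2, opN ℂ a b c d q (awTransform a b c d q f) = awTransform a b c d q (boldY a b c d q f)) ∧
    (∀ f : Vec2, opU ℂ a b c d q (awTransform a b c d q f) = awTransform a b c d q (boldT1 a b f)) ∧
    -- the anti-representation of the DAHA on functions on `ℤ`
    (∃! ρ : Daha a b c d q →ₐ[ℂ] (Module.End ℂ (ℤ → ℂ))ᵐᵒᵖ,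
      ρ (Daha.T1 a b c d q) = MulOpposite.op (opU ℂ a b c d q) ∧
      ρ (Daha.Y a b c d q) = MulOpposite.op (opN ℂ a b c d q) ∧
      ρ (Daha.ZInv a b c d q) = MulOpposite.op (opM ℂ a b c d q)) ∧
    -- the closing isomorphisms
    (∃ Φ : opAlgebra a b c d q ≃ₐ[ℂ] Daha a b c d q,
      (Φ.symm (Daha.T1 a b c d q) : Module.End ℂ (ℤ → ℂ)) = opU ℂ a b c d q ∧
      (Φ.symm (Daha.Y a b c d q) : Module.End ℂ (ℤ → ℂ)) = opN ℂ a b c d q ∧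
      (Φ.symm (Daha.T1 a b c d q * Daha.ZInv a b c d q * Daha.T1Inv a b c d q) :
        Module.End ℂ (ℤ → ℂ)) = opM ℂ a b c d q) ∧
    (∃ Ψ : Daha a b c d q ≃ₐ[ℂ] (Daha a b c d q)ᵐᵒᵖ,
      Ψ (Daha.T1 a b c d q) = MulOpposite.op (Daha.T1 a b c d q) ∧
      Ψ (Daha.Y a b c d q) = MulOpposite.op (Daha.Y a b c d q) ∧
      Ψ (Daha.T1 a b c d q * Daha.ZInv a b c d q * Daha.T1Inv a b c d q) =
        MulOpposite.op (Daha.ZInv a b c d q)) := by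
  have h := unitDisc_of_parameters hq0 hq1 ha hb hc hd hab hcd_conj hac had hbc hbd hcd
  have h' := admissible_of_parameters hq0 hq1 ha hb hc hd hab hcd_conj hac had hbc hbd hcd hc0 hd0
    habcd
  have hra : starRingEnd ℂ (a : ℂ) = a := Complex.conj_ofReal a
  have hrb : starRingEnd ℂ (b : ℂ) = b := Complex.conj_ofReal b
  have hconj : (starRingEnd ℂ c = c ∧ starRingEnd ℂ d = d) ∨ d = starRingEnd ℂ c :=
    hcd_conj.imp_left (And.imp Complex.conj_eq_iff_im.mpr Complex.conj_eq_iff_im.mpr)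
  refine ⟨opU_vecE h', opM_awTransform h h' hra hrb hconj, opN_awTransform h h' hra hrb hconj,
    opU_awTransform h h' hra hrb hconj, h'.existsUnique_antiRep, ⟨h'.opAlgebraEquiv, ?_, ?_, ?_⟩,
    ⟨Daha.antiEquiv h', ?_, ?_, ?_⟩⟩
  · rw [h'.opAlgebraEquiv_symm_apply, h'.funRep_T1]
  · rw [h'.opAlgebraEquiv_symm_apply, h'.funRep_Y]
  · rw [h'.opAlgebraEquiv_symm_apply, h'.funRep_conj_ZInv]
  · rw [Daha.antiEquiv_apply, Daha.anti_T1]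
  · rw [Daha.antiEquiv_apply, Daha.anti_Y]
  · rw [Daha.antiEquiv_apply, Daha.anti_conj_ZInv]
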